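/- Let $X$ be a finite totally ordered set with $|X|=m\ge 2$, identified with $\{0,\dots,m-1\}$ by its unique order isomorphism. Let $n\ge 1$, $\varepsilon\in(0,1]$, $k\ge 1$ an integer, $L_f>0$, $L\ge 0$, and let $\ell:[0,1]^2\to\mathbb{R}$ be $L$-Lipschitz in its first argument, i.e. $|\ell(a,y)-\ell(b,y)|\le L|a-b|$. For $f:X\to[0,1]$ and a dataset $D=((x_1,y_1),\dots,(x_n,y_n))\in(X\times[0,1])^n$ let $\mathcal{L}(f;D)=\frac1n\sum_{i=1}^n\ell(f(x_i),y_i)$. Let $\mathcal{F}$ be the set of all monotone (non-decreasing) functions $f:X\to[0,1]$ that satisfy one of the following extra constraints: 1. $k$-piecewise constant: the domain is partitioned into at most $k$ consecutive intervals, and $f$ is constant on each of them; 2. $k$-piecewise linear: the same with "affine" in place of "constant"; or, in the continuous version, there are breakpoints $0=t_0\le t_1\le\dots\le t_k=m-1$ such that $f$ is affine on each $\{t_s,t_s+1,\dots,t_{s+1}\}$, end points included (the claim holds for each of the two versions); 3. $L_f$-Lipschitz: $|f(i)-f(j)|\le L_f|i-j|$ for all $i,j$; 4. convex: $2f(i+1)\le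 f(i)+f(i+2)$ for all $i$ with $i+2<m$; 5. concave: $2f(i+1)\ge f(i)+f(i+2)$ for all $i$ with $i+2<m$. Then for each of these constraints there are a randomized algorithm $\mathcal{M}$ and constants $C,c,d$ (depending on nothing but the type of constraint) such that, for all $X,n,\varepsilon,k,L_f,L,\ell$ as above, where $m,n,\varepsilon,L,k,L_f$ and $D$ are its input and $\ell$ is accessed as an oracle: * $\mathcal{M}$ is $\varepsilon$-differentially private: $\Pr[\mathcal{M}(D)\in S]\le e^{\varepsilon}\Pr[\mathcal{M}(D')\in S]$ for all sets $S$ of outputs and all $D,D'$ that differ in at most one example; * $\mathcal{M}(D)\in\mathcal{F}$ always, and its expected excess empirical risk is $\tilde O\left(\frac{L\log|X|}{\varepsilon n}\right)$, that is, for every $D$, $$\mathbb{E}[\mathcal{L}(\mathcal{M}(D);D)]-\inf_{g\in\mathcal{F}}\mathcal{L}(g;D)\le C\cdot\frac{L\log|X|}{\varepsilon n}\cdot(1+\log n)^c;$$ * $\mathcal{M}$ always halts within $(n|X|)^{d}$ steps. The model of computation is a randomized real RAM: arithmetic and comparison on natural numbers ($+$, truncated $-$, $\times$) and on reals ($+,-,\times,/,\exp$),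 evaluations of $\ell$, indexed memory access, and coin flips with a given real bias cost one step each. -/

import Mathlib

/-! Differentially private isotonic regression with additional shape constraints,
computed by randomized real-RAM programs with an explicit step count. -/

noncomputable section

namespace PrivIso

/-! ### Regression problem -/

/-- A dataset: `n` labelled examples in `X × [0, 1]`. -/
abbrev Dataset (X : Type*) (n : ℕ) : Type _ := Fin n → X × Set.Icc (0 : ℝ) 1

/-- Two datasets are neighbouring if they differ in at most one example. -/
def Neighboring {X : Type*} {n : ℕ} (D D' : Dataset X n) : Prop :=
  ∃ i, ∀ j, j ≠ i → D j = D' j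

/-- `ℓ (prediction) (label)` is `L`-Lipschitz in the prediction, on the unit square.
The values of `ℓ` outside of the unit square are never constrained. -/
def LipschitzLoss (L : ℝ) (ℓ : ℝ → ℝ → ℝ) : Prop :=
  ∀ a ∈ Set.Icc (0 : ℝ) 1, ∀ b ∈ Set.Icc (0 : ℝ) 1, ∀ y ∈ Set.Icc (0 : ℝ) 1,
    |ℓ a y - ℓ b y| ≤ L * |a - b|

/-- The empirical risk of `f` on `D`. -/
def risk {X : Type*} {n : ℕ} (ℓ : ℝ → ℝ → ℝ) (f : X → ℝ) (D : Dataset X n) : ℝ :=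
  (1 / (n : ℝ)) * ∑ i, ℓ (f (D i).1) ((D i).2 : ℝ)

/-- Pure `ε`-differential privacy of a mechanism with discrete output distributions. -/
def PureDP {X : Type*} {n : ℕ} {Out : Type*} (ε : ℝ) (M : Dataset X n → PMF Out) : Prop :=
  ∀ D D', Neighboring D D' → ∀ S : Set Out,
    (M D).toOuterMeasure S ≤ ENNReal.ofReal (Real.exp ε) * (M D').toOuterMeasure S

/-! ### Shape constraints on functions on `{0, …, m - 1}` -/

/-- `f` is constant on each of at most `k` consecutive intervals that partition the domain;
`c i` is the number of the interval that contains `i`. -/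
def PiecewiseConstant {m : ℕ} (k : ℕ) (f : Fin m → ℝ) : Prop :=
  ∃ c : Fin m → Fin k, Monotone c ∧ ∃ a : Fin k → ℝ, ∀ i, f i = a (c i)

/-- `f` is affine on each of at most `k` consecutive intervals that partition the domain. -/
def PiecewiseLinear {m : ℕ} (k : ℕ) (f : Fin m → ℝ) : Prop :=
  ∃ c : Fin m → Fin k, Monotone c ∧ ∃ a b : Fin k → ℝ, ∀ i, f i = a (c i) + b (c i) * (i : ℝ)

/-- The continuous version of the previous notion: there are breakpoints
`0 = t 0 ≤ t 1 ≤ ⋯ ≤ t k = m - 1` such that `f` is affine on each `[t s, t (s + 1)]`,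
both end points included (so that consecutive affine pieces agree at their common breakpoint). -/
def ContPiecewiseLinear {m : ℕ} (k : ℕ) (f : Fin m → ℝ) : Prop :=
  ∃ t : Fin (k + 1) → Fin m, Monotone t ∧ (t 0 : ℕ) = 0 ∧ (t (Fin.last k) : ℕ) + 1 = m ∧
    ∃ a b : Fin k → ℝ, ∀ s : Fin k, ∀ i, t s.castSucc ≤ i → i ≤ t s.succ →
      f i = a s + b s * (i : ℝ)

/-- `f` is `K`-Lipschitz for the distance `|i - j|`. -/
def LipschitzSeq {m : ℕ} (K : ℝ) (f : Fin m → ℝ) : Prop :=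
  ∀ i j : Fin m, |f i - f j| ≤ K * |(i : ℝ) - (j : ℝ)|

/-- `f` is (discretely) convex. -/
def ConvexSeq {m : ℕ} (f : Fin m → ℝ) : Prop :=
  ∀ (i : ℕ) (h : i + 2 < m),
    2 * f ⟨i + 1, by omega⟩ ≤ f ⟨i, by omega⟩ + f ⟨i + 2, h⟩

/-- `f` is (discretely) concave. -/
def ConcaveSeq {m : ℕ} (f : Fin m → ℝ) : Prop :=
  ∀ (i : ℕ) (h : i + 2 < m),
    f ⟨i, by omega⟩ + f ⟨i + 2, h⟩ ≤ 2 * f ⟨i + 1, by omega⟩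

/-- The variants of constrained isotonic regression. -/
inductive Variant
  | piecewiseConstant
  | piecewiseLinear
  | contPiecewiseLinear
  | lipschitz
  | convex
  | concave

/-- The extra constraint of a variant; `k` is the number of pieces, `Lf` the Lipschitz constant
(each variant uses at most one of the two). -/
def Shape (v : Variant) (k : ℕ) (Lf : ℝ) {m : ℕ} (f : Fin m → ℝ) : Prop :=
  match v with
  | .piecewiseConstant => PiecewiseConstant k f
  | .piecewiseLinear => PiecewiseLinear k f
  | .contPiecewiseLinear => ContPiecewiseLinear k f
  | .lipschitz => LipschitzSeq Lf f
  | .convex => ConvexSeq f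
  | .concave => ConcaveSeq f

/-- The unique order isomorphism of a finite totally ordered set with `{0, …, |X| - 1}`. -/
def rankIso (X : Type*) [LinearOrder X] [Fintype X] : Fin (Fintype.card X) ≃o X :=
  monoEquivOfFin X rfl

/-- The functions over which the variant `v` of isotonic regression ranges: monotone functions
`X → [0, 1]` that satisfy the extra constraint. -/
def feasible (v : Variant) (k : ℕ) (Lf : ℝ) (X : Type*) [LinearOrder X] [Fintype X] :
    Set (X → ℝ) :=
  {f | Monotone f ∧ (∀ x, f x ∈ Set.Icc (0 : ℝ) 1) ∧ Shape v k Lf (f ∘ rankIso X)}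

/-! ### Randomized real-RAM programs

The memory holds natural numbers and reals in finitely many named (for each program)
random-access arrays. Arithmetic on naturals (`+`, truncated `-`, `*`), exact arithmetic on reals
(`+`, `-`, `*`, `/`, `exp`), comparisons, evaluations of the loss function and coin flips of a
given bias cost one step each; there is no rounding from reals to naturals. Loops are counted
loops whose bound is evaluated on entry, so that every program halts on every input. -/

/-- A memory: `nat a i` and `real a i` are the `i`-th cells of the `a`-th arrays. -/
structure Mem where
  nat : ℕ → ℕ → ℕ
  real : ℕ → ℕ → ℝ

/-- Store a natural number. -/
def Mem.setNat (s : Mem) (a i v : ℕ) : Mem :=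
  { s with nat := Function.update s.nat a (Function.update (s.nat a) i v) }

/-- Store a real number. -/
def Mem.setReal (s : Mem) (a i : ℕ) (v : ℝ) : Mem :=
  { s with real := Function.update s.real a (Function.update (s.real a) i v) }

/-- Expressions for naturals. -/
inductive NExp
  | const (c : ℕ)
  | get (a : ℕ) (i : NExp)
  | add (e e' : NExp)
  | sub (e e' : NExp)
  | mul (e e' : NExp)

/-- The value of an expression. -/
def NExp.eval (s : Mem) : NExp → ℕ
  | .const c => c
  | .get a i => s.nat a (i.eval s)
  | .add e e' => e.eval s + e'.eval s
  | .sub e e' => e.eval s - e'.eval s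
  | .mul e e' => e.eval s * e'.eval s

/-- The number of steps that the evaluation takes. -/
def NExp.cost : NExp → ℕ
  | .const _ => 1
  | .get _ i => i.cost + 1
  | .add e e' => e.cost + e'.cost + 1
  | .sub e e' => e.cost + e'.cost + 1
  | .mul e e' => e.cost + e'.cost + 1

/-- Expressions for reals. -/
inductive RExp
  | cast (e : NExp)
  | get (a : ℕ) (i : NExp)
  | add (e e' : RExp)
  | sub (e e' : RExp)
  | mul (e e' : RExp)
  | div (e e' : RExp)
  | exp (e : RExp)
  | loss (e e' : RExp)

/-- The value of an expression; `ℓ` is the loss function, which programs access as an oracle. -/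
def RExp.eval (ℓ : ℝ → ℝ → ℝ) (s : Mem) : RExp → ℝ
  | .cast e => (e.eval s : ℝ)
  | .get a i => s.real a (i.eval s)
  | .add e e' => e.eval ℓ s + e'.eval ℓ s
  | .sub e e' => e.eval ℓ s - e'.eval ℓ s
  | .mul e e' => e.eval ℓ s * e'.eval ℓ s
  | .div e e' => e.eval ℓ s / e'.eval ℓ s
  | .exp e => Real.exp (e.eval ℓ s)
  | .loss e e' => ℓ (e.eval ℓ s) (e'.eval ℓ s)

/-- The number of steps that the evaluation takes. -/
def RExp.cost : RExp → ℕ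
  | .cast e => e.cost + 1
  | .get _ i => i.cost + 1
  | .add e e' => e.cost + e'.cost + 1
  | .sub e e' => e.cost + e'.cost + 1
  | .mul e e' => e.cost + e'.cost + 1
  | .div e e' => e.cost + e'.cost + 1
  | .exp e => e.cost + 1
  | .loss e e' => e.cost + e'.cost + 1

/-- Tests. -/
inductive Test
  | natLe (e e' : NExp)
  | realLe (e e' : RExp)

/-- The truth of a test. -/
def Test.Holds (ℓ : ℝ → ℝ → ℝ) (s : Mem) : Test → Prop
  | .natLe e e' => e.eval s ≤ e'.eval s
  | .realLe e e' => e.eval ℓ s ≤ e'.eval ℓ s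

/-- The number of steps that a test takes. -/
def Test.cost : Test → ℕ
  | .natLe e e' => e.cost + e'.cost + 1
  | .realLe e e' => e.cost + e'.cost + 1

/-- Programs. -/
inductive Prog
  /-- do nothing -/
  | skip
  /-- `nat a [i] := e` -/
  | setNat (a : ℕ) (i e : NExp)
  /-- `real a [i] := e` -/
  | setReal (a : ℕ) (i : NExp) (e : RExp)
  /-- `nat a [i] := 1` with probability `p` (clipped to `[0, 1]`), and `:= 0` otherwise -/
  | flip (a : ℕ) (i : NExp) (p : RExp)
  /-- sequential composition -/
  | seq (p q : Prog)
  /-- branching -/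
  | ite (b : Test) (p q : Prog)
  /-- `for nat a [0] := 0, …, e - 1 do p` -/
  | forTo (a : ℕ) (e : NExp) (p : Prog)

/-- A coin that shows `true` with probability `p`, clipped to `[0, 1]`. -/
def coin (p : ℝ) : PMF Bool :=
  PMF.ofFintype (fun b => if b then min 1 (ENNReal.ofReal p) else 1 - min 1 (ENNReal.ofReal p))
    (by simp)

/-- `N` rounds of a loop with counter cell `nat a [0]`, started in `s`. -/
def loop (a : ℕ) (body : Mem → PMF (Mem × ℕ)) (s : Mem) : ℕ → PMF (Mem × ℕ)
  | 0 => PMF.pure (s, 0)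
  | j + 1 => (loop a body s j).bind fun r =>
      (body (r.1.setNat a 0 j)).map fun r' => (r'.1, r.2 + r'.2 + 1)

open Classical in
/-- The joint distribution of the final memory and the number of steps of a run. -/
def Prog.run (ℓ : ℝ → ℝ → ℝ) : Prog → Mem → PMF (Mem × ℕ)
  | .skip, s => PMF.pure (s, 1)
  | .setNat a i e, s => PMF.pure (s.setNat a (i.eval s) (e.eval s), i.cost + e.cost + 1)
  | .setReal a i e, s => PMF.pure (s.setReal a (i.eval s) (e.eval ℓ s), i.cost + e.cost + 1)
  | .flip a i p, s => (coin (p.eval ℓ s)).map fun b =>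
      (s.setNat a (i.eval s) (if b then 1 else 0), i.cost + p.cost + 1)
  | .seq p q, s => (p.run ℓ s).bind fun r => (q.run ℓ r.1).map fun r' => (r'.1, r.2 + r'.2)
  | .ite b p q, s => (if b.Holds ℓ s then p.run ℓ s else q.run ℓ s).map fun r =>
      (r.1, r.2 + b.cost)
  | .forTo a e p, s => (loop a (p.run ℓ) s (e.eval s)).map fun r => (r.1, r.2 + e.cost + 1)

/-- The real parameters of the problem, given to the program as part of its input. -/
structure Params where
  /-- privacy parameter -/
  ε : ℝ
  /-- Lipschitz constant of the loss function -/
  L : ℝ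
  /-- bound on the number of pieces -/
  k : ℕ
  /-- bound on the Lipschitz constant of the regression function -/
  Lf : ℝ

/-- The initial memory: array `0` of naturals holds `|X|, n, k`, array `1` of naturals the ranks
of `x₁, …, xₙ`, array `0` of reals holds `ε, L, Lf`, array `1` of reals holds `y₁, …, yₙ`;
everything else is zero. -/
def initMem {X : Type*} [LinearOrder X] [Fintype X] {n : ℕ} (θ : Params) (D : Dataset X n) :
    Mem where
  nat a i :=
    if a = 0 then
      if i = 0 then Fintype.card X else if i = 1 then n else if i = 2 then θ.k else 0
    else if a = 1 then
      if h : i < n then ((rankIso X).symm (D ⟨i, h⟩).1 : ℕ) else 0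
    else 0
  real a i :=
    if a = 0 then
      if i = 0 then θ.ε else if i = 1 then θ.L else if i = 2 then θ.Lf else 0
    else if a = 1 then
      if h : i < n then ((D ⟨i, h⟩).2 : ℝ) else 0
    else 0

/-- The output function: its values, in increasing order of the argument, are in array `2` of
reals. -/
def output (X : Type*) [LinearOrder X] [Fintype X] (s : Mem) : X → ℝ :=
  fun x => s.real 2 ((rankIso X).symm x : ℕ)

/-- The randomized algorithm that a program computes. -/
def Prog.mechanism {X : Type*} [LinearOrder X] [Fintype X] {n : ℕ} (P : Prog)
    (ℓ : ℝ → ℝ → ℝ) (θ : Params) (D : Dataset X n) : PMF (X → ℝ) :=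
  (P.run ℓ (initMem θ D)).map fun r => output X r.1

/-- Every run of the program on this input takes at most `t` steps. -/
def Prog.RunsWithin {X : Type*} [LinearOrder X] [Fintype X] {n : ℕ} (P : Prog)
    (ℓ : ℝ → ℝ → ℝ) (θ : Params) (D : Dataset X n) (t : ℕ) : Prop :=
  ∀ r ∈ (P.run ℓ (initMem θ D)).support, r.2 ≤ t

/-- The random function drawn from `p` has expected empirical risk (which exists) at most `B`
above that of every competitor in `𝓕`. -/
def ExpectedExcessRiskLE {X : Type*} {n : ℕ} (ℓ : ℝ → ℝ → ℝ) (p : PMF (X → ℝ))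
    (D : Dataset X n) (𝓕 : Set (X → ℝ)) (B : ℝ) : Prop :=
  ∃ R : ℝ, HasSum (fun f => (p f).toReal * risk ℓ f D) R ∧ ∀ g ∈ 𝓕, R - risk ℓ g D ≤ B

end PrivIso

end

/-! Graph. Function values are rounded to a grid of n·m cells, and rounded functions become paths in
a layered graph. Layer i + 1 belongs to the argument i; a node carries a value, a slope and a piece
count, which turns every shape constraint into a relation between consecutive nodes. Paths from
source to sink describe feasible functions (`Inst.feasible_of_path`), and every feasible function is
within 1/n of a path (`Inst.exists_path`): rounding down the increments rather than the values
preserves their equality and order, and loses at most one grid cell per argument. The weight of a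
node is the loss of the examples in its layer, so the cost of a path is n times the risk.

Mechanism. An optimal path is searched privately by bisection of the value range. At level t the
range is cut into p = 2^t cells, and for each threshold j/p a node has been fixed that plays the
role of the first path node at or above it. Every cell is then split at its midpoint by the
exponential mechanism: a candidate for the first node at or above the midpoint has weight exp(-β ·
cost of the best paths on both sides of it).

Privacy. Values do not decrease along paths, so the cells of a level occupy disjoint ranges of
layers and an example influences only one of them (`LGraph.Valid.sum_chi_le`). Inside that cell its
loss varies by at most Δ = 2L/p around a common offset, and the offset cancels in the normalization
(`LGraph.Perturb.wt_le`, `reservoir_le`). With β = εp / (4L(t+1)(t+2)), deleting an example costs βΔ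
= ε / (2(t+1)(t+2)) at level t, hence at most ε/2 altogether; replacing an example is a deletion and
an insertion.

Utility. A sample raises the expected cost of the best path through the chosen nodes by at most (log
N)/β (`ex_reservoir_neg_log`). The 2^t samples of a level cost 4L(t+1)(t+2)(log N)/ε together, and
there are ⌈log₂ n⌉ levels. After them a cell is so narrow that any path through the chosen nodes
that respects the cells is within 2L of the best one (`LGraph.Valid.cost_walk_le`), so the final
walk need not look at the data.

Implementation. Shortest paths are computed in multiplicative form (`LGraph.K`), with 0 for
"unreachable", and the exponential mechanism is run by reservoir sampling with biased coins. A small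
program logic proves that the output law of the program is exactly that of the abstract mechanism
(`mechanism_eq`); all loops after the computation of the sizes are bounded by N, a polynomial in
n·m. -/

noncomputable section
namespace PrivIso

/-! ### Program logic -/

variable {ℓ : ℝ → ℝ → ℝ}

/-- The distribution of the final memory. -/
def Prog.dist (ℓ : ℝ → ℝ → ℝ) (P : Prog) (s : Mem) : PMF Mem := (P.run ℓ s).map Prod.fst

/-- `N` rounds of a loop, without the step count. -/
def loopDist (a : ℕ) (f : Mem → PMF Mem) (s : Mem) : ℕ → PMF Mem
  | 0 => PMF.pure s
  | j + 1 => (loopDist a f s j).bind fun r => f (r.setNat a 0 j)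

@[simp] theorem Prog.dist_skip (s : Mem) : Prog.skip.dist ℓ s = PMF.pure s := by
  simp [Prog.dist, Prog.run, PMF.pure_map]

@[simp] theorem Prog.dist_setNat (a : ℕ) (i e : NExp) (s : Mem) :
    (Prog.setNat a i e).dist ℓ s = PMF.pure (s.setNat a (i.eval s) (e.eval s)) := by
  simp [Prog.dist, Prog.run, PMF.pure_map]

@[simp] theorem Prog.dist_setReal (a : ℕ) (i : NExp) (e : RExp) (s : Mem) :
    (Prog.setReal a i e).dist ℓ s = PMF.pure (s.setReal a (i.eval s) (e.eval ℓ s)) := by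
  simp [Prog.dist, Prog.run, PMF.pure_map]

theorem Prog.dist_flip (a : ℕ) (i : NExp) (p : RExp) (s : Mem) :
    (Prog.flip a i p).dist ℓ s =
      (coin (p.eval ℓ s)).map fun b => s.setNat a (i.eval s) (if b then 1 else 0) := by
  simp only [Prog.dist, Prog.run, PMF.map_comp]
  rfl

theorem Prog.dist_seq (p q : Prog) (s : Mem) :
    (Prog.seq p q).dist ℓ s = (p.dist ℓ s).bind (q.dist ℓ) := by
  simp only [Prog.dist, Prog.run, PMF.map_bind, PMF.map_comp, PMF.bind_map]
  rfl

open Classical in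
theorem Prog.dist_ite (b : Test) (p q : Prog) (s : Mem) :
    (Prog.ite b p q).dist ℓ s = if b.Holds ℓ s then p.dist ℓ s else q.dist ℓ s := by
  simp only [Prog.dist, Prog.run, PMF.map_comp]
  split_ifs <;> rfl

theorem map_fst_loop (a : ℕ) (p : Prog) (s : Mem) (J : ℕ) :
    (loop a (p.run ℓ) s J).map Prod.fst = loopDist a (p.dist ℓ) s J := by
  induction J with
  | zero => simp [loop, loopDist, PMF.pure_map]
  | succ J ih =>
    simp only [loop, loopDist, ← ih, PMF.map_bind, PMF.map_comp, PMF.bind_map]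
    rfl

theorem Prog.dist_forTo (a : ℕ) (e : NExp) (p : Prog) (s : Mem) :
    (Prog.forTo a e p).dist ℓ s = loopDist a (p.dist ℓ) s (e.eval s) := by
  rw [← map_fst_loop]
  simp only [Prog.dist, Prog.run, PMF.map_comp]
  rfl

/-- Every possible final memory satisfies `Q`. -/
def Prog.ens (ℓ : ℝ → ℝ → ℝ) (P : Prog) (s : Mem) (Q : Mem → Prop) : Prop :=
  ∀ s' ∈ (P.dist ℓ s).support, Q s'

theorem Prog.ens_mono {P : Prog} {s : Mem} {Q Q' : Mem → Prop} (h : P.ens ℓ s Q)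
    (hQ : ∀ s', Q s' → Q' s') : P.ens ℓ s Q' := fun s' hs' => hQ s' (h s' hs')

theorem Prog.ens_and {P : Prog} {s : Mem} {Q Q' : Mem → Prop} (h : P.ens ℓ s Q)
    (h' : P.ens ℓ s Q') : P.ens ℓ s (fun s' => Q s' ∧ Q' s') :=
  fun s' hs' => ⟨h s' hs', h' s' hs'⟩

@[simp] theorem Prog.ens_skip (s : Mem) (Q : Mem → Prop) : Prog.skip.ens ℓ s Q ↔ Q s := by
  simp [Prog.ens]

@[simp] theorem Prog.ens_setNat (a : ℕ) (i e : NExp) (s : Mem) (Q : Mem → Prop) :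
    (Prog.setNat a i e).ens ℓ s Q ↔ Q (s.setNat a (i.eval s) (e.eval s)) := by
  simp [Prog.ens]

@[simp] theorem Prog.ens_setReal (a : ℕ) (i : NExp) (e : RExp) (s : Mem) (Q : Mem → Prop) :
    (Prog.setReal a i e).ens ℓ s Q ↔ Q (s.setReal a (i.eval s) (e.eval ℓ s)) := by
  simp [Prog.ens]

theorem Prog.ens_flip {a : ℕ} {i : NExp} {p : RExp} {s : Mem} {Q : Mem → Prop}
    (h : ∀ x, Q (s.setNat a (i.eval s) x)) : (Prog.flip a i p).ens ℓ s Q := by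
  intro s' hs'
  rw [Prog.dist_flip, PMF.support_map] at hs'
  obtain ⟨b, -, rfl⟩ := hs'
  exact h _

@[simp] theorem Prog.ens_seq (p q : Prog) (s : Mem) (Q : Mem → Prop) :
    (Prog.seq p q).ens ℓ s Q ↔ p.ens ℓ s (fun s' => q.ens ℓ s' Q) := by
  simp only [Prog.ens, Prog.dist_seq, PMF.mem_support_bind_iff]
  exact ⟨fun h s' hs' t ht => h t ⟨s', hs', ht⟩, fun h t ⟨s', hs', ht⟩ => h s' hs' t ht⟩

theorem Prog.ens_ite (b : Test) (p q : Prog) (s : Mem) (Q : Mem → Prop) :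
    (Prog.ite b p q).ens ℓ s Q ↔
      (b.Holds ℓ s → p.ens ℓ s Q) ∧ (¬ b.Holds ℓ s → q.ens ℓ s Q) := by
  simp only [Prog.ens, Prog.dist_ite]
  by_cases h : b.Holds ℓ s <;> simp [h]

/-- Does the program write to the `a`-th array of naturals? -/
def Prog.wN : Prog → ℕ → Bool
  | .skip, _ => false
  | .setNat b _ _, a => b == a
  | .setReal _ _ _, _ => false
  | .flip b _ _, a => b == a
  | .seq p q, a => p.wN a || q.wN a
  | .ite _ p q, a => p.wN a || q.wN a
  | .forTo b _ p, a => b == a || p.wN a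

/-- Does the program write to the `a`-th array of reals? -/
def Prog.wR : Prog → ℕ → Bool
  | .skip, _ => false
  | .setNat _ _ _, _ => false
  | .setReal b _ _, a => b == a
  | .flip _ _ _, _ => false
  | .seq p q, a => p.wR a || q.wR a
  | .ite _ p q, a => p.wR a || q.wR a
  | .forTo _ _ p, a => p.wR a

/-- `s'` agrees with `s` on all arrays to which `P` does not write. -/
structure Prog.Frame (P : Prog) (s s' : Mem) : Prop where
  nat : ∀ a, P.wN a = false → s'.nat a = s.nat a
  real : ∀ a, P.wR a = false → s'.real a = s.real a

theorem Prog.Frame.refl (P : Prog) (s : Mem) : P.Frame s s := ⟨fun _ _ => rfl, fun _ _ => rfl⟩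

theorem setNat_nat (s : Mem) (a i v b : ℕ) :
    (s.setNat a i v).nat b = if b = a then Function.update (s.nat a) i v else s.nat b := by
  simp only [Mem.setNat, Function.update_apply]

@[simp] theorem setNat_real (s : Mem) (a i v : ℕ) : (s.setNat a i v).real = s.real := rfl

theorem setReal_real (s : Mem) (a i : ℕ) (v : ℝ) (b : ℕ) :
    (s.setReal a i v).real b = if b = a then Function.update (s.real a) i v else s.real b := by
  simp only [Mem.setReal, Function.update_apply]

@[simp] theorem setReal_nat (s : Mem) (a i : ℕ) (v : ℝ) : (s.setReal a i v).nat = s.nat := rfl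

theorem loopDist_support {a : ℕ} {f : Mem → PMF Mem} {s : Mem} {J : ℕ} {I : ℕ → Mem → Prop}
    (h0 : I 0 s) (h : ∀ j < J, ∀ r, I j r → ∀ r' ∈ (f (r.setNat a 0 j)).support, I (j + 1) r') :
    ∀ r ∈ (loopDist a f s J).support, I J r := by
  induction J with
  | zero => intro r hr; simp [loopDist] at hr; exact hr ▸ h0
  | succ J ih =>
    intro r hr
    rw [loopDist, PMF.mem_support_bind_iff] at hr
    obtain ⟨r', hr', hr⟩ := hr
    exact h J (Nat.lt_succ_self J) r' (ih (fun j hj => h j (hj.trans (Nat.lt_succ_self J))) r' hr')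
      r hr

/-- The footprint is syntactic and computable, so for concrete programs "this array is untouched" is
closed by `rfl`. Loop invariants therefore mention only the arrays that change. -/
theorem Prog.ens_frame (P : Prog) (s : Mem) : P.ens ℓ s (P.Frame s) := by
  induction P generalizing s with
  | skip => simpa using Prog.Frame.refl _ _
  | setNat a i e =>
    rw [Prog.ens_setNat]
    refine ⟨fun b hb => ?_, fun b _ => rfl⟩
    have : b ≠ a := by rintro rfl; simp [Prog.wN] at hb
    rw [setNat_nat, if_neg this]
  | setReal a i e =>
    rw [Prog.ens_setReal]
    refine ⟨fun b _ => rfl, fun b hb => ?_⟩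
    have : b ≠ a := by rintro rfl; simp [Prog.wR] at hb
    rw [setReal_real, if_neg this]
  | flip a i p =>
    refine Prog.ens_flip fun x => ⟨fun b hb => ?_, fun b _ => rfl⟩
    have : b ≠ a := by rintro rfl; simp [Prog.wN] at hb
    rw [setNat_nat, if_neg this]
  | seq p q ihp ihq =>
    rw [Prog.ens_seq]
    refine Prog.ens_mono (ihp s) fun s' h => Prog.ens_mono (ihq s') fun t h' => ⟨fun b hb => ?_,
      fun b hb => ?_⟩
    · simp only [Prog.wN, Bool.or_eq_false_iff] at hb
      rw [h'.nat b hb.2, h.nat b hb.1]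
    · simp only [Prog.wR, Bool.or_eq_false_iff] at hb
      rw [h'.real b hb.2, h.real b hb.1]
  | ite b p q ihp ihq =>
    rw [Prog.ens_ite]
    refine ⟨fun _ => Prog.ens_mono (ihp s) fun s' h => ⟨fun b hb => ?_, fun b hb => ?_⟩,
      fun _ => Prog.ens_mono (ihq s) fun s' h => ⟨fun b hb => ?_, fun b hb => ?_⟩⟩
    · simp only [Prog.wN, Bool.or_eq_false_iff] at hb
      exact h.nat b hb.1
    · simp only [Prog.wR, Bool.or_eq_false_iff] at hb
      exact h.real b hb.1
    · simp only [Prog.wN, Bool.or_eq_false_iff] at hb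
      exact h.nat b hb.2
    · simp only [Prog.wR, Bool.or_eq_false_iff] at hb
      exact h.real b hb.2
  | forTo a e p ih =>
    intro s' hs'
    rw [Prog.dist_forTo] at hs'
    refine loopDist_support (I := fun _ => (Prog.forTo a e p).Frame s) (Prog.Frame.refl _ _) ?_ s' hs'
    intro j _ r hr r' hr'
    have h := ih (r.setNat a 0 j) r' hr'
    refine ⟨fun b hb => ?_, fun b hb => ?_⟩
    · have hb' := hb
      simp only [Prog.wN, Bool.or_eq_false_iff] at hb
      have : b ≠ a := by rintro rfl; simp at hb
      rw [h.nat b hb.2, setNat_nat, if_neg this, hr.nat b hb']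
    · rw [h.real b hb, setNat_real, hr.real b hb]

/-- The usual invariant rule, with the frame of the whole loop supplied for free both in the step
and at the exit. -/
theorem Prog.ens_forTo {a : ℕ} {e : NExp} {p : Prog} {s : Mem} {Q : Mem → Prop} {J : ℕ}
    (hJ : e.eval s = J) (I : ℕ → Mem → Prop) (h0 : I 0 s)
    (hs : ∀ j < J, ∀ r, (Prog.forTo a e p).Frame s r → I j r →
      p.ens ℓ (r.setNat a 0 j) (I (j + 1)))
    (hQ : ∀ r, (Prog.forTo a e p).Frame s r → I J r → Q r) :
    (Prog.forTo a e p).ens ℓ s Q := by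
  subst hJ
  intro s' hs'
  refine hQ s' (Prog.ens_frame _ s s' hs') ?_
  rw [Prog.dist_forTo] at hs'
  refine (loopDist_support (I := fun j r => (Prog.forTo a e p).Frame s r ∧ I j r)
    ⟨Prog.Frame.refl _ _, h0⟩ ?_ s' hs').2
  intro j hj r hr r' hr'
  refine ⟨?_, hs j hj r hr.1 hr.2 r' hr'⟩
  have h := Prog.ens_frame p (r.setNat a 0 j) r' hr'
  refine ⟨fun b hb => ?_, fun b hb => ?_⟩
  · have hb' := hb
    simp only [Prog.wN, Bool.or_eq_false_iff] at hb
    have : b ≠ a := by rintro rfl; simp at hb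
    rw [h.nat b hb.2, setNat_nat, if_neg this, hr.1.nat b hb']
  · rw [h.real b hb, setNat_real, hr.1.real b hb]

/-- `J` steps of a Markov chain. -/
def iter {α : Type*} (g : ℕ → α → PMF α) (x : α) : ℕ → PMF α
  | 0 => PMF.pure x
  | j + 1 => (iter g x j).bind (g j)

/-- From `s`, the program establishes `Q`, and the image of the final memory under `abs` has
distribution `μ`. -/
def Prog.sim {α : Type*} (ℓ : ℝ → ℝ → ℝ) (P : Prog) (s : Mem) (Q : Mem → Prop) (abs : Mem → α)
    (μ : PMF α) : Prop :=
  P.ens ℓ s Q ∧ (P.dist ℓ s).map abs = μ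

theorem pmf_map_const {α β : Type*} {μ : PMF α} {f : α → β} {c : β}
    (h : ∀ x ∈ μ.support, f x = c) : μ.map f = PMF.pure c := by
  have : μ.map f = μ.map (fun _ => c) := by
    simp only [PMF.map]
    ext y
    simp only [PMF.bind_apply, Function.comp]
    refine tsum_congr fun x => ?_
    by_cases hx : μ x = 0
    · simp [hx]
    · rw [h x ((PMF.mem_support_iff _ _).2 hx)]
  rw [this]
  exact PMF.map_const _ _

theorem pmf_bind_congr {α β : Type*} {μ : PMF α} {f g : α → PMF β}
    (h : ∀ x ∈ μ.support, f x = g x) : μ.bind f = μ.bind g := by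
  ext y
  simp only [PMF.bind_apply]
  refine tsum_congr fun x => ?_
  by_cases hx : μ x = 0
  · simp [hx]
  · rw [h x ((PMF.mem_support_iff _ _).2 hx)]

theorem Prog.sim_of_ens {α : Type*} {P : Prog} {s : Mem} {Q : Mem → Prop} {abs : Mem → α} {c : α}
    (h : P.ens ℓ s (fun s' => Q s' ∧ abs s' = c)) : P.sim ℓ s Q abs (PMF.pure c) :=
  ⟨P.ens_mono h fun _ h => h.1, pmf_map_const fun x hx => (h x hx).2⟩

/-- The second program may depend on the intermediate memory only through `abs` as far as its
abstract law is concerned; everything else it needs must hold surely and be recorded in `Q`. -/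
theorem Prog.sim_seq {α β : Type*} {p q : Prog} {s : Mem} {Q Q' : Mem → Prop} {abs : Mem → α}
    {abs' : Mem → β} {μ : PMF α} {g : α → PMF β} (hp : p.sim ℓ s Q abs μ)
    (hq : ∀ s', Q s' → q.sim ℓ s' Q' abs' (g (abs s'))) :
    (Prog.seq p q).sim ℓ s Q' abs' (μ.bind g) := by
  refine ⟨?_, ?_⟩
  · rw [Prog.ens_seq]
    exact Prog.ens_mono hp.1 fun s' hs' => (hq s' hs').1
  · rw [Prog.dist_seq, PMF.map_bind, ← hp.2, PMF.bind_map]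
    exact pmf_bind_congr fun x hx => (hq x (hp.1 x hx)).2

/-- A loop whose body simulates one transition simulates the Markov chain `iter`. This is the bridge
from programs to the chains on which privacy and utility are proved. -/
theorem Prog.sim_forTo {α : Type*} {a : ℕ} {e : NExp} {p : Prog} {s : Mem} {Q : Mem → Prop}
    {J : ℕ} (hJ : e.eval s = J) (abs : Mem → α) (g : ℕ → α → PMF α) (I : ℕ → Mem → Prop)
    (h0 : I 0 s)
    (hs : ∀ j < J, ∀ r, (Prog.forTo a e p).Frame s r → I j r →
      p.sim ℓ (r.setNat a 0 j) (I (j + 1)) abs (g j (abs r)))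
    (hQ : ∀ r, (Prog.forTo a e p).Frame s r → I J r → Q r) :
    (Prog.forTo a e p).sim ℓ s Q abs (iter g (abs s) J) := by
  refine ⟨Prog.ens_forTo hJ I h0 (fun j hj r hf hr => (hs j hj r hf hr).1) hQ, ?_⟩
  have key : ∀ J' ≤ J, (loopDist a (p.dist ℓ) s J').map abs = iter g (abs s) J' ∧
      ∀ r ∈ (loopDist a (p.dist ℓ) s J').support, (Prog.forTo a e p).Frame s r ∧ I J' r := by
    intro J'
    induction J' with
    | zero =>
      intro _
      refine ⟨by simp [loopDist, iter, PMF.pure_map], ?_⟩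
      intro r hr
      simp only [loopDist, PMF.mem_support_pure_iff] at hr
      subst hr
      exact ⟨Prog.Frame.refl _ _, h0⟩
    | succ J' ih =>
      intro hJ'
      obtain ⟨ih1, ih2⟩ := ih (by omega)
      refine ⟨?_, ?_⟩
      · rw [loopDist, iter, PMF.map_bind, ← ih1, PMF.bind_map]
        exact pmf_bind_congr fun r hr => (hs J' (by omega) r (ih2 r hr).1 (ih2 r hr).2).2
      · intro r hr
        rw [loopDist, PMF.mem_support_bind_iff] at hr
        obtain ⟨r', hr', hr⟩ := hr
        obtain ⟨hf, hI⟩ := ih2 r' hr'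
        refine ⟨?_, (hs J' (by omega) r' hf hI).1 r hr⟩
        have h := Prog.ens_frame p (r'.setNat a 0 J') r hr
        refine ⟨fun b hb => ?_, fun b hb => ?_⟩
        · have hb' := hb
          simp only [Prog.wN, Bool.or_eq_false_iff] at hb
          have : b ≠ a := by rintro rfl; simp at hb
          rw [h.nat b hb.2, setNat_nat, if_neg this, hf.nat b hb']
        · rw [h.real b hb, setNat_real, hf.real b hb]
  rw [Prog.dist_forTo, hJ]
  exact (key J le_rfl).1

/-! ### Running time -/

/-- No write to array `13` of naturals, and all loop bounds are at most `nat 13 [0]`. -/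
def Prog.Safe : Prog → Prop
  | .skip => True
  | .setNat a _ _ => a ≠ 13
  | .setReal _ _ _ => True
  | .flip a _ _ => a ≠ 13
  | .seq p q => p.Safe ∧ q.Safe
  | .ite _ p q => p.Safe ∧ q.Safe
  | .forTo a e p => a ≠ 13 ∧ (∃ e', e = .sub (.get 13 (.const 0)) e') ∧ p.Safe

/-- A bound on the number of steps in terms of a bound on the lengths of all loops. -/
def Prog.time : Prog → ℕ → ℕ
  | .skip, _ => 1
  | .setNat _ i e, _ => i.cost + e.cost + 1
  | .setReal _ i e, _ => i.cost + e.cost + 1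
  | .flip _ i p, _ => i.cost + p.cost + 1
  | .seq p q, B => p.time B + q.time B
  | .ite b p q, B => p.time B + q.time B + b.cost
  | .forTo _ e p, B => B * (p.time B + 1) + e.cost + 1

/-- The loop bounds depend on run-time values, but a safe bound is a truncated difference with
minuend B, and the cell that holds B is never overwritten. -/
theorem Prog.run_time {B : ℕ} (P : Prog) (hP : P.Safe) (s : Mem) (hs : s.nat 13 0 = B) :
    ∀ r ∈ (P.run ℓ s).support, r.2 ≤ P.time B ∧ r.1.nat 13 0 = B := by
  induction P generalizing s with
  | skip => intro r hr; simp [Prog.run] at hr; subst hr; simp [Prog.time, hs]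
  | setNat a i e =>
    intro r hr; simp only [Prog.run, PMF.mem_support_pure_iff] at hr; subst hr
    refine ⟨le_rfl, ?_⟩
    simp only [setNat_nat]
    rw [if_neg (Ne.symm hP), hs]
  | setReal a i e =>
    intro r hr; simp only [Prog.run, PMF.mem_support_pure_iff] at hr; subst hr
    exact ⟨le_rfl, hs⟩
  | flip a i p =>
    intro r hr
    simp only [Prog.run, PMF.support_map] at hr
    obtain ⟨b, -, rfl⟩ := hr
    refine ⟨le_rfl, ?_⟩
    simp only [setNat_nat]
    rw [if_neg (Ne.symm hP), hs]
  | seq p q ihp ihq =>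
    intro r hr
    simp only [Prog.run, PMF.mem_support_bind_iff, PMF.support_map] at hr
    obtain ⟨r1, hr1, r2, hr2, rfl⟩ := hr
    obtain ⟨h1, h1'⟩ := ihp hP.1 s hs r1 hr1
    obtain ⟨h2, h2'⟩ := ihq hP.2 r1.1 h1' r2 hr2
    exact ⟨Nat.add_le_add h1 h2, h2'⟩
  | ite b p q ihp ihq =>
    intro r hr
    simp only [Prog.run, PMF.support_map] at hr
    obtain ⟨r1, hr1, rfl⟩ := hr
    simp only [Prog.time]
    split_ifs at hr1 with hb
    · obtain ⟨h1, h1'⟩ := ihp hP.1 s hs r1 hr1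
      exact ⟨by omega, h1'⟩
    · obtain ⟨h1, h1'⟩ := ihq hP.2 s hs r1 hr1
      exact ⟨by omega, h1'⟩
  | forTo a e p ih =>
    intro r hr
    simp only [Prog.run, PMF.support_map] at hr
    obtain ⟨r1, hr1, rfl⟩ := hr
    obtain ⟨ha, ⟨e', rfl⟩, hp⟩ := hP
    have key : ∀ J, ∀ r ∈ (loop a (p.run ℓ) s J).support,
        r.2 ≤ J * (p.time B + 1) ∧ r.1.nat 13 0 = B := by
      intro J
      induction J with
      | zero => intro r hr; simp [loop] at hr; subst hr; simp [hs]
      | succ J ihJ =>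
        intro r hr
        simp only [loop, PMF.mem_support_bind_iff, PMF.support_map] at hr
        obtain ⟨r1, hr1, r2, hr2, rfl⟩ := hr
        obtain ⟨h1, h1'⟩ := ihJ r1 hr1
        obtain ⟨h2, h2'⟩ := ih hp (r1.1.setNat a 0 J)
          (by rw [setNat_nat, if_neg (Ne.symm ha), h1']) r2 hr2
        refine ⟨?_, h2'⟩
        simp only [Nat.succ_mul]
        omega
    obtain ⟨h1, h1'⟩ := key _ r1 hr1
    refine ⟨?_, h1'⟩
    simp only [Prog.time]
    have : (NExp.sub (.get 13 (.const 0)) e').eval s ≤ B := by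
      simp only [NExp.eval, hs]; omega
    have := Nat.mul_le_mul_right (p.time B + 1) this
    omega

/-- Only loops raise the degree, each by one, so the degree is the nesting depth of loops; C and D
depend on the program text alone. -/
theorem Prog.time_le (P : Prog) : ∃ C D : ℕ, ∀ B, P.time B ≤ C * (B + 1) ^ D := by
  have one_le : ∀ B D : ℕ, 1 ≤ (B + 1) ^ D := fun B D => Nat.one_le_pow _ _ (by omega)
  have mono : ∀ {C D D' B : ℕ}, D ≤ D' → C * (B + 1) ^ D ≤ C * (B + 1) ^ D' :=
    fun h => Nat.mul_le_mul_left _ (Nat.pow_le_pow_right (by omega) h)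
  induction P with
  | skip => exact ⟨1, 0, fun B => by simp [Prog.time]⟩
  | setNat a i e => exact ⟨i.cost + e.cost + 1, 0, fun B => by simp [Prog.time]⟩
  | setReal a i e => exact ⟨i.cost + e.cost + 1, 0, fun B => by simp [Prog.time]⟩
  | flip a i e => exact ⟨i.cost + e.cost + 1, 0, fun B => by simp [Prog.time]⟩
  | seq p q ihp ihq =>
    obtain ⟨C, D, h⟩ := ihp
    obtain ⟨C', D', h'⟩ := ihq
    refine ⟨C + C', max D D', fun B => ?_⟩
    have h1 := (h B).trans (mono (le_max_left D D'))
    have h2 := (h' B).trans (mono (le_max_right D D'))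
    simp only [Prog.time, add_mul]
    omega
  | ite b p q ihp ihq =>
    obtain ⟨C, D, h⟩ := ihp
    obtain ⟨C', D', h'⟩ := ihq
    refine ⟨C + C' + b.cost, max D D', fun B => ?_⟩
    have h1 := (h B).trans (mono (le_max_left D D'))
    have h2 := (h' B).trans (mono (le_max_right D D'))
    have h3 := Nat.mul_le_mul_left b.cost (one_le B (max D D'))
    simp only [Prog.time, add_mul]
    omega
  | forTo a e p ih =>
    obtain ⟨C, D, h⟩ := ih
    refine ⟨C + 1 + e.cost + 1, D + 1, fun B => ?_⟩
    have h1 := h B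
    have h2 : B * (p.time B + 1) ≤ (B + 1) * (C * (B + 1) ^ D + 1 * (B + 1) ^ D) :=
      Nat.mul_le_mul (by omega) (by have := one_le B D; omega)
    have h3 := Nat.mul_le_mul_left (e.cost + 1) (one_le B (D + 1))
    simp only [Prog.time]
    calc B * (p.time B + 1) + e.cost + 1
        ≤ (B + 1) * (C * (B + 1) ^ D + 1 * (B + 1) ^ D) + (e.cost + 1) * (B + 1) ^ (D + 1) := by
          omega
      _ = _ := by ring

end PrivIso
end

noncomputable section
namespace PrivIso

/-! ### Expectations over finitely supported distributions -/

/-- Expectation. -/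
def ex {α : Type*} (μ : PMF α) (g : α → ℝ) : ℝ := ∑' x, (μ x).toReal * g x

theorem hasSum_ex {α : Type*} {μ : PMF α} (h : μ.support.Finite) (g : α → ℝ) :
    HasSum (fun x => (μ x).toReal * g x) (ex μ g) := by
  refine Summable.hasSum (summable_of_hasFiniteSupport (h.subset fun x hx => ?_))
  rw [PMF.mem_support_iff]
  intro h0
  simp [h0] at hx

theorem ex_eq_sum {α : Type*} {μ : PMF α} {S : Finset α} (h : μ.support ⊆ S) (g : α → ℝ) :
    ex μ g = ∑ x ∈ S, (μ x).toReal * g x := by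
  refine tsum_eq_sum fun x hx => ?_
  have : μ x = 0 := by
    by_contra h0
    exact hx (h ((PMF.mem_support_iff _ _).2 h0))
  simp [this]

theorem sum_toReal {α : Type*} {μ : PMF α} {S : Finset α} (h : μ.support ⊆ S) :
    ∑ x ∈ S, (μ x).toReal = 1 := by
  rw [← ENNReal.toReal_sum fun x _ => μ.apply_ne_top x, ← ENNReal.toReal_one, ← μ.tsum_coe]
  congr 1
  symm
  refine tsum_eq_sum fun x hx => ?_
  by_contra h0
  exact hx (h ((PMF.mem_support_iff _ _).2 h0))

theorem ex_mono {α : Type*} {μ : PMF α} (h : μ.support.Finite) {g g' : α → ℝ}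
    (hg : ∀ x ∈ μ.support, g x ≤ g' x) : ex μ g ≤ ex μ g' := by
  rw [ex_eq_sum (S := h.toFinset) (by simp), ex_eq_sum (S := h.toFinset) (by simp)]
  refine Finset.sum_le_sum fun x hx => ?_
  exact mul_le_mul_of_nonneg_left (hg x (by simpa using hx)) ENNReal.toReal_nonneg

theorem ex_add_const {α : Type*} {μ : PMF α} (h : μ.support.Finite) (g : α → ℝ) (c : ℝ) :
    ex μ (fun x => g x + c) = ex μ g + c := by
  have h1 : μ.support ⊆ (h.toFinset : Set α) := by simp
  rw [ex_eq_sum h1, ex_eq_sum h1]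
  simp only [mul_add, Finset.sum_add_distrib]
  rw [← Finset.sum_mul, sum_toReal h1, one_mul]

theorem ex_const_mul {α : Type*} (μ : PMF α) (g : α → ℝ) (c : ℝ) :
    ex μ (fun x => c * g x) = c * ex μ g := by
  simp only [ex, ← tsum_mul_left]
  exact tsum_congr fun x => by ring

theorem ex_const {α : Type*} {μ : PMF α} (h : μ.support.Finite) (c : ℝ) :
    ex μ (fun _ => c) = c := by
  have := ex_add_const h (fun _ => (0 : ℝ)) c
  simpa [ex] using this

theorem ex_pure {α : Type*} (x : α) (g : α → ℝ) : ex (PMF.pure x) g = g x := by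
  rw [ex_eq_sum (S := {x}) (by simp)]
  simp

theorem finite_support_bind {α β : Type*} {μ : PMF α} {f : α → PMF β} (h : μ.support.Finite)
    (hf : ∀ x ∈ μ.support, (f x).support.Finite) : (μ.bind f).support.Finite := by
  rw [PMF.support_bind]
  exact h.biUnion hf

theorem finite_support_map {α β : Type*} {μ : PMF α} (f : α → β) (h : μ.support.Finite) :
    (μ.map f).support.Finite := by
  rw [PMF.support_map]
  exact h.image f

theorem ex_bind {α β : Type*} {μ : PMF α} {f : α → PMF β} (h : μ.support.Finite)
    (hf : ∀ x ∈ μ.support, (f x).support.Finite) (g : β → ℝ) :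
    ex (μ.bind f) g = ex μ (fun x => ex (f x) g) := by
  classical
  have hb := finite_support_bind h hf
  have h1 : μ.support ⊆ (h.toFinset : Set α) := by simp
  have h2 : (μ.bind f).support ⊆ (hb.toFinset : Set β) := by simp
  rw [ex_eq_sum h1, ex_eq_sum h2]
  have h3 : ∀ x ∈ h.toFinset, ex (f x) g = ∑ y ∈ hb.toFinset, (f x y).toReal * g y := by
    intro x hx
    refine ex_eq_sum (fun y hy => ?_) g
    simp only [Set.Finite.coe_toFinset, PMF.mem_support_bind_iff]
    exact ⟨x, by simpa using hx, hy⟩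
  have h4 : ∑ x ∈ h.toFinset, (μ x).toReal * ex (f x) g =
      ∑ x ∈ h.toFinset, ∑ y ∈ hb.toFinset, (μ x).toReal * ((f x y).toReal * g y) :=
    Finset.sum_congr rfl fun x hx => by rw [h3 x hx, Finset.mul_sum]
  rw [h4, Finset.sum_comm]
  refine Finset.sum_congr rfl fun y _ => ?_
  have : (μ.bind f) y = ∑ x ∈ h.toFinset, μ x * f x y := by
    rw [PMF.bind_apply]
    refine tsum_eq_sum fun x hx => ?_
    have : μ x = 0 := by
      by_contra h0
      exact hx (h1 ((PMF.mem_support_iff _ _).2 h0))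
    simp [this]
  rw [this, ENNReal.toReal_sum fun x _ =>
    ENNReal.mul_ne_top (μ.apply_ne_top x) ((f x).apply_ne_top y), Finset.sum_mul]
  refine Finset.sum_congr rfl fun x _ => ?_
  rw [ENNReal.toReal_mul]
  ring

theorem ex_map {α β : Type*} {μ : PMF α} (h : μ.support.Finite) (f : α → β) (g : β → ℝ) :
    ex (μ.map f) g = ex μ (fun x => g (f x)) := by
  rw [PMF.map, ex_bind h (fun x _ => by simp)]
  simp only [Function.comp, ex_pure]

/-! ### Markov chains -/

theorem iter_support {α : Type*} {g : ℕ → α → PMF α} {x : α} {J : ℕ} {I : ℕ → α → Prop}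
    (h0 : I 0 x) (h : ∀ j < J, ∀ y, I j y → ∀ z ∈ (g j y).support, I (j + 1) z) :
    ∀ y ∈ (iter g x J).support, I J y := by
  induction J with
  | zero => intro y hy; simp [iter] at hy; exact hy ▸ h0
  | succ J ih =>
    intro y hy
    rw [iter, PMF.mem_support_bind_iff] at hy
    obtain ⟨z, hz, hy⟩ := hy
    exact h J (by omega) z (ih (fun j hj => h j (by omega)) z hz) y hy

theorem iter_finite {α : Type*} {g : ℕ → α → PMF α} (hg : ∀ j x, (g j x).support.Finite) (x : α)
    (J : ℕ) : (iter g x J).support.Finite := by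
  induction J with
  | zero => simp [iter]
  | succ J ih => exact finite_support_bind ih fun y _ => hg J y

/-- If each step raises the expected potential by at most `c j`, then the whole chain raises it
by at most the sum. -/
theorem ex_iter_le {α : Type*} {g : ℕ → α → PMF α} (hg : ∀ j x, (g j x).support.Finite) {x : α}
    {J : ℕ} {I : ℕ → α → Prop} (h0 : I 0 x)
    (h : ∀ j < J, ∀ y, I j y → ∀ z ∈ (g j y).support, I (j + 1) z)
    (Φ : ℕ → α → ℝ) (c : ℕ → ℝ)
    (hΦ : ∀ j < J, ∀ y, I j y → ex (g j y) (Φ (j + 1)) ≤ Φ j y + c j) :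
    ex (iter g x J) (Φ J) ≤ Φ 0 x + ∑ j ∈ Finset.range J, c j := by
  induction J with
  | zero => simp [iter, ex_pure]
  | succ J ih =>
    have ih := ih (fun j hj => h j (by omega)) (fun j hj => hΦ j (by omega))
    rw [iter, ex_bind (iter_finite hg x J) (fun y _ => hg J y), Finset.sum_range_succ]
    calc _ ≤ ex (iter g x J) (fun y => Φ J y + c J) :=
          ex_mono (iter_finite hg x J) fun y hy =>
            hΦ J (by omega) y (iter_support h0 (fun j hj => h j (by omega)) y hy)
      _ = ex (iter g x J) (Φ J) + c J := ex_add_const (iter_finite hg x J) _ _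
      _ ≤ _ := by linarith

/-- Adaptive composition of pure differential privacy: likelihood ratios multiply along the chain.
They need to be controlled only at states that the chain on the left can reach, since other states
contribute zero there. -/
theorem iter_apply_le {α : Type*} {g g' : ℕ → α → PMF α} {x : α} {J : ℕ} {I : ℕ → α → Prop}
    (h0 : I 0 x) (h : ∀ j < J, ∀ y, I j y → ∀ z ∈ (g j y).support, I (j + 1) z)
    (η : ℕ → ℝ)
    (hη : ∀ j < J, ∀ y, I j y → ∀ z, g j y z ≤ ENNReal.ofReal (Real.exp (η j)) * g' j y z)
    (z : α) :
    iter g x J z ≤ ENNReal.ofReal (Real.exp (∑ j ∈ Finset.range J, η j)) * iter g' x J z := by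
  induction J generalizing z with
  | zero => simp [iter]
  | succ J ih =>
    have ih := ih (fun j hj => h j (by omega)) (fun j hj => hη j (by omega))
    rw [iter, iter, PMF.bind_apply, PMF.bind_apply, Finset.sum_range_succ, Real.exp_add,
      ENNReal.ofReal_mul (Real.exp_pos _).le, ← ENNReal.tsum_mul_left]
    refine ENNReal.tsum_le_tsum fun y => ?_
    by_cases hy : y ∈ (iter g x J).support
    · have h1 := hη J (by omega) y (iter_support h0 (fun j hj => h j (by omega)) y hy) z
      calc iter g x J y * g J y z
          ≤ (ENNReal.ofReal (Real.exp (∑ j ∈ Finset.range J, η j)) * iter g' x J y) *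
            (ENNReal.ofReal (Real.exp (η J)) * g' J y z) := mul_le_mul' (ih y) h1
        _ = _ := by ring
    · have : iter g x J y = 0 := by
        by_contra h0
        exact hy ((PMF.mem_support_iff _ _).2 h0)
      rw [this, zero_mul]
      exact zero_le

theorem map_apply_le {α β : Type*} {μ μ' : PMF α} {c : ENNReal} (h : ∀ x, μ x ≤ c * μ' x)
    (f : α → β) (y : β) : μ.map f y ≤ c * μ'.map f y := by
  classical
  rw [PMF.map_apply, PMF.map_apply, ← ENNReal.tsum_mul_left]
  refine ENNReal.tsum_le_tsum fun x => ?_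
  split_ifs
  · exact h x
  · simp

theorem toOuterMeasure_le {α : Type*} {μ μ' : PMF α} {c : ENNReal} (h : ∀ x, μ x ≤ c * μ' x)
    (S : Set α) : μ.toOuterMeasure S ≤ c * μ'.toOuterMeasure S := by
  classical
  rw [PMF.toOuterMeasure_apply, PMF.toOuterMeasure_apply, ← ENNReal.tsum_mul_left]
  refine ENNReal.tsum_le_tsum fun x => ?_
  simp only [Set.indicator]
  split_ifs
  · exact h x
  · simp

/-! ### Reservoir sampling -/

/-- Sample `u < N` with probability proportional to `W u` by reservoir sampling. -/
def reservoir (W : ℕ → ℝ) : ℕ → PMF ℕ :=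
  iter (fun u sel => (coin (W u / ∑ i ∈ Finset.range (u + 1), W i)).map
    fun b => if b then u else sel) 0

theorem coin_true (p : ℝ) : coin p true = min 1 (ENNReal.ofReal p) := by
  simp [coin, PMF.ofFintype_apply]

theorem coin_false (p : ℝ) : coin p false = 1 - min 1 (ENNReal.ofReal p) := by
  simp [coin, PMF.ofFintype_apply]

theorem coin_finite (p : ℝ) : (coin p).support.Finite := Set.toFinite _

theorem reservoir_finite (W : ℕ → ℝ) (N : ℕ) : (reservoir W N).support.Finite :=
  iter_finite (fun _ _ => finite_support_map _ (coin_finite _)) _ _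

theorem map_coin_apply (p : ℝ) (u sel x : ℕ) :
    (coin p).map (fun b => if b then u else sel) x =
      (if x = u then coin p true else 0) + (if x = sel then coin p false else 0) := by
  rw [PMF.map_apply, tsum_bool, add_comm]
  simp

/-- An earlier selection survives the last coin with probability S/(S + W N), which replaces the
normalization S by S + W N. -/
theorem reservoir_apply {W : ℕ → ℝ} (hW : ∀ u, 0 ≤ W u) {N : ℕ}
    (hN : 0 < ∑ i ∈ Finset.range N, W i) (x : ℕ) :
    reservoir W N x =
      if x < N then ENNReal.ofReal (W x / ∑ i ∈ Finset.range N, W i) else 0 := by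
  induction N generalizing x with
  | zero => simp at hN
  | succ N ih =>
    set S := ∑ i ∈ Finset.range N, W i with hS
    have hS0 : 0 ≤ S := Finset.sum_nonneg fun i _ => hW i
    have hsucc : ∑ i ∈ Finset.range (N + 1), W i = S + W N := by
      rw [Finset.sum_range_succ]
    rw [hsucc] at hN ⊢
    have hstep : reservoir W (N + 1) = (reservoir W N).bind fun sel =>
        (coin (W N / (S + W N))).map fun b => if b then N else sel := by
      rw [reservoir, iter, hsucc]
    have hq1 : W N / (S + W N) ≤ 1 := (div_le_one hN).2 (by linarith)
    have hq0 : 0 ≤ W N / (S + W N) := div_nonneg (hW N) hN.le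
    have ht : coin (W N / (S + W N)) true = ENNReal.ofReal (W N / (S + W N)) := by
      rw [coin_true, min_eq_right]
      simpa using ENNReal.ofReal_le_ofReal hq1
    have hf : coin (W N / (S + W N)) false = ENNReal.ofReal (S / (S + W N)) := by
      rw [coin_false, min_eq_right (by simpa using ENNReal.ofReal_le_ofReal hq1),
        ← ENNReal.ofReal_one, ← ENNReal.ofReal_sub _ hq0]
      congr 1
      field_simp
      ring
    have hmain : reservoir W (N + 1) x = (if x = N then ENNReal.ofReal (W N / (S + W N)) else 0) +
        reservoir W N x * ENNReal.ofReal (S / (S + W N)) := by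
      rw [hstep, PMF.bind_apply]
      simp only [map_coin_apply, ht, hf, mul_add]
      rw [ENNReal.tsum_add, ENNReal.tsum_mul_right, PMF.tsum_coe, one_mul]
      congr 1
      rw [tsum_eq_single x]
      · simp
      · intro y hy
        simp [Ne.symm hy]
    rw [hmain]
    rcases hS0.lt_or_eq with hpos | h0
    · rw [ih hpos]
      by_cases hx : x = N
      · subst hx; simp
      · have : x < N + 1 ↔ x < N := by omega
        simp only [hx, if_false, zero_add, this]
        split_ifs with hxN
        · rw [← ENNReal.ofReal_mul (div_nonneg (hW x) hS0)]
          congr 1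
          field_simp
        · simp
    -- All earlier weights vanish, so the induction hypothesis does not apply; but W N is positive
    -- and the coin has bias 1.
    · rw [← h0]
      have hz : ∀ i ∈ Finset.range N, W i = 0 :=
        (Finset.sum_eq_zero_iff_of_nonneg fun i _ => hW i).1 (hS ▸ h0.symm)
      simp only [zero_div, ENNReal.ofReal_zero, mul_zero, add_zero]
      by_cases hx : x = N
      · subst hx; simp
      · simp only [hx, if_false]
        split_ifs with hxN
        · rw [hz x (by simp; omega)]; simp
        · rfl

theorem reservoir_support {W : ℕ → ℝ} (hW : ∀ u, 0 ≤ W u) {N : ℕ}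
    (hN : 0 < ∑ i ∈ Finset.range N, W i) {x : ℕ} (hx : x ∈ (reservoir W N).support) :
    x < N ∧ 0 < W x := by
  rw [PMF.mem_support_iff, reservoir_apply hW hN] at hx
  split_ifs at hx with h
  · refine ⟨h, (hW x).lt_of_ne fun h0 => hx ?_⟩
    rw [← h0]; simp
  · exact absurd rfl hx

/-- The exponent a comes from the numerator and b from the normalizing sum. They are kept separate
and may be negative, so that a shift common to all candidates cancels in a + b. -/
theorem reservoir_le {W W' : ℕ → ℝ} (hW : ∀ u, 0 ≤ W u) (hW' : ∀ u, 0 ≤ W' u) {N : ℕ}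
    (hN : 0 < ∑ i ∈ Finset.range N, W i) {a b : ℝ}
    (h1 : ∀ u < N, W u ≤ Real.exp a * W' u) (h2 : ∀ u < N, W' u ≤ Real.exp b * W u) (x : ℕ) :
    reservoir W N x ≤ ENNReal.ofReal (Real.exp (a + b)) * reservoir W' N x := by
  have hs1 : ∑ i ∈ Finset.range N, W i ≤ Real.exp a * ∑ i ∈ Finset.range N, W' i := by
    rw [Finset.mul_sum]
    exact Finset.sum_le_sum fun i hi => h1 i (by simpa using hi)
  have hs2 : ∑ i ∈ Finset.range N, W' i ≤ Real.exp b * ∑ i ∈ Finset.range N, W i := by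
    rw [Finset.mul_sum]
    exact Finset.sum_le_sum fun i hi => h2 i (by simpa using hi)
  have hN' : 0 < ∑ i ∈ Finset.range N, W' i := by
    by_contra h
    nlinarith [Real.exp_pos a]
  rw [reservoir_apply hW hN, reservoir_apply hW' hN']
  split_ifs with hx
  · rw [← ENNReal.ofReal_mul (Real.exp_pos _).le]
    refine ENNReal.ofReal_le_ofReal ?_
    rw [Real.exp_add, ← mul_div_assoc, div_le_div_iff₀ hN hN']
    calc W x * ∑ i ∈ Finset.range N, W' i
        ≤ (Real.exp a * W' x) * (Real.exp b * ∑ i ∈ Finset.range N, W i) :=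
          mul_le_mul (h1 x hx) hs2 hN'.le (mul_nonneg (Real.exp_pos _).le (hW' x))
      _ = _ := by ring
  · simp

/-- The utility of the exponential mechanism. -/
theorem ex_reservoir_neg_log {W : ℕ → ℝ} (hW : ∀ u, 0 ≤ W u) {N : ℕ} {u₀ : ℕ} (hu : u₀ < N)
    (h0 : 0 < W u₀) :
    ex (reservoir W N) (fun u => - Real.log (W u)) ≤ - Real.log (W u₀) + Real.log N := by
  have hmem : u₀ ∈ Finset.range N := by simpa using hu
  have hle : W u₀ ≤ ∑ i ∈ Finset.range N, W i :=
    Finset.single_le_sum (fun i _ => hW i) hmem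
  have hN : 0 < ∑ i ∈ Finset.range N, W i := h0.trans_le hle
  set Z := ∑ i ∈ Finset.range N, W i
  have hN0 : (0 : ℝ) < N := by exact_mod_cast (Nat.zero_le _).trans_lt hu
  have hsupp : (reservoir W N).support ⊆ (Finset.range N : Set ℕ) := fun x hx => by
    simpa using (reservoir_support hW hN hx).1
  rw [ex_eq_sum hsupp]
  -- Gibbs' inequality against the uniform distribution, term by term, from log y ≤ y - 1 at y = Z /
  -- (W x · N). The corrections 1/N - W x / Z sum to zero, which leaves log N - log Z, and Z ≥ W u₀.
  have hp : ∀ x ∈ Finset.range N, ((reservoir W N) x).toReal * (- Real.log (W x)) ≤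
      (W x / Z) * (Real.log N - Real.log Z) + (1 / N - W x / Z) := by
    intro x hx
    rw [reservoir_apply hW hN, if_pos (by simpa using hx),
      ENNReal.toReal_ofReal (div_nonneg (hW x) hN.le)]
    rcases (hW x).lt_or_eq with hpos | h0
    · have := Real.log_le_sub_one_of_pos (x := Z / (W x * N)) (by positivity)
      rw [Real.log_div hN.ne' (by positivity), Real.log_mul hpos.ne' hN0.ne'] at this
      have h2 := mul_le_mul_of_nonneg_left this (div_nonneg (hW x) hN.le)
      have h3 : W x / Z * (Z / (W x * N) - 1) = 1 / N - W x / Z := by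
        field_simp
      rw [h3] at h2
      linarith
    · rw [← h0]; simp
  refine (Finset.sum_le_sum hp).trans ?_
  rw [Finset.sum_add_distrib, ← Finset.sum_mul, Finset.sum_sub_distrib, ← Finset.sum_div,
    div_self hN.ne']
  simp only [Finset.sum_const, Finset.card_range, nsmul_eq_mul]
  have := Real.log_le_log h0 hle
  rw [mul_one_div_cancel hN0.ne']
  linarith

end PrivIso
end

noncomputable section
namespace PrivIso

/-! ### Shortest paths in layered graphs -/

/-- A layered directed graph on `{0, …, N - 1}` whose nodes carry values that do not decrease along
edges; paths lead from the node `0` in layer `0` to `sink` in layer `R`. -/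
structure LGraph where
  N : ℕ
  Q : ℕ
  M : ℕ
  R : ℕ
  sink : ℕ
  pos : ℕ → ℕ
  V : ℕ → ℕ
  E : ℕ → ℕ → Prop
  pos_mono : Monotone pos
  pos_zero : pos 0 = 0
  pos_sink : pos sink = R
  V_sink : V sink = M
  sink_lt : sink < N
  E_pos : ∀ {u v}, E u v → pos v = pos u + 1
  E_V : ∀ {u v}, E u v → V u ≤ V v
  E_lt : ∀ {u v}, E u v → v < N
  E_Q : ∀ {u v}, E u v → V u ≤ Q

namespace LGraph

variable (G : LGraph)

theorem lt_of_pos_lt {u v : ℕ} (h : G.pos u < G.pos v) : u < v := by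
  by_contra h'
  exact absurd (G.pos_mono (not_lt.1 h')) (not_le.2 h)

theorem E_lt' {u v : ℕ} (h : G.E u v) : u < v := G.lt_of_pos_lt (by rw [G.E_pos h]; omega)

/-- `ρ` is a path from `a` to `b` (indexed by layers) all of whose nodes before `b` have a value
below the threshold `j / p`. -/
structure IsPath (j p a b : ℕ) (ρ : ℕ → ℕ) : Prop where
  le : G.pos a ≤ G.pos b
  left : ρ (G.pos a) = a
  right : ρ (G.pos b) = b
  edge : ∀ i, G.pos a ≤ i → i < G.pos b → G.E (ρ i) (ρ (i + 1))
  ok : ∀ i, G.pos a ≤ i → i < G.pos b → G.V (ρ i) * p < j * G.M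

variable {G}
variable {j p a b c : ℕ} {ρ : ℕ → ℕ}

theorem IsPath.pos_eq (h : G.IsPath j p a b ρ) {i : ℕ} (h1 : G.pos a ≤ i) (h2 : i ≤ G.pos b) :
    G.pos (ρ i) = i := by
  induction i, h1 using Nat.le_induction with
  | base => rw [h.left]
  | succ i h1 ih => rw [G.E_pos (h.edge i h1 (by omega)), ih (by omega)]

theorem IsPath.V_mono (h : G.IsPath j p a b ρ) {i i' : ℕ} (h1 : G.pos a ≤ i) (hi : i ≤ i')
    (h2 : i' ≤ G.pos b) : G.V (ρ i) ≤ G.V (ρ i') := by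
  induction i', hi using Nat.le_induction with
  | base => exact le_rfl
  | succ i' h1' ih => exact (ih (by omega)).trans (G.E_V (h.edge i' (by omega) (by omega)))

theorem IsPath.lt_N (h : G.IsPath j p a b ρ) (ha : a < G.N) {i : ℕ} (h1 : G.pos a ≤ i)
    (h2 : i ≤ G.pos b) : ρ i < G.N := by
  rcases h1.eq_or_lt with rfl | h1
  · rwa [h.left]
  · obtain ⟨i, rfl⟩ : ∃ i', i = i' + 1 := ⟨i - 1, by omega⟩
    exact G.E_lt (h.edge i (by omega) (by omega))

theorem IsPath.congr (h : G.IsPath j p a b ρ) {ρ' : ℕ → ℕ}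
    (hρ : ∀ i, G.pos a ≤ i → i ≤ G.pos b → ρ' i = ρ i) : G.IsPath j p a b ρ' where
  le := h.le
  left := by rw [hρ _ le_rfl h.le, h.left]
  right := by rw [hρ _ h.le le_rfl, h.right]
  edge i h1 h2 := by rw [hρ i h1 h2.le, hρ _ (by omega) (by omega)]; exact h.edge i h1 h2
  ok i h1 h2 := by rw [hρ i h1 h2.le]; exact h.ok i h1 h2

theorem IsPath.refl (j p a : ℕ) : G.IsPath j p a a (fun _ => a) :=
  ⟨le_rfl, rfl, rfl, fun i h1 h2 => by omega, fun i h1 h2 => by omega⟩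

theorem IsPath.of_ok {j' p' : ℕ} (h : G.IsPath j p a b ρ)
    (hok : ∀ i, G.pos a ≤ i → i < G.pos b → G.V (ρ i) * p' < j' * G.M) :
    G.IsPath j' p' a b ρ := ⟨h.le, h.left, h.right, h.edge, hok⟩

theorem IsPath.take (h : G.IsPath j p a b ρ) {i : ℕ} (h1 : G.pos a ≤ i) (h2 : i ≤ G.pos b) :
    G.IsPath j p a (ρ i) ρ := by
  have hp := h.pos_eq h1 h2
  exact ⟨by rw [hp]; exact h1, h.left, by rw [hp],
    fun i' h1' h2' => h.edge i' h1' (by omega), fun i' h1' h2' => h.ok i' h1' (by omega)⟩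

theorem IsPath.drop (h : G.IsPath j p a b ρ) {i : ℕ} (h1 : G.pos a ≤ i) (h2 : i ≤ G.pos b) :
    G.IsPath j p (ρ i) b ρ := by
  have hp := h.pos_eq h1 h2
  exact ⟨by rw [hp]; exact h2, by rw [hp], h.right,
    fun i' h1' h2' => h.edge i' (by omega) h2', fun i' h1' h2' => h.ok i' (by omega) h2'⟩

/-- Concatenation of paths. -/
def glue (G : LGraph) (b : ℕ) (ρ ρ' : ℕ → ℕ) (i : ℕ) : ℕ := if i < G.pos b then ρ i else ρ' i

theorem IsPath.glue {ρ' : ℕ → ℕ} (h : G.IsPath j p a b ρ) (h' : G.IsPath j p b c ρ') :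
    G.IsPath j p a c (G.glue b ρ ρ') := by
  have e1 : ∀ i, i ≤ G.pos b → G.glue b ρ ρ' i = ρ i := by
    intro i hi
    rcases hi.eq_or_lt with rfl | hi
    · rw [LGraph.glue, if_neg (lt_irrefl _), h'.left, h.right]
    · rw [LGraph.glue, if_pos hi]
  have e2 : ∀ i, G.pos b ≤ i → G.glue b ρ ρ' i = ρ' i := by
    intro i hi
    rw [LGraph.glue, if_neg (by omega)]
  refine ⟨h.le.trans h'.le, by rw [e1 _ h.le, h.left], by rw [e2 _ h'.le, h'.right], ?_, ?_⟩
  · intro i h1 h2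
    by_cases hi : i < G.pos b
    · rw [e1 i hi.le, e1 (i + 1) hi]; exact h.edge i h1 hi
    · rw [e2 i (by omega), e2 (i + 1) (by omega)]; exact h'.edge i (by omega) h2
  · intro i h1 h2
    by_cases hi : i < G.pos b
    · rw [e1 i hi.le]; exact h.ok i h1 hi
    · rw [e2 i (by omega)]; exact h'.ok i (by omega) h2

/-- The total weight of the nodes of a path before its end. -/
def cost (G : LGraph) (w : ℕ → ℝ) (a b : ℕ) (ρ : ℕ → ℕ) : ℝ :=
  ∑ i ∈ Finset.Ico (G.pos a) (G.pos b), w (ρ i)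

theorem cost_split (w : ℕ → ℝ) (h1 : G.pos a ≤ G.pos b) (h2 : G.pos b ≤ G.pos c) :
    G.cost w a c ρ = G.cost w a b ρ + G.cost w b c ρ :=
  (Finset.sum_Ico_consecutive _ h1 h2).symm

theorem cost_congr {w : ℕ → ℝ} {ρ' : ℕ → ℕ}
    (h : ∀ i, G.pos a ≤ i → i < G.pos b → ρ i = ρ' i) : G.cost w a b ρ = G.cost w a b ρ' :=
  Finset.sum_congr rfl fun i hi => by
    rw [Finset.mem_Ico] at hi
    rw [h i hi.1 hi.2]

theorem IsPath.cost_glue {w : ℕ → ℝ} {ρ' : ℕ → ℕ} (h : G.IsPath j p a b ρ)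
    (h' : G.IsPath j p b c ρ') :
    G.cost w a c (G.glue b ρ ρ') = G.cost w a b ρ + G.cost w b c ρ' := by
  rw [cost_split w h.le h'.le]
  congr 1
  · exact cost_congr fun i _ hi => by rw [LGraph.glue, if_pos hi]
  · exact cost_congr fun i hi _ => by rw [LGraph.glue, if_neg (by omega)]

variable (G)

/-- There is a path. -/
def Reach (j p a b : ℕ) : Prop := ∃ ρ, G.IsPath j p a b ρ

/-- The least weight of a path. -/
def D (w : ℕ → ℝ) (j p a b : ℕ) : ℝ := sInf {x | ∃ ρ, G.IsPath j p a b ρ ∧ x = G.cost w a b ρ}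

variable {G}

/-- The cost sees only finitely many entries of ρ, each of them less than b because layers increase
with node numbers. Hence the infimum in `D` is attained. -/
theorem finite_costs (w : ℕ → ℝ) (j p a b : ℕ) :
    {x | ∃ ρ, G.IsPath j p a b ρ ∧ x = G.cost w a b ρ}.Finite := by
  refine (Set.finite_range fun f : Fin (G.pos b) → Fin (b + 1) =>
    ∑ i ∈ Finset.Ico (G.pos a) (G.pos b),
      if h : i < G.pos b then w (f ⟨i, h⟩ : ℕ) else 0).subset ?_
  rintro x ⟨ρ, hρ, rfl⟩
  refine ⟨fun i => ⟨min (ρ i) b, by omega⟩, ?_⟩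
  refine Finset.sum_congr rfl fun i hi => ?_
  rw [Finset.mem_Ico] at hi
  have : ρ i < b := G.lt_of_pos_lt (by rw [hρ.pos_eq hi.1 hi.2.le]; exact hi.2)
  simp only [hi.2, dif_pos]
  rw [min_eq_left this.le]

theorem IsPath.D_le (w : ℕ → ℝ) (h : G.IsPath j p a b ρ) : G.D w j p a b ≤ G.cost w a b ρ :=
  csInf_le (finite_costs w j p a b).bddBelow ⟨ρ, h, rfl⟩

theorem Reach.exists_min (w : ℕ → ℝ) (h : G.Reach j p a b) :
    ∃ ρ, G.IsPath j p a b ρ ∧ G.cost w a b ρ = G.D w j p a b := by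
  obtain ⟨ρ, hρ⟩ := h
  obtain ⟨ρ', h1, h2⟩ := Set.Nonempty.csInf_mem
    (s := {x | ∃ ρ, G.IsPath j p a b ρ ∧ x = G.cost w a b ρ}) ⟨_, ρ, hρ, rfl⟩
    (finite_costs w j p a b)
  exact ⟨ρ', h1, h2.symm⟩

theorem Reach.refl (j p a : ℕ) : G.Reach j p a a := ⟨_, IsPath.refl j p a⟩

theorem Reach.trans (h : G.Reach j p a b) (h' : G.Reach j p b c) : G.Reach j p a c := by
  obtain ⟨ρ, hρ⟩ := h
  obtain ⟨ρ', hρ'⟩ := h'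
  exact ⟨_, hρ.glue hρ'⟩

theorem Reach.pos_le (h : G.Reach j p a b) : G.pos a ≤ G.pos b := by
  obtain ⟨ρ, hρ⟩ := h
  exact hρ.le

theorem Reach.eq_of_pos (h : G.Reach j p a b) (hp : G.pos a = G.pos b) : a = b := by
  obtain ⟨ρ, hρ⟩ := h
  rw [← hρ.left, hp, hρ.right]

theorem isPath_edge (h : G.E a b) (ho : G.V a * p < j * G.M) :
    G.IsPath j p a b (fun i => if i ≤ G.pos a then a else b) := by
  have hp := G.E_pos h
  refine ⟨by omega, by simp, by simp [hp], fun i h1 h2 => ?_, fun i h1 h2 => ?_⟩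
  · have : i = G.pos a := by omega
    subst this
    simpa using h
  · have : i = G.pos a := by omega
    subst this
    simpa using ho

theorem D_self (w : ℕ → ℝ) (j p a : ℕ) : G.D w j p a a = 0 := by
  obtain ⟨ρ, -, h⟩ := (Reach.refl (G := G) j p a).exists_min w
  rw [← h]
  simp [cost]

theorem D_add_edge {w : ℕ → ℝ} (h : G.Reach j p a b) (he : G.E b c) (ho : G.V b * p < j * G.M) :
    G.D w j p a c ≤ G.D w j p a b + w b := by
  obtain ⟨ρ, hρ, hc⟩ := h.exists_min w
  have h2 := isPath_edge he ho
  refine ((hρ.glue h2).D_le w).trans ?_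
  rw [hρ.cost_glue h2, hc]
  simp [cost, G.E_pos he]

variable (G)

open Classical in
/-- The largest product of the factors `exp (- β * w u)` along a path. -/
def K (β : ℝ) (w : ℕ → ℝ) (j p a b : ℕ) : ℝ :=
  if G.Reach j p a b then Real.exp (-(β * G.D w j p a b)) else 0

variable {G}
variable {β : ℝ} {w : ℕ → ℝ}

theorem K_nonneg (β : ℝ) (w : ℕ → ℝ) (j p a b : ℕ) : 0 ≤ G.K β w j p a b := by
  unfold K
  split_ifs
  · exact (Real.exp_pos _).le
  · exact le_rfl

theorem K_pos : 0 < G.K β w j p a b ↔ G.Reach j p a b := by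
  unfold K
  split_ifs with h
  · simp [h, Real.exp_pos]
  · simp [h]

theorem K_self (β : ℝ) (w : ℕ → ℝ) (j p a : ℕ) : G.K β w j p a a = 1 := by
  rw [K, if_pos (Reach.refl j p a), D_self]
  simp

/-- The recursion for `K`. -/
theorem isGreatest_K (hβ : 0 ≤ β) (w : ℕ → ℝ) (j p a v : ℕ) :
    IsGreatest {x | x = (if a = v then 1 else 0) ∨ ∃ u < v, (G.E u v ∧ G.V u * p < j * G.M) ∧
      x = G.K β w j p a u * Real.exp (-(β * w u))} (G.K β w j p a v) := by
  have hub : ∀ u, G.E u v → G.V u * p < j * G.M →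
      G.K β w j p a u * Real.exp (-(β * w u)) ≤ G.K β w j p a v := by
    intro u he ho
    by_cases hr : G.Reach j p a u
    · have hr' : G.Reach j p a v := hr.trans ⟨_, isPath_edge he ho⟩
      rw [K, K, if_pos hr, if_pos hr', ← Real.exp_add]
      refine Real.exp_le_exp.2 ?_
      have := mul_le_mul_of_nonneg_left (D_add_edge (w := w) hr he ho) hβ
      rw [mul_add] at this
      linarith
    · rw [K, if_neg hr, zero_mul]
      exact K_nonneg _ _ _ _ _ _
  constructor
  · by_cases hav : a = v
    · subst hav
      left
      rw [K_self, if_pos rfl]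
    by_cases hr : G.Reach j p a v
    · right
      obtain ⟨ρ, hρ, hc⟩ := hr.exists_min w
      have hlt : G.pos a < G.pos v := hr.pos_le.lt_of_ne fun h => hav (hr.eq_of_pos h)
      obtain ⟨i, hi⟩ : ∃ i, G.pos v = i + 1 := ⟨G.pos v - 1, by omega⟩
      have he := hρ.edge i (by omega) (by omega)
      have ho := hρ.ok i (by omega) (by omega)
      have hpi := hρ.pos_eq (i := i) (by omega) (by omega)
      have hv : ρ (i + 1) = v := by rw [← hi, hρ.right]
      rw [hv] at he
      refine ⟨ρ i, G.E_lt' he, ⟨he, ho⟩, le_antisymm ?_ (hub _ he ho)⟩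
      have ht := hρ.take (i := i) (by omega) (by omega)
      rw [K, if_pos hr, K, if_pos ⟨ρ, ht⟩, ← Real.exp_add]
      refine Real.exp_le_exp.2 ?_
      have h1 := ht.D_le w
      have h2 : G.cost w a v ρ = G.cost w a (ρ i) ρ + w (ρ i) := by
        rw [cost_split w ht.le (b := ρ i) (by rw [hpi]; omega)]
        simp [cost, hpi, hi]
      have := mul_le_mul_of_nonneg_left h1 hβ
      rw [← hc, h2, mul_add]
      linarith
    · left
      rw [K, if_neg hr, if_neg hav]
  · rintro x (rfl | ⟨u, -, ⟨he, ho⟩, rfl⟩)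
    · split_ifs with h
      · subst h
        rw [K_self]
      · exact K_nonneg _ _ _ _ _ _
    · exact hub u he ho

/-! ### Splitting a path at a threshold -/

variable (G)

open Classical in
/-- The weight of the candidate `u` for the first node at or above the threshold `j₁ / p` on a path
from `lo` to `hi` below the threshold `j₂ / p`. -/
def wt (β : ℝ) (w : ℕ → ℝ) (j₁ j₂ p lo hi u : ℕ) : ℝ :=
  if j₁ * G.M ≤ G.V u * p then G.K β w j₁ p lo u * G.K β w j₂ p u hi else 0

variable {G}
variable {j₁ j₂ lo hi u : ℕ}

theorem wt_nonneg (β : ℝ) (w : ℕ → ℝ) (j₁ j₂ p lo hi u : ℕ) :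
    0 ≤ G.wt β w j₁ j₂ p lo hi u := by
  unfold wt
  split_ifs
  · exact mul_nonneg (K_nonneg _ _ _ _ _ _) (K_nonneg _ _ _ _ _ _)
  · exact le_rfl

theorem wt_pos : 0 < G.wt β w j₁ j₂ p lo hi u ↔
    j₁ * G.M ≤ G.V u * p ∧ G.Reach j₁ p lo u ∧ G.Reach j₂ p u hi := by
  unfold wt
  split_ifs with h
  · constructor
    · intro h'
      refine ⟨h, ?_, ?_⟩
      · by_contra h1
        rw [K, if_neg h1, zero_mul] at h'
        exact lt_irrefl _ h'
      · by_contra h1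
        rw [K.eq_1 _ _ _ _ _ u, if_neg h1, mul_zero] at h'
        exact lt_irrefl _ h'
    · rintro ⟨-, h1, h2⟩
      exact mul_pos (K_pos.2 h1) (K_pos.2 h2)
  · simp [h]

theorem neg_log_wt (h : 0 < G.wt β w j₁ j₂ p lo hi u) :
    -Real.log (G.wt β w j₁ j₂ p lo hi u) =
      β * (G.D w j₁ p lo u + G.D w j₂ p u hi) := by
  obtain ⟨h0, h1, h2⟩ := wt_pos.1 h
  rw [wt, if_pos h0, K, K, if_pos h1, if_pos h2, ← Real.exp_add, Real.log_exp]
  ring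

/-- The first node of an optimal path at or above a threshold. -/
theorem exists_crossing (w : ℕ → ℝ) (hr : G.Reach j₂ p lo hi) (hj : j₁ ≤ j₂)
    (hhi : j₂ * G.M ≤ G.V hi * p) (hlo : lo < G.N) :
    ∃ u < G.N, j₁ * G.M ≤ G.V u * p ∧ G.Reach j₁ p lo u ∧ G.Reach j₂ p u hi ∧
      G.D w j₁ p lo u + G.D w j₂ p u hi ≤ G.D w j₂ p lo hi := by
  classical
  obtain ⟨ρ, hρ, hc⟩ := hr.exists_min w
  have hex : ∃ i, G.pos lo ≤ i ∧ j₁ * G.M ≤ G.V (ρ i) * p :=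
    ⟨G.pos hi, hρ.le, by rw [hρ.right]; exact (Nat.mul_le_mul_right _ hj).trans hhi⟩
  set i := Nat.find hex
  obtain ⟨hi1, hi2⟩ := Nat.find_spec hex
  have hi3 : i ≤ G.pos hi :=
    Nat.find_min' hex ⟨hρ.le, by rw [hρ.right]; exact (Nat.mul_le_mul_right _ hj).trans hhi⟩
  have hp := hρ.pos_eq hi1 hi3
  -- By minimality of i, all nodes before the crossing are below the lower threshold; the remainder
  -- keeps the threshold j₂ / p. The crossing node itself is counted only in the second part.
  have ht : G.IsPath j₁ p lo (ρ i) ρ := (hρ.take hi1 hi3).of_ok fun i' h1 h2 => by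
    rw [hp] at h2
    have := Nat.find_min hex h2
    simp only [not_and, not_le] at this
    exact this h1
  have hd := hρ.drop hi1 hi3
  refine ⟨ρ i, hρ.lt_N hlo hi1 hi3, hi2, ⟨ρ, ht⟩, ⟨ρ, hd⟩, ?_⟩
  rw [← hc, cost_split w ht.le hd.le]
  exact add_le_add (ht.D_le w) (hd.D_le w)

/-! ### Sensitivity -/

/-- A perturbation of the weights in the layer `x`, by amounts in `[A, A + Δ]` for the values in
`[j₀ / p, j₂ / p)`. -/
structure Perturb (G : LGraph) (w w' : ℕ → ℝ) (x j₀ j₂ p : ℕ) (A Δ : ℝ) : Prop where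
  ne : ∀ u, G.pos u ≠ x → w' u = w u
  lower : ∀ u, G.pos u = x → G.V u ≤ G.Q → j₀ * G.M ≤ G.V u * p → G.V u * p < j₂ * G.M →
    w u + A ≤ w' u
  upper : ∀ u, G.pos u = x → G.V u ≤ G.Q → j₀ * G.M ≤ G.V u * p → G.V u * p < j₂ * G.M →
    w' u ≤ w u + (A + Δ)

/-- `c` if the layer `x` lies between `a` and `b`. -/
def chi (G : LGraph) (x a b : ℕ) (c : ℝ) : ℝ := if G.pos a ≤ x ∧ x < G.pos b then c else 0

variable {w' : ℕ → ℝ} {x j₀ : ℕ} {A Δ : ℝ}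

/-- A path meets the layer x at most once, and monotonicity of values keeps all its nodes before the
end in the range [j₀/p, j₂/p) where the perturbation is controlled. -/
theorem Perturb.cost (hw : G.Perturb w w' x j₀ j₂ p A Δ) (hj : j ≤ j₂)
    (ha : j₀ * G.M ≤ G.V a * p) (hρ : G.IsPath j p a b ρ) :
    G.cost w a b ρ + G.chi x a b A ≤ G.cost w' a b ρ ∧
      G.cost w' a b ρ ≤ G.cost w a b ρ + G.chi x a b (A + Δ) := by
  have hdiff : ∀ C : ℝ, G.chi x a b C = ∑ i ∈ Finset.Ico (G.pos a) (G.pos b),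
      if i = x then C else 0 := by
    intro C
    rw [Finset.sum_ite_eq', chi]
    simp
  have hnode : ∀ i ∈ Finset.Ico (G.pos a) (G.pos b), G.pos (ρ i) = i ∧ G.V (ρ i) ≤ G.Q ∧
      j₀ * G.M ≤ G.V (ρ i) * p ∧ G.V (ρ i) * p < j₂ * G.M := by
    intro i hi
    rw [Finset.mem_Ico] at hi
    refine ⟨hρ.pos_eq hi.1 hi.2.le, G.E_Q (hρ.edge i hi.1 hi.2), ?_, ?_⟩
    · refine ha.trans (Nat.mul_le_mul_right _ ?_)
      have := hρ.V_mono le_rfl hi.1 hi.2.le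
      rwa [hρ.left] at this
    · exact (hρ.ok i hi.1 hi.2).trans_le (Nat.mul_le_mul_right _ hj)
  simp only [hdiff, LGraph.cost, ← Finset.sum_add_distrib]
  refine ⟨Finset.sum_le_sum fun i hi => ?_, Finset.sum_le_sum fun i hi => ?_⟩
  · obtain ⟨h1, h2, h3, h4⟩ := hnode i hi
    split_ifs with hx
    · exact hw.lower _ (h1.trans hx) h2 h3 h4
    · rw [hw.ne _ (by rw [h1]; exact hx)]; simp
  · obtain ⟨h1, h2, h3, h4⟩ := hnode i hi
    split_ifs with hx
    · exact hw.upper _ (h1.trans hx) h2 h3 h4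
    · rw [hw.ne _ (by rw [h1]; exact hx)]; simp

theorem Perturb.D (hw : G.Perturb w w' x j₀ j₂ p A Δ) (hj : j ≤ j₂)
    (ha : j₀ * G.M ≤ G.V a * p) (h : G.Reach j p a b) :
    G.D w j p a b + G.chi x a b A ≤ G.D w' j p a b ∧
      G.D w' j p a b ≤ G.D w j p a b + G.chi x a b (A + Δ) := by
  obtain ⟨ρ, hρ, hc⟩ := h.exists_min w
  obtain ⟨ρ', hρ', hc'⟩ := h.exists_min w'
  constructor
  · rw [← hc']
    have := (hw.cost hj ha hρ').1
    have := hρ'.D_le w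
    linarith
  · rw [← hc]
    have := (hw.cost hj ha hρ).2
    have := hρ.D_le w'
    linarith

theorem chi_add (x : ℕ) (h1 : G.pos a ≤ G.pos b) (h2 : G.pos b ≤ G.pos c) (C : ℝ) :
    G.chi x a b C + G.chi x b c C = G.chi x a c C := by
  unfold chi
  split_ifs <;> first | (exfalso; omega) | simp

theorem chi_smul (x a b : ℕ) (β C : ℝ) : β * G.chi x a b C = G.chi x a b (β * C) := by
  unfold chi
  split_ifs <;> simp

/-- The layer x is passed either before or after the candidate u but not both, so `chi` of the two
parts adds up to `chi` of the cell, the same for all candidates. The two exponents differ from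
opposite numbers by βΔ only: A drops out when they are added in `reservoir_le`. -/
theorem Perturb.wt_le (hw : G.Perturb w w' x j₀ j₂ p A Δ) (hβ : 0 ≤ β) (hj : j₀ ≤ j₁)
    (hj' : j₁ ≤ j₂) (hlo : j₀ * G.M ≤ G.V lo * p) (u : ℕ) :
    G.wt β w' j₁ j₂ p lo hi u ≤
        Real.exp (G.chi x lo hi (-(β * A))) * G.wt β w j₁ j₂ p lo hi u ∧
      G.wt β w j₁ j₂ p lo hi u ≤
        Real.exp (G.chi x lo hi (β * (A + Δ))) * G.wt β w' j₁ j₂ p lo hi u := by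
  by_cases hu : j₁ * G.M ≤ G.V u * p ∧ G.Reach j₁ p lo u ∧ G.Reach j₂ p u hi
  · obtain ⟨h0, h1, h2⟩ := hu
    have hD1 := hw.D hj' hlo h1
    have hD2 := hw.D le_rfl ((Nat.mul_le_mul_right _ hj).trans h0) h2
    simp only [wt, if_pos h0, K, if_pos h1, if_pos h2, ← Real.exp_add, Real.exp_le_exp]
    have hA := chi_add x h1.pos_le h2.pos_le A
    have hB := chi_add x h1.pos_le h2.pos_le (A + Δ)
    have e1 : G.chi x lo hi (-(β * A)) = -(β * G.chi x lo hi A) := by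
      rw [chi_smul]; unfold chi; split_ifs <;> simp
    rw [e1, ← chi_smul, ← hA, ← hB]
    constructor
    · have := mul_le_mul_of_nonneg_left (add_le_add hD1.1 hD2.1) hβ
      linarith
    · have := mul_le_mul_of_nonneg_left (add_le_add hD1.2 hD2.2) hβ
      linarith
  · have e : ∀ w'' : ℕ → ℝ, G.wt β w'' j₁ j₂ p lo hi u = 0 := fun w'' =>
      le_antisymm (not_lt.1 fun h => hu (wt_pos.1 h)) (wt_nonneg _ _ _ _ _ _ _ _)
    rw [e, e]; simp

end LGraph

end PrivIso
end

noncomputable section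
namespace PrivIso
namespace LGraph

variable {G : LGraph}

/-! ### One level of the mechanism -/

/-- `A` is a sequence of nodes that splits a path at the thresholds `0 / p, 1 / p, …, p / p`. -/
structure Valid (G : LGraph) (p : ℕ) (A : ℕ → ℕ) : Prop where
  zero : A 0 = 0
  last : A p = G.sink
  reach : ∀ j < p, G.Reach (j + 1) p (A j) (A (j + 1))
  above : ∀ j ≤ p, j * G.M ≤ G.V (A j) * p
  lt : ∀ j ≤ p, A j < G.N

/-- Interleave two sequences. -/
def merge (p : ℕ) (A B : ℕ → ℕ) (i : ℕ) : ℕ :=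
  if i ≤ 2 * p then (if i % 2 = 0 then A (i / 2) else B (i / 2)) else A i

theorem merge_even {p j : ℕ} (h : j ≤ p) (A B : ℕ → ℕ) : merge p A B (2 * j) = A j := by
  unfold merge
  rw [if_pos (by omega), if_pos (by omega)]
  congr 1
  omega

theorem merge_odd {p j : ℕ} (h : j < p) (A B : ℕ → ℕ) : merge p A B (2 * j + 1) = B j := by
  unfold merge
  rw [if_pos (by omega), if_neg (by omega)]
  congr 1
  omega

variable (G)

/-- The weight of a candidate in the `j`-th cell of a level with `p` cells. -/
def cellWt (β : ℝ) (w : ℕ → ℝ) (p : ℕ) (A : ℕ → ℕ) (j u : ℕ) : ℝ :=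
  G.wt β w (2 * j + 1) (2 * j + 2) (2 * p) (A j) (A (j + 1)) u

/-- Sample the node that splits the `j`-th cell. -/
def cellStep (β : ℝ) (w : ℕ → ℝ) (p : ℕ) (A : ℕ → ℕ) (j : ℕ) (B : ℕ → ℕ) : PMF (ℕ → ℕ) :=
  (reservoir (G.cellWt β w p A j) G.N).map fun u => Function.update B j u

/-- Split all cells of a level. -/
def levelStep (β : ℝ) (w : ℕ → ℝ) (p : ℕ) (s : (ℕ → ℕ) × (ℕ → ℕ)) : PMF ((ℕ → ℕ) × (ℕ → ℕ)) :=
  (iter (G.cellStep β w p s.1) s.2 p).map fun B => (merge p s.1 B, B)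

/-- The total weight of the optimal paths between consecutive nodes. -/
def potential (w : ℕ → ℝ) (p : ℕ) (A : ℕ → ℕ) : ℝ :=
  ∑ j ∈ Finset.range p, G.D w (j + 1) p (A j) (A (j + 1))

variable {G}
variable {β : ℝ} {w w' : ℕ → ℝ} {p : ℕ} {A : ℕ → ℕ}

theorem isPath_scale {j a b : ℕ} {ρ : ℕ → ℕ} :
    G.IsPath (2 * j) (2 * p) a b ρ ↔ G.IsPath j p a b ρ := by
  have h : ∀ i, G.V (ρ i) * (2 * p) < 2 * j * G.M ↔ G.V (ρ i) * p < j * G.M := fun i => by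
    rw [show G.V (ρ i) * (2 * p) = 2 * (G.V (ρ i) * p) by ring, mul_assoc]
    omega
  exact ⟨fun hp => hp.of_ok fun i h1 h2 => (h i).1 (hp.ok i h1 h2),
    fun hp => hp.of_ok fun i h1 h2 => (h i).2 (hp.ok i h1 h2)⟩

theorem reach_scale {j a b : ℕ} : G.Reach (2 * j) (2 * p) a b ↔ G.Reach j p a b := by
  simp only [Reach, isPath_scale]

theorem D_scale {j a b : ℕ} : G.D w (2 * j) (2 * p) a b = G.D w j p a b := by
  simp only [D, isPath_scale]

/-- The thresholds j/p and (2j)/(2p) agree, so a cell of level p may be split at its midpoint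
(2j+1)/(2p). The node where an optimal path crosses shows that a free choice exists, hence that the
sampling weights have positive sum. -/
theorem Valid.crossing (h : G.Valid p A) (w : ℕ → ℝ) {j : ℕ} (hj : j < p) :
    ∃ u < G.N, (2 * j + 1) * G.M ≤ G.V u * (2 * p) ∧
      G.Reach (2 * j + 1) (2 * p) (A j) u ∧ G.Reach (2 * j + 2) (2 * p) u (A (j + 1)) ∧
      G.D w (2 * j + 1) (2 * p) (A j) u + G.D w (2 * j + 2) (2 * p) u (A (j + 1)) ≤
        G.D w (j + 1) p (A j) (A (j + 1)) := by
  have e : 2 * j + 2 = 2 * (j + 1) := by ring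
  rw [← D_scale (j := j + 1), ← e]
  refine exists_crossing w ?_ (by omega) ?_ (h.lt j hj.le)
  · rw [e, reach_scale]; exact h.reach j hj
  · rw [e]
    have := h.above (j + 1) hj
    calc 2 * (j + 1) * G.M = 2 * ((j + 1) * G.M) := by ring
      _ ≤ 2 * (G.V (A (j + 1)) * p) := by omega
      _ = _ := by ring

theorem cellWt_nonneg (β : ℝ) (w : ℕ → ℝ) (p : ℕ) (A : ℕ → ℕ) (j u : ℕ) :
    0 ≤ G.cellWt β w p A j u := wt_nonneg _ _ _ _ _ _ _ _

theorem Valid.sum_pos (h : G.Valid p A) (β : ℝ) (w : ℕ → ℝ) {j : ℕ} (hj : j < p) :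
    0 < ∑ u ∈ Finset.range G.N, G.cellWt β w p A j u := by
  obtain ⟨u, hu, h1, h2, h3, -⟩ := h.crossing w hj
  refine (wt_pos.2 ⟨h1, h2, h3⟩ : 0 < G.cellWt β w p A j u).trans_le ?_
  exact Finset.single_le_sum (f := fun u => G.cellWt β w p A j u)
    (fun i _ => cellWt_nonneg _ _ _ _ _ _) (Finset.mem_range.2 hu)

theorem cellStep_finite (β : ℝ) (w : ℕ → ℝ) (p : ℕ) (A : ℕ → ℕ) (j : ℕ) (B : ℕ → ℕ) :
    (G.cellStep β w p A j B).support.Finite := finite_support_map _ (reservoir_finite _ _)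

theorem levelStep_finite (β : ℝ) (w : ℕ → ℝ) (p : ℕ) (s : (ℕ → ℕ) × (ℕ → ℕ)) :
    (G.levelStep β w p s).support.Finite :=
  finite_support_map _ (iter_finite (fun _ _ => cellStep_finite _ _ _ _ _ _) _ _)

/-- What is known after the splits of the first `J` cells. -/
def Splits (G : LGraph) (p : ℕ) (A : ℕ → ℕ) (J : ℕ) (B : ℕ → ℕ) : Prop :=
  ∀ j < J, B j < G.N ∧ (2 * j + 1) * G.M ≤ G.V (B j) * (2 * p) ∧
    G.Reach (2 * j + 1) (2 * p) (A j) (B j) ∧ G.Reach (2 * j + 2) (2 * p) (B j) (A (j + 1))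

theorem Valid.splits_step (h : G.Valid p A) (β : ℝ) (w : ℕ → ℝ) {j : ℕ} (hj : j < p) (B : ℕ → ℕ)
    (hB : G.Splits p A j B) : ∀ B' ∈ (G.cellStep β w p A j B).support, G.Splits p A (j + 1) B' := by
  intro B' hB'
  rw [cellStep, PMF.support_map] at hB'
  obtain ⟨u, hu, rfl⟩ := hB'
  obtain ⟨h1, h2⟩ := reservoir_support (cellWt_nonneg _ _ _ _ _) (h.sum_pos β w hj) hu
  intro i hi
  beta_reduce
  rcases Nat.lt_succ_iff_lt_or_eq.1 hi with hi | rfl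
  · rw [Function.update_of_ne hi.ne]
    exact hB i hi
  · rw [Function.update_self]
    exact ⟨h1, wt_pos.1 h2⟩

theorem Valid.merge (h : G.Valid p A) {B : ℕ → ℕ} (hB : G.Splits p A p B) :
    G.Valid (2 * p) (merge p A B) where
  zero := by rw [show 0 = 2 * 0 by rfl, merge_even (by omega), h.zero]
  last := by rw [merge_even le_rfl, h.last]
  reach j hj := by
    rcases Nat.even_or_odd' j with ⟨i, rfl | rfl⟩
    · rw [merge_even (by omega), merge_odd (by omega)]
      exact (hB i (by omega)).2.2.1
    · rw [merge_odd (by omega), show 2 * i + 1 + 1 = 2 * (i + 1) by ring, merge_even (by omega)]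
      exact (hB i (by omega)).2.2.2
  above j hj := by
    rcases Nat.even_or_odd' j with ⟨i, rfl | rfl⟩
    · rw [merge_even (by omega)]
      have := h.above i (by omega)
      calc 2 * i * G.M = 2 * (i * G.M) := by ring
        _ ≤ 2 * (G.V (A i) * p) := by omega
        _ = _ := by ring
    · rw [merge_odd (by omega)]
      exact (hB i (by omega)).2.1
  lt j hj := by
    rcases Nat.even_or_odd' j with ⟨i, rfl | rfl⟩
    · rw [merge_even (by omega)]
      exact h.lt i (by omega)
    · rw [merge_odd (by omega)]
      exact (hB i (by omega)).1

theorem Valid.levelStep (h : G.Valid p A) (β : ℝ) (w : ℕ → ℝ) (B : ℕ → ℕ) :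
    ∀ s ∈ (G.levelStep β w p (A, B)).support, G.Valid (2 * p) s.1 := by
  intro s hs
  rw [LGraph.levelStep, PMF.support_map] at hs
  obtain ⟨B', hB', rfl⟩ := hs
  refine h.merge (iter_support (I := G.Splits p A) (fun j hj => by omega) ?_ B' hB')
  exact fun j hj B hB => h.splits_step β w hj B hB

theorem potential_merge (w : ℕ → ℝ) (p : ℕ) (A B : ℕ → ℕ) :
    G.potential w (2 * p) (LGraph.merge p A B) = ∑ j ∈ Finset.range p,
      (G.D w (2 * j + 1) (2 * p) (A j) (B j) + G.D w (2 * j + 2) (2 * p) (B j) (A (j + 1))) := by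
  have key : ∀ P ≤ p, ∑ j ∈ Finset.range (2 * P),
      G.D w (j + 1) (2 * p) (LGraph.merge p A B j) (LGraph.merge p A B (j + 1)) =
      ∑ j ∈ Finset.range P,
      (G.D w (2 * j + 1) (2 * p) (A j) (B j) +
        G.D w (2 * j + 2) (2 * p) (B j) (A (j + 1))) := by
    intro P
    induction P with
    | zero => intro _; simp
    | succ P ih =>
      intro hP
      rw [show 2 * (P + 1) = 2 * P + 1 + 1 by ring, Finset.sum_range_succ, Finset.sum_range_succ,
        Finset.sum_range_succ, ih (by omega), merge_even (by omega), merge_odd (by omega),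
        show 2 * P + 1 + 1 = 2 * (P + 1) by ring, merge_even hP, add_assoc]
  exact key p le_rfl

/-- The utility of a level. -/
theorem Valid.ex_levelStep_le (h : G.Valid p A) (hβ : 0 < β) (w : ℕ → ℝ) (B : ℕ → ℕ) :
    ex (G.levelStep β w p (A, B)) (fun s => G.potential w (2 * p) s.1) ≤
      G.potential w p A + p * (Real.log G.N / β) := by
  have hfin : ∀ j B, (G.cellStep β w p A j B).support.Finite := fun j B =>
    cellStep_finite _ _ _ _ _ _
  rw [LGraph.levelStep, ex_map (iter_finite hfin _ _)]
  simp only [potential_merge]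
  set f : ℕ → ℕ → ℝ := fun j u =>
    G.D w (2 * j + 1) (2 * p) (A j) u + G.D w (2 * j + 2) (2 * p) u (A (j + 1)) with hf
  -- The potential is the cost of the cells split so far; each step adds the cost of the unsplit
  -- cell plus the loss (log N)/β of one exponential mechanism.
  have key := ex_iter_le hfin (x := B) (J := p) (I := G.Splits p A) (fun j hj => by omega)
    (fun j hj B hB => h.splits_step β w hj B hB)
    (fun J B => ∑ j ∈ Finset.range J, f j (B j))
    (fun j => G.D w (j + 1) p (A j) (A (j + 1)) + Real.log G.N / β) ?_
  · simp only [Finset.range_zero, Finset.sum_empty, zero_add, Finset.sum_add_distrib,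
      Finset.sum_const, Finset.card_range, nsmul_eq_mul] at key
    exact key
  · intro j hj B hB
    have hr := reservoir_finite (G.cellWt β w p A j) G.N
    rw [cellStep, ex_map hr]
    have e : ∀ u, ∑ i ∈ Finset.range (j + 1), f i (Function.update B j u i) =
        f j u + ∑ i ∈ Finset.range j, f i (B i) := by
      intro u
      rw [Finset.sum_range_succ, Function.update_self, add_comm]
      congr 1
      refine Finset.sum_congr rfl fun i hi => ?_
      rw [Function.update_of_ne (by simp at hi; omega)]
    simp only [e]
    rw [ex_add_const hr, add_comm]
    refine add_le_add le_rfl ?_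
    -- The comparison candidate is the crossing node of an optimal path, for which splitting is
    -- free.
    obtain ⟨u₀, hu, h1, h2, h3, h4⟩ := h.crossing w hj
    have hpos : 0 < G.cellWt β w p A j u₀ := wt_pos.2 ⟨h1, h2, h3⟩
    have hmain := ex_reservoir_neg_log (cellWt_nonneg β w p A j) hu hpos
    have hcongr : ex (reservoir (G.cellWt β w p A j) G.N) (fun u => β * f j u) ≤
        ex (reservoir (G.cellWt β w p A j) G.N) (fun u => -Real.log (G.cellWt β w p A j u)) := by
      refine ex_mono hr fun u hu => ?_
      have := (reservoir_support (cellWt_nonneg β w p A j) (h.sum_pos β w hj) hu).2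
      rw [cellWt, neg_log_wt this]
    rw [ex_const_mul] at hcongr
    rw [cellWt, neg_log_wt hpos] at hmain
    have := mul_le_mul_of_nonneg_left h4 hβ.le
    have h5 : β * ex (reservoir (G.cellWt β w p A j) G.N) (fun u => f j u) ≤
        β * (G.D w (j + 1) p (A j) (A (j + 1)) + Real.log G.N / β) := by
      rw [mul_add, mul_div_cancel₀ _ hβ.ne']
      linarith
    exact le_of_mul_le_mul_left h5 hβ

theorem Valid.pos_mono (h : G.Valid p A) {i j : ℕ} (hij : i ≤ j) (hj : j ≤ p) :
    G.pos (A i) ≤ G.pos (A j) := by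
  induction j, hij using Nat.le_induction with
  | base => exact le_rfl
  | succ j hij ih => exact (ih (by omega)).trans (h.reach j (by omega)).pos_le

/-- Parallel composition: the intervals of layers of the cells are consecutive, so the layer x lies
in at most one of them and p samples cost no more privacy than one. -/
theorem Valid.sum_chi_le (h : G.Valid p A) (x : ℕ) {C : ℝ} (hC : 0 ≤ C) :
    ∑ j ∈ Finset.range p, G.chi x (A j) (A (j + 1)) C ≤ C := by
  have key : ∀ J ≤ p, ∑ j ∈ Finset.range J, G.chi x (A j) (A (j + 1)) C = G.chi x (A 0) (A J) C := by
    intro J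
    induction J with
    | zero =>
      intro _
      unfold chi
      rw [if_neg (by omega)]; simp
    | succ J ih =>
      intro hJ
      rw [Finset.sum_range_succ, ih (by omega), chi_add x (h.pos_mono (by omega) (by omega))
        (h.pos_mono (by omega) hJ)]
  rw [key p le_rfl]
  unfold chi
  split_ifs
  · exact le_rfl
  · exact hC

/-- The privacy loss of a level, if the weights are perturbed in one layer. -/
theorem Valid.levelStep_le (h : G.Valid p A) (hβ : 0 ≤ β) {x : ℕ} {Δ : ℝ} (hΔ : 0 ≤ Δ)
    (hw : ∀ j < p, ∃ C, G.Perturb w w' x (2 * j) (2 * j + 2) (2 * p) C Δ) (B : ℕ → ℕ)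
    (s : (ℕ → ℕ) × (ℕ → ℕ)) :
    G.levelStep β w p (A, B) s ≤
        ENNReal.ofReal (Real.exp (β * Δ)) * G.levelStep β w' p (A, B) s ∧
      G.levelStep β w' p (A, B) s ≤
        ENNReal.ofReal (Real.exp (β * Δ)) * G.levelStep β w p (A, B) s := by
  have hcell : ∀ j < p, ∀ u,
      reservoir (G.cellWt β w p A j) G.N u ≤
        ENNReal.ofReal (Real.exp (G.chi x (A j) (A (j + 1)) (β * Δ))) *
          reservoir (G.cellWt β w' p A j) G.N u ∧
      reservoir (G.cellWt β w' p A j) G.N u ≤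
        ENNReal.ofReal (Real.exp (G.chi x (A j) (A (j + 1)) (β * Δ))) *
          reservoir (G.cellWt β w p A j) G.N u := by
    intro j hj u
    obtain ⟨C, hC⟩ := hw j hj
    have hab : 2 * j * G.M ≤ G.V (A j) * (2 * p) := by
      have := h.above j hj.le
      calc 2 * j * G.M = 2 * (j * G.M) := by ring
        _ ≤ 2 * (G.V (A j) * p) := by omega
        _ = _ := by ring
    have hle := fun u => hC.wt_le (hi := A (j + 1)) hβ (j₁ := 2 * j + 1) (by omega) (by omega) hab u
    -- The offset C, which depends on the cell and the example, cancels between weight and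
    -- normalization.
    have e : G.chi x (A j) (A (j + 1)) (β * (C + Δ)) + G.chi x (A j) (A (j + 1)) (-(β * C)) =
        G.chi x (A j) (A (j + 1)) (β * Δ) := by
      unfold chi
      split_ifs <;> ring
    constructor
    · rw [← e]
      exact reservoir_le (cellWt_nonneg _ _ _ _ _) (cellWt_nonneg _ _ _ _ _) (h.sum_pos β w hj)
        (fun u _ => (hle u).2) (fun u _ => (hle u).1) u
    · rw [← e, add_comm]
      exact reservoir_le (cellWt_nonneg _ _ _ _ _) (cellWt_nonneg _ _ _ _ _) (h.sum_pos β w' hj)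
        (fun u _ => (hle u).1) (fun u _ => (hle u).2) u
  have hexp : ENNReal.ofReal (Real.exp (∑ j ∈ Finset.range p, G.chi x (A j) (A (j + 1)) (β * Δ))) ≤
      ENNReal.ofReal (Real.exp (β * Δ)) :=
    ENNReal.ofReal_le_ofReal (Real.exp_le_exp.2 (h.sum_chi_le x (mul_nonneg hβ hΔ)))
  constructor
  · refine map_apply_le (fun B' => ?_) _ s
    refine (iter_apply_le (I := fun _ _ => True) trivial (fun _ _ _ _ _ _ => trivial) _
      (fun j hj B _ z => map_apply_le (fun u => (hcell j hj u).1) _ z) B').trans ?_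
    exact mul_le_mul' hexp le_rfl
  · refine map_apply_le (fun B' => ?_) _ s
    refine (iter_apply_le (I := fun _ _ => True) trivial (fun _ _ _ _ _ _ => trivial) _
      (fun j hj B _ z => map_apply_le (fun u => (hcell j hj u).2) _ z) B').trans ?_
    exact mul_le_mul' hexp le_rfl

/-! ### All levels -/

variable (G)

/-- The initial nodes. -/
def start : (ℕ → ℕ) × (ℕ → ℕ) := (fun i => if i = 1 then G.sink else 0, fun _ => 0)

/-- `T` levels, where level `t` uses the inverse temperature `β t`. -/
def levels (β : ℕ → ℝ) (w : ℕ → ℝ) (T : ℕ) : PMF ((ℕ → ℕ) × (ℕ → ℕ)) :=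
  iter (fun t => G.levelStep (β t) w (2 ^ t)) G.start T

variable {G}

theorem valid_start (h : G.Reach 1 1 0 G.sink) : G.Valid 1 G.start.1 where
  zero := by simp [start]
  last := by simp [start]
  reach j hj := by
    obtain rfl : j = 0 := by omega
    simpa [start] using h
  above j hj := by
    interval_cases j
    · simp
    · simp [start, G.V_sink]
  lt j hj := by
    have := G.sink_lt
    simp only [start]
    split_ifs <;> omega

theorem levels_finite (β : ℕ → ℝ) (w : ℕ → ℝ) (T : ℕ) : (G.levels β w T).support.Finite :=
  iter_finite (fun _ _ => levelStep_finite _ _ _ _) _ _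

theorem levelStep_valid (β : ℕ → ℝ) (w : ℕ → ℝ) (t : ℕ) (s : (ℕ → ℕ) × (ℕ → ℕ))
    (hs : G.Valid (2 ^ t) s.1) :
    ∀ s' ∈ (G.levelStep (β t) w (2 ^ t) s).support, G.Valid (2 ^ (t + 1)) s'.1 := by
  intro s' hs'
  rw [pow_succ']
  exact hs.levelStep _ _ _ s' hs'

theorem levels_valid (h : G.Reach 1 1 0 G.sink) (β : ℕ → ℝ) (w : ℕ → ℝ) (T : ℕ) :
    ∀ s ∈ (G.levels β w T).support, G.Valid (2 ^ T) s.1 :=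
  iter_support (I := fun t (s : (ℕ → ℕ) × (ℕ → ℕ)) => G.Valid (2 ^ t) s.1)
    (by simpa using valid_start h) fun t _ s hs => levelStep_valid β w t s hs

theorem ex_levels_le (h : G.Reach 1 1 0 G.sink) (β : ℕ → ℝ) (hβ : ∀ t, 0 < β t) (w : ℕ → ℝ)
    (T : ℕ) :
    ex (G.levels β w T) (fun s => G.potential w (2 ^ T) s.1) ≤
      G.D w 1 1 0 G.sink + ∑ t ∈ Finset.range T, ((2 : ℝ) ^ t * (Real.log G.N / β t)) := by
  have := ex_iter_le (g := fun t => G.levelStep (β t) w (2 ^ t))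
    (fun _ _ => levelStep_finite _ _ _ _) (x := G.start) (J := T)
    (I := fun t (s : (ℕ → ℕ) × (ℕ → ℕ)) => G.Valid (2 ^ t) s.1) (by simpa using valid_start h)
    (fun t _ s hs => levelStep_valid β w t s hs)
    (fun t s => G.potential w (2 ^ t) s.1)
    (fun t => (2 : ℝ) ^ t * (Real.log G.N / β t))
    (fun t _ s hs => by
      have := hs.ex_levelStep_le (hβ t) w s.2
      rw [pow_succ']
      push_cast at this ⊢
      exact this)
  simpa [potential, start, levels] using this

/-- Both directions are needed later, because a replacement is compared through the weights with the
example deleted. -/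
theorem levels_le (h : G.Reach 1 1 0 G.sink) (β : ℕ → ℝ) (hβ : ∀ t, 0 ≤ β t) {w w' : ℕ → ℝ}
    (T : ℕ) {x : ℕ} {Δ : ℕ → ℝ} (hΔ : ∀ t, 0 ≤ Δ t)
    (hw : ∀ t, ∀ j < 2 ^ t, ∃ C, G.Perturb w w' x (2 * j) (2 * j + 2) (2 * 2 ^ t) C (Δ t))
    (s : (ℕ → ℕ) × (ℕ → ℕ)) :
    G.levels β w T s ≤ ENNReal.ofReal (Real.exp (∑ t ∈ Finset.range T, β t * Δ t)) *
        G.levels β w' T s ∧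
      G.levels β w' T s ≤ ENNReal.ofReal (Real.exp (∑ t ∈ Finset.range T, β t * Δ t)) *
        G.levels β w T s := by
  have h0 : G.Valid (2 ^ 0) G.start.1 := by simpa using valid_start h
  have hle : ∀ t < T, ∀ s : (ℕ → ℕ) × (ℕ → ℕ), G.Valid (2 ^ t) s.1 → ∀ z, _ ∧ _ :=
    fun t _ s hs z => hs.levelStep_le (hβ t) (hΔ t) (hw t) s.2 z
  exact ⟨iter_apply_le (I := fun t (s : (ℕ → ℕ) × (ℕ → ℕ)) => G.Valid (2 ^ t) s.1) h0
      (fun t _ => levelStep_valid β w t) _ (fun t ht s hs z => (hle t ht s hs z).1) s,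
    iter_apply_le (I := fun t (s : (ℕ → ℕ) × (ℕ → ℕ)) => G.Valid (2 ^ t) s.1) h0
      (fun t _ => levelStep_valid β w' t) _ (fun t ht s hs z => (hle t ht s hs z).2) s⟩

/-! ### The walk through the chosen nodes -/

variable (G)

open Classical in
/-- One step towards `hi` below the threshold `j / p`; the state consists of the current node and
the list of the nodes visited in the layers. -/
def walkStep (j p hi : ℕ) (s : ℕ × (ℕ → ℕ)) : ℕ × (ℕ → ℕ) :=
  if s.1 < hi then
    let x := Nat.findGreatest (fun u => G.E s.1 u ∧ G.Reach j p u hi) (G.N - 1)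
    (x, Function.update s.2 (G.pos x) x)
  else s

/-- The walk through the first `j` cells. -/
def walk (p : ℕ) (A : ℕ → ℕ) : ℕ → ℕ × (ℕ → ℕ)
  | 0 => (0, fun _ => 0)
  | j + 1 => (G.walkStep (j + 1) p (A (j + 1)))^[G.R + 1] (walk p A j)

variable {G}

/-- `s` describes a walk in the cell `j` (from `lo` to `hi`). -/
structure InCell (G : LGraph) (j p lo hi : ℕ) (s : ℕ × (ℕ → ℕ)) : Prop where
  path : G.IsPath j p lo s.1 s.2
  reach : G.Reach j p s.1 hi

theorem InCell.lt_or_eq {j p lo hi : ℕ} {s : ℕ × (ℕ → ℕ)} (h : G.InCell j p lo hi s) :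
    s.1 < hi ∨ s.1 = hi := by
  rcases h.reach.pos_le.lt_or_eq with h1 | h1
  · exact Or.inl (G.lt_of_pos_lt h1)
  · exact Or.inr (h.reach.eq_of_pos h1)

theorem InCell.step {j p lo hi : ℕ} {s : ℕ × (ℕ → ℕ)} (h : G.InCell j p lo hi s)
    (hlt : s.1 < hi) :
    G.InCell j p lo hi (G.walkStep j p hi s) ∧
      G.pos (G.walkStep j p hi s).1 = G.pos s.1 + 1 ∧
      ∀ i ≤ G.pos s.1, (G.walkStep j p hi s).2 i = s.2 i := by
  classical
  obtain ⟨cur, PI⟩ := s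
  simp only at hlt
  obtain ⟨hp, ρ, hρ⟩ := h
  simp only at hp hρ
  have hpos : G.pos cur < G.pos hi :=
    hρ.le.lt_of_ne fun e => hlt.ne (Reach.eq_of_pos ⟨ρ, hρ⟩ e)
  have he := hρ.edge (G.pos cur) le_rfl hpos
  have ho := hρ.ok (G.pos cur) le_rfl hpos
  rw [hρ.left] at he ho
  have hd : G.Reach j p (ρ (G.pos cur + 1)) hi := ⟨ρ, hρ.drop (by omega) hpos⟩
  -- The second node of a path that witnesses reachability satisfies the predicate, so the search
  -- does not fall back to its default value 0.
  have hspec := Nat.findGreatest_spec (P := fun u => G.E cur u ∧ G.Reach j p u hi)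
    (n := G.N - 1) (m := ρ (G.pos cur + 1)) (by have := G.E_lt he; omega) ⟨he, hd⟩
  have e : G.walkStep j p hi (cur, PI) =
      (Nat.findGreatest (fun u => G.E cur u ∧ G.Reach j p u hi) (G.N - 1), Function.update PI
      (G.pos (Nat.findGreatest (fun u => G.E cur u ∧ G.Reach j p u hi) (G.N - 1)))
      (Nat.findGreatest (fun u => G.E cur u ∧ G.Reach j p u hi) (G.N - 1))) := by
    simp only [walkStep, if_pos hlt]
  rw [e]
  set x := Nat.findGreatest (fun u => G.E cur u ∧ G.Reach j p u hi) (G.N - 1)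
  obtain ⟨hx1, hx2⟩ := hspec
  have hxp := G.E_pos hx1
  have hsame : ∀ i ≤ G.pos cur, Function.update PI (G.pos x) x i = PI i := fun i hi => by
    rw [Function.update_of_ne (by omega)]
  refine ⟨⟨⟨?_, ?_, ?_, ?_, ?_⟩, hx2⟩, hxp, hsame⟩
  · have := hp.le; simp only; omega
  · simp only; rw [hsame _ hp.le, hp.left]
  · simp
  · intro i h1 h2
    simp only at h2 ⊢
    rcases Nat.lt_succ_iff_lt_or_eq.1 (hxp ▸ h2) with h3 | rfl
    · rw [hsame _ h3.le, hsame _ h3]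
      exact hp.edge i h1 h3
    · rw [hsame _ le_rfl, hp.right, ← hxp, Function.update_self]
      exact hx1
  · intro i h1 h2
    simp only at h2 ⊢
    rcases Nat.lt_succ_iff_lt_or_eq.1 (hxp ▸ h2) with h3 | rfl
    · rw [hsame _ h3.le]
      exact hp.ok i h1 h3
    · rw [hsame _ le_rfl, hp.right]
      exact ho

/-- Each step either gains a layer or rests at `hi`; what was recorded up to the starting layer is
never overwritten, so the pieces of different cells fit together. -/
theorem InCell.iterate {j p lo hi : ℕ} {s : ℕ × (ℕ → ℕ)} (h : G.InCell j p lo hi s) (i : ℕ) :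
    G.InCell j p lo hi ((G.walkStep j p hi)^[i] s) ∧
      (((G.walkStep j p hi)^[i] s).1 = hi ∨
        G.pos s.1 + i ≤ G.pos ((G.walkStep j p hi)^[i] s).1) ∧
      G.pos s.1 ≤ G.pos ((G.walkStep j p hi)^[i] s).1 ∧
      ∀ i' ≤ G.pos s.1, ((G.walkStep j p hi)^[i] s).2 i' = s.2 i' := by
  induction i with
  | zero => exact ⟨h, Or.inr le_rfl, le_rfl, fun _ _ => rfl⟩
  | succ i ih =>
    rw [Function.iterate_succ_apply']
    obtain ⟨h1, h2, h3, h4⟩ := ih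
    set s' := (G.walkStep j p hi)^[i] s
    rcases h1.lt_or_eq with hlt | heq
    · obtain ⟨h5, h6, h7⟩ := h1.step hlt
      refine ⟨h5, Or.inr ?_, by omega, fun i' hi' => by rw [h7 i' (by omega), h4 i' hi']⟩
      rcases h2 with h2 | h2
      · omega
      · omega
    · have e : G.walkStep j p hi s' = s' := by
        unfold walkStep
        rw [if_neg (by omega)]
      rw [e]
      exact ⟨h1, Or.inl heq, h3, h4⟩

/-- The walk is a path from the source to the sink that stays in the cells. -/
theorem Valid.walk (h : G.Valid p A) : ∀ J ≤ p, (G.walk p A J).1 = A J ∧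
    (∀ j < J, G.IsPath (j + 1) p (A j) (A (j + 1)) (G.walk p A J).2) ∧
    (G.walk p A J).2 (G.pos (A J)) = A J := by
  intro J
  induction J with
  | zero =>
    intro _
    exact ⟨h.zero.symm, fun j hj => by omega, h.zero.symm⟩
  | succ J ih =>
    intro hJ
    obtain ⟨ih1, ih2, ih3⟩ := ih (by omega)
    have hc : G.InCell (J + 1) p (A J) (A (J + 1)) (G.walk p A J) := by
      refine ⟨?_, by rw [ih1]; exact h.reach J hJ⟩
      rw [ih1]
      exact ⟨le_rfl, ih3, ih3, fun i h1 h2 => by omega, fun i h1 h2 => by omega⟩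
    obtain ⟨h1, h2, h3, h4⟩ := hc.iterate (G.R + 1)
    -- Otherwise the walk would have climbed R + 1 layers, beyond the layer R of the sink.
    have hend : ((G.walkStep (J + 1) p (A (J + 1)))^[G.R + 1] (G.walk p A J)).1 = A (J + 1) := by
      rcases h2 with h2 | h2
      · exact h2
      · have h5 := h1.reach.pos_le
        have h6 := h.pos_mono hJ le_rfl
        rw [h.last, G.pos_sink] at h6
        omega
    rw [LGraph.walk]
    rw [ih1] at h4
    have hp := h1.path
    rw [hend] at hp
    refine ⟨hend, fun j hj => ?_, hp.right⟩
    rcases Nat.lt_succ_iff_lt_or_eq.1 hj with hj | rfl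
    · exact (ih2 j hj).congr fun i _ hi =>
        h4 i (hi.trans (h.pos_mono (by omega) (by omega)))
    · exact hp

theorem Valid.sum_cells (h : G.Valid p A) (f : ℕ → ℝ) :
    ∑ j ∈ Finset.range p, ∑ i ∈ Finset.Ico (G.pos (A j)) (G.pos (A (j + 1))), f i =
      ∑ i ∈ Finset.range G.R, f i := by
  have key : ∀ J ≤ p, ∑ j ∈ Finset.range J,
      ∑ i ∈ Finset.Ico (G.pos (A j)) (G.pos (A (j + 1))), f i =
      ∑ i ∈ Finset.Ico (G.pos (A 0)) (G.pos (A J)), f i := by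
    intro J
    induction J with
    | zero => intro _; simp
    | succ J ih =>
      intro hJ
      rw [Finset.sum_range_succ, ih (by omega), Finset.sum_Ico_consecutive _
        (h.pos_mono (by omega) (by omega)) (h.pos_mono (by omega) hJ)]
  rw [key p le_rfl, h.zero, h.last, G.pos_zero, G.pos_sink, Finset.range_eq_Ico]

theorem Valid.walk_edge (h : G.Valid p A) :
    (∀ i < G.R, G.E ((G.walk p A p).2 i) ((G.walk p A p).2 (i + 1))) ∧
      (G.walk p A p).2 0 = 0 ∧ (G.walk p A p).2 G.R = G.sink := by
  obtain ⟨-, h2, h3⟩ := h.walk p le_rfl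
  refine ⟨?_, ?_, ?_⟩
  · have key : ∀ J ≤ p, ∀ i < G.pos (A J),
        G.E ((G.walk p A p).2 i) ((G.walk p A p).2 (i + 1)) := by
      intro J
      induction J with
      | zero => intro _ i hi; rw [h.zero, G.pos_zero] at hi; omega
      | succ J ih =>
        intro hJ i hi
        by_cases h' : i < G.pos (A J)
        · exact ih (by omega) i h'
        · exact (h2 J hJ).edge i (by omega) hi
    intro i hi
    exact key p le_rfl i (by rw [h.last, G.pos_sink]; exact hi)
  · rcases Nat.eq_zero_or_pos p with rfl | hp
    · rfl
    · have := (h2 0 hp).left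
      rwa [h.zero, G.pos_zero] at this
  · rw [h.last, G.pos_sink] at h3
    exact h3

/-- The cost of the walk. -/
theorem Valid.cost_walk_le (h : G.Valid p A) {w : ℕ → ℝ} {δ : ℕ → ℝ}
    (hw : ∀ j < p, ∀ u v, G.pos u = G.pos v → G.V u ≤ G.Q → G.V v ≤ G.Q →
      j * G.M ≤ G.V u * p → j * G.M ≤ G.V v * p → G.V u * p < (j + 1) * G.M →
      G.V v * p < (j + 1) * G.M → w u ≤ w v + δ (G.pos u)) :
    ∑ i ∈ Finset.range G.R, w ((G.walk p A p).2 i) ≤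
      G.potential w p A + ∑ i ∈ Finset.range G.R, δ i := by
  obtain ⟨-, h2, -⟩ := h.walk p le_rfl
  rw [← h.sum_cells, ← h.sum_cells, potential, ← Finset.sum_add_distrib]
  refine Finset.sum_le_sum fun j hj => ?_
  rw [Finset.mem_range] at hj
  -- The walk is compared with an optimal path of the same cell, layer by layer: both nodes lie in
  -- the same layer and in the same range of values.
  obtain ⟨ρ, hρ, hc⟩ := (h.reach j hj).exists_min w
  have hπ := h2 j hj
  rw [← hc, cost, ← Finset.sum_add_distrib]
  refine Finset.sum_le_sum fun i hi => ?_
  rw [Finset.mem_Ico] at hi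
  have e1 := hπ.pos_eq hi.1 hi.2.le
  have e2 := hρ.pos_eq hi.1 hi.2.le
  have hab := h.above j hj.le
  have l1 := hπ.V_mono le_rfl hi.1 hi.2.le
  have l2 := hρ.V_mono le_rfl hi.1 hi.2.le
  rw [hπ.left] at l1
  rw [hρ.left] at l2
  have := hw j hj _ _ (e1.trans e2.symm) (G.E_Q (hπ.edge i hi.1 hi.2)) (G.E_Q (hρ.edge i hi.1 hi.2))
    (hab.trans (Nat.mul_le_mul_right _ l1)) (hab.trans (Nat.mul_le_mul_right _ l2))
    (hπ.ok i hi.1 hi.2) (hρ.ok i hi.1 hi.2)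
  rwa [e1] at this

end LGraph
end PrivIso
end

noncomputable section
namespace PrivIso

/-! ### The graph of discretized functions -/

/-- The data on which the graph of discretized functions depends; `J` is the largest increment of a
function value, in units of the grid, that the Lipschitz constraint admits. -/
structure Inst where
  v : Variant
  m : ℕ
  n : ℕ
  k : ℕ
  J : ℕ

namespace Inst

variable (I : Inst)

/-- The number of grid cells of `[0, 1]`. -/
def Q : ℕ := I.n * I.m

/-- The value of the sink. -/
def M : ℕ := I.Q + 2

/-- The base in which nodes are encoded. -/
def B : ℕ := I.Q + I.m + 3

/-- The number of nodes. -/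
def N : ℕ := I.B * I.B * I.B * I.B

/-- The layer of a node. -/
def pos (u : ℕ) : ℕ := u / I.B / I.B / I.B

/-- The value of a node, in units of the grid. -/
def V (u : ℕ) : ℕ := u / I.B / I.B % I.B

/-- The slope stored in a node, in units of the grid. -/
def slope (u : ℕ) : ℕ := u / I.B % I.B

/-- The number of pieces stored in a node. -/
def cnt (u : ℕ) : ℕ := u % I.B

/-- The node with given digits. -/
def node (p V d q : ℕ) : ℕ := ((p * I.B + V) * I.B + d) * I.B + q

/-- The sink. -/
def sink : ℕ := I.node (I.m + 1) I.M 0 0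

/-- The relation between the nodes of consecutive arguments. -/
def Rel (a b : ℕ) : Prop :=
  match I.v with
  | .piecewiseConstant => I.cnt b ≤ I.k ∧
      ((I.cnt b = I.cnt a ∧ I.V b = I.V a) ∨ I.cnt b = I.cnt a + 1)
  | .piecewiseLinear => I.cnt b ≤ I.k ∧
      ((I.cnt b = I.cnt a ∧ I.V b = I.V a + I.slope a ∧ I.slope b = I.slope a) ∨
        I.cnt b = I.cnt a + 1)
  | .contPiecewiseLinear => I.cnt b ≤ I.k ∧ I.V b = I.V a + I.slope b ∧
      ((I.cnt b = I.cnt a ∧ I.slope b = I.slope a) ∨ I.cnt b = I.cnt a + 1)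
  | .lipschitz => I.V b ≤ I.V a + I.J
  | .convex => I.V b = I.V a + I.slope b ∧ I.slope a ≤ I.slope b
  | .concave => I.V b = I.V a + I.slope b ∧ I.slope b ≤ I.slope a

/-- The edges. -/
def Edge (a b : ℕ) : Prop :=
  I.pos b = I.pos a + 1 ∧ I.V a ≤ I.Q ∧ I.V a ≤ I.V b ∧ (I.pos b = I.m + 1 ∨
    (I.V b ≤ I.Q ∧ ((I.pos a = 0 ∧ I.cnt b = 1) ∨ (1 ≤ I.pos a ∧ I.Rel a b))))

theorem B_pos : 0 < I.B := by unfold B; omega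

variable {I}

theorem node_digits {p V d q : ℕ} (hV : V < I.B) (hd : d < I.B) (hq : q < I.B) :
    I.pos (I.node p V d q) = p ∧ I.V (I.node p V d q) = V ∧ I.slope (I.node p V d q) = d ∧
      I.cnt (I.node p V d q) = q := by
  have hB := I.B_pos
  have e : ∀ x y, y < I.B → (x * I.B + y) / I.B = x := fun x y hy => by
    rw [mul_comm, Nat.mul_add_div hB, Nat.div_eq_of_lt hy, add_zero]
  have e' : ∀ x y, y < I.B → (x * I.B + y) % I.B = y := fun x y hy => by
    rw [mul_comm, Nat.mul_add_mod, Nat.mod_eq_of_lt hy]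
  simp only [pos, Inst.V, slope, cnt, node]
  rw [e _ _ hq, e _ _ hd, e _ _ hV, e' _ _ hV, e' _ _ hd, e' _ _ hq]
  exact ⟨rfl, rfl, rfl, rfl⟩

theorem node_lt {p V d q : ℕ} (hp : p < I.B) (hV : V < I.B) (hd : d < I.B) (hq : q < I.B) :
    I.node p V d q < I.N := by
  have e : ∀ x y z, x < z → y < I.B → x * I.B + y < z * I.B := fun x y z hx hy => by
    calc x * I.B + y < x * I.B + I.B := by omega
      _ = (x + 1) * I.B := by ring
      _ ≤ _ := Nat.mul_le_mul_right _ hx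
  exact e _ _ _ (e _ _ _ (e _ _ _ hp hV) hd) hq

theorem sink_digits : I.pos I.sink = I.m + 1 ∧ I.V I.sink = I.M := by
  obtain ⟨h1, h2, -⟩ := node_digits (I := I) (p := I.m + 1) (V := I.M) (d := 0) (q := 0)
    (by unfold B M; omega) I.B_pos I.B_pos
  exact ⟨h1, h2⟩

variable (I)

/-- The layered graph of discretized functions. -/
def graph : LGraph where
  N := I.N
  Q := I.Q
  M := I.M
  R := I.m + 1
  sink := I.sink
  pos := I.pos
  V := I.V
  -- The bound is needed because the layer is the leading digit, which `Edge` does not confine to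
  -- the range of encoded nodes.
  E a b := I.Edge a b ∧ b < I.N
  pos_mono _ _ h := Nat.div_le_div_right (Nat.div_le_div_right (Nat.div_le_div_right h))
  pos_zero := by simp [pos]
  pos_sink := sink_digits.1
  V_sink := sink_digits.2
  sink_lt := node_lt (by unfold B; omega) (by unfold B M; omega) I.B_pos I.B_pos
  E_pos h := h.1.1
  E_V h := h.1.2.2.1
  E_lt h := h.2
  E_Q h := h.1.2.1

end Inst

/-! ### The program -/

/-- The cell `0` of an array. -/
def reg (a : ℕ) : NExp := .get a (.const 0)

/-- The truth value of `a ≤ b`. -/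
def leE (a b : NExp) : NExp := .sub (.const 1) (.sub a b)

/-- The truth value of `a = b`. -/
def eqE (a b : NExp) : NExp := .mul (leE a b) (leE b a)

/-- A test for the truth of a value. -/
def isTrue (e : NExp) : Test := .natLe (.const 1) e

/-- Truncated subtraction yields comparisons; products and sums of truth values then act as
conjunction and disjunction, with "at least 1" meaning true. -/
theorem leE_iff {a b : NExp} {s : Mem} : 1 ≤ (leE a b).eval s ↔ a.eval s ≤ b.eval s := by
  simp only [leE, NExp.eval]; omega

theorem mul_iff {a b : NExp} {s : Mem} :
    1 ≤ (NExp.mul a b).eval s ↔ 1 ≤ a.eval s ∧ 1 ≤ b.eval s := by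
  simp only [NExp.eval, Nat.one_le_iff_ne_zero, ne_eq, mul_eq_zero, not_or]

theorem add_iff {a b : NExp} {s : Mem} :
    1 ≤ (NExp.add a b).eval s ↔ 1 ≤ a.eval s ∨ 1 ≤ b.eval s := by
  simp only [NExp.eval]; omega

theorem eqE_iff {a b : NExp} {s : Mem} : 1 ≤ (eqE a b).eval s ↔ a.eval s = b.eval s := by
  rw [eqE, mul_iff, leE_iff, leE_iff]; omega

theorem eqE_eval (a b : NExp) (s : Mem) :
    (eqE a b).eval s = if a.eval s = b.eval s then 1 else 0 := by
  simp only [eqE, leE, NExp.eval]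
  split_ifs with h
  · simp [h]
  · rcases Nat.lt_or_gt_of_ne h with h | h
    · simp [show 1 - (b.eval s - a.eval s) = 0 by omega]
    · simp [show 1 - (a.eval s - b.eval s) = 0 by omega]

theorem isTrue_holds {ℓ : ℝ → ℝ → ℝ} {e : NExp} {s : Mem} :
    (isTrue e).Holds ℓ s ↔ 1 ≤ e.eval s := by
  simp [isTrue, Test.Holds, NExp.eval]

/-- A loop bound that evaluates to `e` if the value of `e` is at most `N`. -/
def upto (e : NExp) : NExp := .sub (reg 13) (.sub (reg 13) e)

def mE : NExp := .get 0 (.const 0)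
def nE : NExp := .get 0 (.const 1)
def kE : NExp := .get 0 (.const 2)

/-- The layer, value, slope and count of a node, looked up in the tables of quotients and
remainders. -/
def posE (u : NExp) : NExp := .get 20 (.get 20 (.get 20 u))
def valE (u : NExp) : NExp := .get 21 (.get 20 (.get 20 u))
def slopeE (u : NExp) : NExp := .get 21 (.get 20 u)
def cntE (u : NExp) : NExp := .get 21 u

/-- The truth value of `Inst.Rel`. -/
def relE (v : Variant) (a b : NExp) : NExp :=
  match v with
  | .piecewiseConstant => .mul (leE (cntE b) kE)
      (.add (.mul (eqE (cntE b) (cntE a)) (eqE (valE b) (valE a)))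
        (eqE (cntE b) (.add (cntE a) (.const 1))))
  | .piecewiseLinear => .mul (leE (cntE b) kE)
      (.add (.mul (eqE (cntE b) (cntE a)) (.mul (eqE (valE b) (.add (valE a) (slopeE a)))
        (eqE (slopeE b) (slopeE a)))) (eqE (cntE b) (.add (cntE a) (.const 1))))
  | .contPiecewiseLinear => .mul (leE (cntE b) kE)
      (.mul (eqE (valE b) (.add (valE a) (slopeE b)))
      (.add (.mul (eqE (cntE b) (cntE a)) (eqE (slopeE b) (slopeE a)))
        (eqE (cntE b) (.add (cntE a) (.const 1)))))
  | .lipschitz => leE (valE b) (.add (valE a) (reg 15))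
  | .convex => .mul (eqE (valE b) (.add (valE a) (slopeE b))) (leE (slopeE a) (slopeE b))
  | .concave => .mul (eqE (valE b) (.add (valE a) (slopeE b))) (leE (slopeE b) (slopeE a))

/-- The truth value of `Inst.Edge`. -/
def edgeE (v : Variant) (a b : NExp) : NExp :=
  .mul (eqE (posE b) (.add (posE a) (.const 1))) (.mul (leE (valE a) (reg 10))
    (.mul (leE (valE a) (valE b)) (.add (eqE (posE b) (.add mE (.const 1)))
      (.mul (leE (valE b) (reg 10))
        (.add (.mul (eqE (posE a) (.const 0)) (eqE (cntE b) (.const 1)))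
          (.mul (leE (.const 1) (posE a)) (relE v a b)))))))

/-- Memory contents that describe the graph. -/
structure Static (I : Inst) (s : Mem) : Prop where
  m : s.nat 0 0 = I.m
  n : s.nat 0 1 = I.n
  k : s.nat 0 2 = I.k
  Q : s.nat 10 0 = I.Q
  M : s.nat 11 0 = I.M
  N : s.nat 13 0 = I.N
  sink : s.nat 14 0 = I.sink
  J : s.nat 15 0 = I.J
  div : ∀ u < I.N, s.nat 20 u = u / I.B
  mod : ∀ u < I.N, s.nat 21 u = u % I.B

/-- The arrays that `Static` refers to. -/
def staticArrays : List ℕ := [0, 10, 11, 13, 14, 15, 20, 21]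

theorem Static.of_eq {I : Inst} {s s' : Mem} (h : Static I s)
    (hs : ∀ a ∈ staticArrays, s'.nat a = s.nat a) : Static I s' := by
  simp only [staticArrays, List.mem_cons, List.not_mem_nil, or_false, forall_eq_or_imp,
    forall_eq] at hs
  obtain ⟨h0, h10, h11, h13, h14, h15, h20, h21⟩ := hs
  constructor
  · rw [h0, h.m]
  · rw [h0, h.n]
  · rw [h0, h.k]
  · rw [h10, h.Q]
  · rw [h11, h.M]
  · rw [h13, h.N]
  · rw [h14, h.sink]
  · rw [h15, h.J]
  · rw [h20]; exact h.div
  · rw [h21]; exact h.mod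

theorem Static.frame {I : Inst} {s s' : Mem} {P : Prog} (h : Static I s) (hf : P.Frame s s')
    (hP : ∀ a ∈ staticArrays, P.wN a = false) : Static I s' :=
  h.of_eq fun a ha => hf.nat a (hP a ha)

theorem Static.setNat {I : Inst} {s : Mem} (h : Static I s) {a i x : ℕ} (ha : a ∉ staticArrays) :
    Static I (s.setNat a i x) :=
  h.of_eq fun b hb => by
    rw [setNat_nat, if_neg]
    rintro rfl
    exact ha hb

theorem Static.setReal {I : Inst} {s : Mem} (h : Static I s) {a i : ℕ} {x : ℝ} :
    Static I (s.setReal a i x) := h.of_eq fun _ _ => rfl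

theorem Static.digits {I : Inst} {s : Mem} (h : Static I s) {a : NExp} (ha : a.eval s < I.N) :
    (posE a).eval s = I.pos (a.eval s) ∧ (valE a).eval s = I.V (a.eval s) ∧
      (slopeE a).eval s = I.slope (a.eval s) ∧ (cntE a).eval s = I.cnt (a.eval s) := by
  have h1 : a.eval s / I.B < I.N := (Nat.div_le_self _ _).trans_lt ha
  have h2 : a.eval s / I.B / I.B < I.N := (Nat.div_le_self _ _).trans_lt h1
  simp only [posE, valE, slopeE, cntE, NExp.eval, h.div _ ha, h.div _ h1, h.div _ h2, h.mod _ ha,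
    h.mod _ h1, h.mod _ h2, Inst.pos, Inst.V, Inst.slope, Inst.cnt, and_self]

/-- The machine tests edges by arithmetic on digits, which it looks up in tables because it cannot
divide naturals. -/
theorem Static.edge_iff {I : Inst} {s : Mem} (h : Static I s) {a b : NExp} (ha : a.eval s < I.N)
    (hb : b.eval s < I.N) :
    1 ≤ (edgeE I.v a b).eval s ↔ I.graph.E (a.eval s) (b.eval s) := by
  obtain ⟨a1, a2, a3, a4⟩ := h.digits ha
  obtain ⟨b1, b2, b3, b4⟩ := h.digits hb
  have hrel : 1 ≤ (relE I.v a b).eval s ↔ I.Rel (a.eval s) (b.eval s) := by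
    unfold relE Inst.Rel
    cases I.v <;> simp only [mul_iff, add_iff, leE_iff, eqE_iff] <;>
      simp only [NExp.eval, a2, a3, a4, b2, b3, b4, kE, reg, h.k, h.J]
  simp only [edgeE, mul_iff, add_iff, leE_iff, eqE_iff, hrel]
  simp only [NExp.eval, a1, a2, b1, b2, b4, mE, reg, h.m, h.Q]
  simp only [Inst.graph, Inst.Edge, hb, and_true]

/-- Compute the sizes. -/
def sizesProg : Prog :=
  .seq (.setNat 10 (.const 0) (.mul nE mE)) <|
  .seq (.setNat 11 (.const 0) (.add (reg 10) (.const 2))) <|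
  .seq (.setNat 12 (.const 0) (.add (.add (reg 10) mE) (.const 3))) <|
  .seq (.setNat 14 (.const 0) (.mul (.mul (.add (.mul (.add mE (.const 1)) (reg 12)) (reg 11))
    (reg 12)) (reg 12)))
  (.setNat 13 (.const 0) (.mul (.mul (.mul (reg 12) (reg 12)) (reg 12)) (reg 12)))

/-- Tabulate quotients and remainders modulo the base. -/
def divModProg : Prog :=
  .seq (.setNat 22 (.const 0) (.const 0)) <| .seq (.setNat 23 (.const 0) (.const 0)) <|
  .forTo 30 (upto (reg 13)) <|
    .seq (.setNat 20 (reg 30) (reg 22)) <| .seq (.setNat 21 (reg 30) (reg 23)) <|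
    .ite (.natLe (.add (reg 23) (.const 2)) (reg 12))
      (.setNat 23 (.const 0) (.add (reg 23) (.const 1)))
      (.seq (.setNat 23 (.const 0) (.const 0))
        (.setNat 22 (.const 0) (.add (reg 22) (.const 1))))

/-- Compute the largest increment that the Lipschitz constraint admits. -/
def incrProg : Prog :=
  .seq (.setNat 15 (.const 0) (.const 0)) <|
  .forTo 30 (upto (.add (reg 10) (.const 1))) <|
    .ite (.realLe (.cast (reg 30)) (.mul (.get 0 (.const 2)) (.cast (reg 10))))
      (.setNat 15 (.const 0) (reg 30)) .skip

/-- Tabulate the empirical losses of the nodes. -/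
def lossProg : Prog :=
  .forTo 30 (upto (reg 13)) <|
    .seq (.setReal 7 (.const 0) (.cast (.const 0))) <|
    .seq (.forTo 31 (upto nE) <|
      .ite (isTrue (eqE (.add (.get 1 (reg 31)) (.const 1)) (posE (reg 30))))
        (.setReal 7 (.const 0) (.add (.get 7 (.const 0))
          (.loss (.div (.cast (valE (reg 30))) (.cast (reg 10))) (.get 1 (reg 31))))) .skip) <|
    .setReal 3 (reg 30) (.get 7 (.const 0))

/-- Compute the number of levels. -/
def numLevelsProg : Prog :=
  .seq (.setNat 43 (.const 0) (.const 1)) <| .seq (.setNat 44 (.const 0) (.const 0)) <|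
  .seq (.forTo 30 (upto nE) <|
    .ite (.natLe (.add (reg 43) (.const 1)) nE)
      (.seq (.setNat 43 (.const 0) (.mul (.const 2) (reg 43)))
        (.setNat 44 (.const 0) (.add (reg 44) (.const 1)))) .skip)
  (.setNat 43 (.const 0) (.const 1))

/-- Tabulate the factors of the nodes at a level. -/
def gainProg : Prog :=
  .seq (.setReal 8 (.const 0) (.div (.mul (.get 0 (.const 0)) (.cast (reg 43)))
    (.mul (.mul (.cast (.const 4)) (.get 0 (.const 1)))
      (.cast (.mul (.add (reg 35) (.const 1)) (.add (reg 35) (.const 2))))))) <|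
  .forTo 30 (upto (reg 13)) <|
    .setReal 4 (reg 30) (.exp (.sub (.cast (.const 0)) (.mul (.get 8 (.const 0))
      (.get 3 (reg 30)))))

/-- The address of an entry of an `N × N` table. -/
def addr (a b : NExp) : NExp := .add (.mul a (reg 13)) b

/-- Tabulate `LGraph.K` for the threshold `reg 26 / reg 27` in the `κ`-th array of reals. -/
def tableProg (v : Variant) (κ : ℕ) : Prog :=
  .forTo 32 (upto (reg 13)) <| .forTo 33 (upto (reg 13)) <|
    .seq (.setReal κ (addr (reg 32) (reg 33)) (.cast (eqE (reg 32) (reg 33)))) <|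
    .forTo 34 (upto (reg 33)) <|
      .ite (isTrue (.mul (edgeE v (reg 34) (reg 33))
          (leE (.add (.mul (valE (reg 34)) (reg 27)) (.const 1)) (.mul (reg 26) (reg 11)))))
        (.ite (.realLe (.get κ (addr (reg 32) (reg 33)))
            (.mul (.get κ (addr (reg 32) (reg 34))) (.get 4 (reg 34))))
          (.setReal κ (addr (reg 32) (reg 33))
            (.mul (.get κ (addr (reg 32) (reg 34))) (.get 4 (reg 34)))) .skip) .skip

/-- One step of the reservoir sampling. -/
def candidateProg : Prog :=
  .seq (.ite (.natLe (.mul (.add (.mul (.const 2) (reg 36)) (.const 1)) (reg 11))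
        (.mul (valE (reg 37)) (.mul (.const 2) (reg 43))))
      (.setReal 10 (.const 0) (.mul (.get 5 (addr (.get 40 (reg 36)) (reg 37)))
        (.get 6 (addr (reg 37) (.get 40 (.add (reg 36) (.const 1)))))))
      (.setReal 10 (.const 0) (.cast (.const 0)))) <|
  .seq (.setReal 9 (.const 0) (.add (.get 9 (.const 0)) (.get 10 (.const 0)))) <|
  .seq (.flip 48 (.const 0) (.div (.get 10 (.const 0)) (.get 9 (.const 0)))) <|
  .ite (.natLe (.const 1) (reg 48)) (.setNat 47 (.const 0) (reg 37)) .skip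

/-- Tabulate `LGraph.K` for both thresholds of a cell. -/
def cellTablesProg (v : Variant) : Prog :=
  .seq (.setNat 27 (.const 0) (.mul (.const 2) (reg 43))) <|
  .seq (.setNat 26 (.const 0) (.add (.mul (.const 2) (reg 36)) (.const 1))) <|
  .seq (tableProg v 5) <|
  .seq (.setNat 26 (.const 0) (.add (.mul (.const 2) (reg 36)) (.const 2))) <|
  .seq (tableProg v 6) <|
  .seq (.setNat 47 (.const 0) (.const 0)) (.setReal 9 (.const 0) (.cast (.const 0)))

/-- Sample the node that splits the cell `reg 36`. -/
def cellProg (v : Variant) : Prog :=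
  .seq (cellTablesProg v) <| .seq (.forTo 37 (upto (reg 13)) candidateProg) <|
  .setNat 41 (reg 36) (reg 47)

/-- Interleave the old and the new nodes. -/
def mergeProg : Prog :=
  .seq (.forTo 38 (upto (.add (reg 43) (.const 1))) <|
    .seq (.setNat 42 (.mul (.const 2) (reg 38)) (.get 40 (reg 38)))
      (.setNat 42 (.add (.mul (.const 2) (reg 38)) (.const 1)) (.get 41 (reg 38)))) <|
  .seq (.forTo 38 (upto (.add (.mul (.const 2) (reg 43)) (.const 1))) <|
    .setNat 40 (reg 38) (.get 42 (reg 38)))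
  (.setNat 43 (.const 0) (.mul (.const 2) (reg 43)))

/-- One level. -/
def levelProg (v : Variant) : Prog :=
  .seq gainProg <| .seq (.forTo 36 (upto (reg 43)) (cellProg v)) mergeProg

/-- All levels. -/
def levelsProg (v : Variant) : Prog := .forTo 35 (upto (reg 44)) (levelProg v)

/-- One step of the walk towards the end of the cell `reg 36`. -/
def walkStepProg (v : Variant) : Prog :=
  .ite (.natLe (.add (reg 51) (.const 1)) (.get 40 (.add (reg 36) (.const 1))))
    (.seq (.setNat 52 (.const 0) (.const 0)) <|
      .seq (.forTo 38 (upto (reg 13)) <|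
        .ite (isTrue (edgeE v (reg 51) (reg 38)))
          (.ite (.realLe (.get 5 (addr (reg 38) (.get 40 (.add (reg 36) (.const 1)))))
            (.cast (.const 0))) .skip (.setNat 52 (.const 0) (reg 38))) .skip) <|
      .seq (.setNat 51 (.const 0) (reg 52)) (.setNat 50 (posE (reg 51)) (reg 51))) .skip

/-- The walk through the chosen nodes. -/
def walkProg (v : Variant) : Prog :=
  .seq gainProg <| .forTo 36 (upto (reg 43)) <|
    .seq (.setNat 26 (.const 0) (.add (reg 36) (.const 1))) <|
    .seq (.setNat 27 (.const 0) (reg 43)) <|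
    .seq (tableProg v 5) <| .forTo 37 (upto (.add mE (.const 2))) (walkStepProg v)

/-- Write the output. -/
def outProg : Prog :=
  .forTo 36 (upto mE) <|
    .setReal 2 (reg 36) (.div (.cast (valE (.get 50 (.add (reg 36) (.const 1)))))
      (.cast (reg 10)))

/-- The deterministic preparations. -/
def setupProg : Prog :=
  .seq divModProg <| .seq incrProg <| .seq lossProg <| .seq numLevelsProg
    (.setNat 40 (.const 1) (reg 14))

/-- Everything after the computation of the sizes. -/
def bodyProg (v : Variant) : Prog :=
  .seq setupProg <| .seq (levelsProg v) <| .seq (walkProg v) outProg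

/-- The program. -/
def mainProg (v : Variant) : Prog := .seq sizesProg (bodyProg v)

end PrivIso
end

noncomputable section
namespace PrivIso

variable {ℓ : ℝ → ℝ → ℝ}

/-! ### Correctness of the deterministic parts -/

theorem Prog.ens_seq_of {p q : Prog} {s : Mem} {Q R : Mem → Prop} (hp : p.ens ℓ s R)
    (hq : ∀ s', p.Frame s s' → R s' → q.ens ℓ s' Q) : (Prog.seq p q).ens ℓ s Q := by
  rw [Prog.ens_seq]
  exact fun s' hs' => hq s' (p.ens_frame s s' hs') (hp s' hs')

theorem upto_eval {s : Mem} {e : NExp} {N J : ℕ} (hN : s.nat 13 0 = N) (he : e.eval s = J)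
    (hJ : J ≤ N) : (upto e).eval s = J := by
  simp only [upto, NExp.eval, reg, hN, he]
  omega

@[simp] theorem reg_eval (s : Mem) (a : ℕ) : (reg a).eval s = s.nat a 0 := rfl

theorem Static.frame' {I : Inst} {s s' : Mem} {P : Prog} (h : Static I s) (hf : P.Frame s s')
    (hP : (staticArrays.all fun a => !P.wN a) = true) : Static I s' := by
  refine h.frame hf fun a ha => ?_
  have := List.all_eq_true.1 hP a ha
  simpa using this

theorem Static.setNat' {I : Inst} {s : Mem} (h : Static I s) {a i x : ℕ}
    (ha : (staticArrays.contains a) = false) : Static I (s.setNat a i x) :=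
  h.setNat fun h' => by
    have := List.contains_iff_mem.2 h'
    rw [ha] at this
    exact absurd this (by decide)

theorem sizes_ens {s : Mem} (I : Inst) (hm : s.nat 0 0 = I.m) (hn : s.nat 0 1 = I.n) :
    sizesProg.ens ℓ s (fun s' => s'.nat 10 0 = I.Q ∧ s'.nat 11 0 = I.M ∧ s'.nat 12 0 = I.B ∧
      s'.nat 13 0 = I.N ∧ s'.nat 14 0 = I.sink) := by
  simp [sizesProg, NExp.eval, setNat_nat, mE, nE, hm, hn, Inst.N, Inst.B, Inst.M, Inst.Q,
    Inst.sink, Inst.node]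

theorem divMod_ens {s : Mem} (I : Inst) (hB : s.nat 12 0 = I.B) (hN : s.nat 13 0 = I.N) :
    divModProg.ens ℓ s (fun s' => (∀ u < I.N, s'.nat 20 u = u / I.B) ∧
      ∀ u < I.N, s'.nat 21 u = u % I.B) := by
  have hBp := I.B_pos
  simp only [divModProg, Prog.ens_seq, Prog.ens_setNat]
  refine Prog.ens_forTo (J := I.N) (upto_eval (by simpa [setNat_nat] using hN)
    (by simpa [setNat_nat] using hN) le_rfl)
    (fun j s' => s'.nat 22 0 = j / I.B ∧ s'.nat 23 0 = j % I.B ∧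
      (∀ u < j, s'.nat 20 u = u / I.B) ∧ ∀ u < j, s'.nat 21 u = u % I.B) ?_ ?_
    (fun r _ hr => hr.2.2)
  · simp [setNat_nat, NExp.eval]
  · intro j hj r hf ⟨h1, h2, h3, h4⟩
    have h12 : r.nat 12 0 = I.B := by
      rw [hf.nat 12 rfl]; simpa [setNat_nat] using hB
    have hmod : j % I.B < I.B := Nat.mod_lt _ hBp
    have h3' : ∀ u < j + 1, Function.update (r.nat 20) j (j / I.B) u = u / I.B := by
      intro u hu
      rcases Nat.lt_succ_iff_lt_or_eq.1 hu with hu | rfl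
      · rw [Function.update_of_ne hu.ne, h3 u hu]
      · rw [Function.update_self]
    have h4' : ∀ u < j + 1, Function.update (r.nat 21) j (j % I.B) u = u % I.B := by
      intro u hu
      rcases Nat.lt_succ_iff_lt_or_eq.1 hu with hu | rfl
      · rw [Function.update_of_ne hu.ne, h4 u hu]
      · rw [Function.update_self]
    have hdm := Nat.div_add_mod j I.B
    simp only [Prog.ens_seq, Prog.ens_setNat, Prog.ens_ite]
    simp only [Test.Holds, NExp.eval, setNat_nat, reg_eval]
    simp only [Nat.reduceEqDiff, if_false, if_true, Function.update_self, h1, h2, h12]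
    constructor
    · intro hlt
      have hu : (j + 1) / I.B = j / I.B ∧ (j + 1) % I.B = j % I.B + 1 :=
        (Nat.div_mod_unique hBp).2 ⟨by omega, by omega⟩
      exact ⟨hu.1.symm, hu.2.symm, h3', h4'⟩
    · intro hlt
      have hu : (j + 1) / I.B = j / I.B + 1 ∧ (j + 1) % I.B = 0 :=
        (Nat.div_mod_unique hBp).2 ⟨by rw [mul_add]; omega, hBp⟩
      exact ⟨hu.1.symm, hu.2.symm, h3', h4'⟩

/-- Ensures that `upto` does not truncate the intended loop bounds. -/
theorem Inst.Q_lt_N (I : Inst) : 2 * I.Q + 2 * I.m + 3 ≤ I.N := by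
  have h : I.B * I.B ≤ I.N := by
    unfold Inst.N
    rw [mul_assoc (I.B * I.B)]
    exact Nat.le_mul_of_pos_right _ (Nat.mul_pos I.B_pos I.B_pos)
  have : 3 * I.B ≤ I.B * I.B := Nat.mul_le_mul_right _ (by unfold Inst.B; omega)
  unfold Inst.B at this h
  omega

open Classical in
/-- The largest increment, in units of the grid, that the Lipschitz constraint admits. -/
def maxIncr (Q : ℕ) (Lf : ℝ) : ℕ := Nat.findGreatest (fun i => (i : ℝ) ≤ Lf * Q) Q

theorem incr_ens {s : Mem} (I : Inst) (hN : s.nat 13 0 = I.N) (hQ : s.nat 10 0 = I.Q) :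
    incrProg.ens ℓ s (fun s' => s'.nat 15 0 = maxIncr I.Q (s.real 0 2)) := by
  classical
  have hQN := I.Q_lt_N
  simp only [incrProg, Prog.ens_seq, Prog.ens_setNat]
  refine Prog.ens_forTo (J := I.Q + 1) (upto_eval (N := I.N) (by simpa [setNat_nat] using hN)
    (by simpa [setNat_nat, NExp.eval] using hQ) (by omega))
    (fun j s' => s'.nat 15 0 =
      Nat.findGreatest (fun i => (i : ℝ) ≤ s.real 0 2 * I.Q) (j - 1)) ?_ ?_
    (fun r _ hr => ?_)
  · simp [setNat_nat, NExp.eval]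
  · intro j hj r hf h1
    have h10 : r.nat 10 0 = I.Q := by
      rw [hf.nat 10 rfl]; simpa [setNat_nat] using hQ
    have h0 : r.real 0 = s.real 0 := hf.real 0 rfl
    simp only [Prog.ens_setNat, Prog.ens_ite, Prog.ens_skip]
    simp only [Test.Holds, RExp.eval, NExp.eval, setNat_nat, reg_eval, setNat_real]
    simp only [Nat.reduceEqDiff, if_false, if_true, Function.update_self, h1, h10, h0]
    -- After the truncated j - 1, the invariants before and after round 0 both speak of a search up
    -- to 0, whose result is 0 whether or not the test succeeds.
    rcases j with _ | j
    · simp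
    · simp only [Nat.add_sub_cancel]
      rw [Nat.findGreatest_succ]
      constructor
      · intro h; rw [if_pos h]
      · intro h; rw [if_neg h]
  · simpa [maxIncr] using hr

/-- The empirical loss of a node. -/
def Inst.loss (I : Inst) (ℓ : ℝ → ℝ → ℝ) (xs : ℕ → ℕ) (ys : ℕ → ℝ) (u : ℕ) : ℝ :=
  ∑ i ∈ Finset.range I.n, if xs i + 1 = I.pos u then ℓ ((I.V u : ℝ) / I.Q) (ys i) else 0

theorem loss_ens {s : Mem} {I : Inst} (hs : Static I s) (hn : I.n ≤ I.N) :
    lossProg.ens ℓ s (fun s' => ∀ u < I.N, s'.real 3 u = I.loss ℓ (s.nat 1) (s.real 1) u) := by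
  refine Prog.ens_forTo (J := I.N) (upto_eval hs.N hs.N le_rfl)
    (fun j s' => ∀ u < j, s'.real 3 u = I.loss ℓ (s.nat 1) (s.real 1) u) (by simp) ?_
    (fun r _ hr => hr)
  intro j hj r hf hI
  have hr : Static I r := hs.frame' hf rfl
  set r1 := (r.setNat 30 0 j).setReal 7 0 0 with hr1
  have hr1s : Static I r1 := (hr.setNat' rfl).setReal
  have key : (Prog.forTo 31 (upto nE) <|
      .ite (isTrue (eqE (.add (.get 1 (reg 31)) (.const 1)) (posE (reg 30))))
        (.setReal 7 (.const 0) (.add (.get 7 (.const 0))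
          (.loss (.div (.cast (valE (reg 30))) (.cast (reg 10))) (.get 1 (reg 31))))) .skip).ens ℓ
      r1 (fun s' => s'.real 7 0 = I.loss ℓ (s.nat 1) (s.real 1) j) := by
    refine Prog.ens_forTo (J := I.n) (upto_eval hr1s.N hr1s.n hn)
      (fun i s' => s'.real 7 0 = ∑ i ∈ Finset.range i,
        if s.nat 1 i + 1 = I.pos j then ℓ ((I.V j : ℝ) / I.Q) (s.real 1 i) else 0) ?_ ?_
      (fun r' _ hr' => hr')
    · simp [hr1, setReal_real]
    · intro i hi r' hf' hI'
      have h1 : r'.nat 1 = s.nat 1 := by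
        rw [hf'.nat 1 rfl, hr1, setReal_nat, setNat_nat, if_neg (by decide), hf.nat 1 rfl]
      have h2 : r'.real 1 = s.real 1 := by
        rw [hf'.real 1 rfl, hr1, setReal_real, if_neg (by decide), setNat_real, hf.real 1 rfl]
      have hs' : Static I (r'.setNat 31 0 i) := (hr1s.frame' hf' rfl).setNat' rfl
      have h30 : (r'.setNat 31 0 i).nat 30 0 = j := by
        rw [setNat_nat, if_neg (by decide), hf'.nat 30 rfl]
        simp [hr1, setNat_nat]
      have hd := hs'.digits (a := reg 30) (by rw [reg_eval, h30]; exact hj)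
      rw [reg_eval, h30] at hd
      simp only [Prog.ens_ite, Prog.ens_setReal, Prog.ens_skip, isTrue_holds, eqE_iff]
      simp only [RExp.eval, NExp.eval, hd.1, hd.2.1, reg_eval, hs'.Q, setNat_nat, setNat_real,
        setReal_real]
      simp only [Nat.reduceEqDiff, if_false, if_true, Function.update_self, h1, h2, hI',
        Finset.sum_range_succ]
      constructor
      · intro h; rw [if_pos h]
      · intro h; rw [if_neg h, add_zero]
  simp only [Prog.ens_seq, Prog.ens_setReal]
  have e : (r.setNat 30 0 j).setReal 7 (NExp.eval (r.setNat 30 0 j) (.const 0))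
      (RExp.eval ℓ (r.setNat 30 0 j) (.cast (.const 0))) = r1 := by
    simp [hr1, RExp.eval, NExp.eval]
  rw [e]
  refine Prog.ens_mono (Prog.ens_and key (Prog.ens_frame _ _)) ?_
  intro r2 ⟨h7, hf2⟩ u hu
  have h30 : r2.nat 30 0 = j := by
    rw [hf2.nat 30 rfl]; simp [hr1, setNat_nat]
  have h3 : r2.real 3 = r.real 3 := by
    rw [hf2.real 3 rfl]; simp [hr1, setReal_real]
  simp only [reg_eval, RExp.eval, NExp.eval, h30, h7, h3, setReal_real, if_true]
  rcases Nat.lt_succ_iff_lt_or_eq.1 hu with hu | rfl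
  · rw [Function.update_of_ne hu.ne, hI u hu]
  · rw [Function.update_self]

/-- A power of two is doubled while it is below n; n rounds are enough because n < 2^n. The cell is
then reset to 1, the number of cells of level 0. -/
theorem numLevels_ens {s : Mem} {I : Inst} (hs : Static I s) (hn : I.n ≤ I.N) :
    numLevelsProg.ens ℓ s (fun s' => s'.nat 44 0 = Nat.clog 2 I.n ∧ s'.nat 43 0 = 1) := by
  have hs1 : Static I ((s.setNat 43 0 1).setNat 44 0 0) := (hs.setNat' rfl).setNat' rfl
  have key : (Prog.forTo 30 (upto nE) <|
      .ite (.natLe (.add (reg 43) (.const 1)) nE)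
      (.seq (.setNat 43 (.const 0) (.mul (.const 2) (reg 43)))
        (.setNat 44 (.const 0) (.add (reg 44) (.const 1)))) .skip).ens ℓ
      ((s.setNat 43 0 1).setNat 44 0 0) (fun s' => s'.nat 44 0 = Nat.clog 2 I.n) := by
    refine Prog.ens_forTo (J := I.n) (upto_eval hs1.N hs1.n hn)
      (fun i s' => s'.nat 43 0 = 2 ^ (s'.nat 44 0) ∧ s'.nat 44 0 ≤ Nat.clog 2 I.n ∧
        (I.n ≤ s'.nat 43 0 ∨ s'.nat 44 0 = i)) ?_ ?_ ?_
    · simp [setNat_nat]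
    · intro i hi r hf ⟨h1, h2, h3⟩
      have hr : Static I (r.setNat 30 0 i) := (hs1.frame' hf rfl).setNat' rfl
      simp only [Prog.ens_ite, Prog.ens_seq, Prog.ens_setNat, Prog.ens_skip]
      have hnv := hr.n
      simp only [Test.Holds, NExp.eval, nE, hnv, setNat_nat, reg_eval]
      simp only [Nat.reduceEqDiff, if_false, if_true, Function.update_self]
      constructor
      · intro h
        refine ⟨by rw [h1, pow_succ'], ?_, Or.inr ?_⟩
        · simp only [Nat.add_one_le_iff]
          rw [Nat.lt_clog_iff_pow_lt (by decide), ← h1]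
          omega
        · rcases h3 with h3 | h3
          · omega
          · omega
      · intro h
        exact ⟨h1, h2, Or.inl (by omega)⟩
    · intro r _ ⟨h1, h2, h3⟩
      refine le_antisymm h2 ((Nat.clog_le_iff_le_pow (by decide)).2 ?_)
      rw [← h1]
      rcases h3 with h3 | h3
      · exact h3
      · rw [h1, h3]; exact Nat.lt_two_pow_self.le
  simp only [numLevelsProg, Prog.ens_seq, Prog.ens_setNat]
  refine Prog.ens_mono key fun r hr => ?_
  simp [NExp.eval, setNat_nat, hr]

end PrivIso
end

/-! ### Shortest-path tables by dynamic programming, and the sampling loop -/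

noncomputable section
namespace PrivIso

variable {ℓ : ℝ → ℝ → ℝ}

/-- The inverse temperature of a level with `p` cells. -/
def temp (ε L : ℝ) (p t : ℕ) : ℝ := ε * p / (4 * L * ((t + 1) * (t + 2)))

theorem gain_ens {s : Mem} {I : Inst} (hN : s.nat 13 0 = I.N) {w : ℕ → ℝ}
    (hw : ∀ u < I.N, s.real 3 u = w u) :
    gainProg.ens ℓ s (fun s' => ∀ u < I.N, s'.real 4 u =
      Real.exp (-(temp (s.real 0 0) (s.real 0 1) (s.nat 43 0) (s.nat 35 0) * w u))) := by
  simp only [gainProg, Prog.ens_seq, Prog.ens_setReal]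
  refine Prog.ens_forTo (J := I.N) (upto_eval hN hN le_rfl)
    (fun j s' => ∀ u < j, s'.real 4 u =
      Real.exp (-(temp (s.real 0 0) (s.real 0 1) (s.nat 43 0) (s.nat 35 0) * w u))) (by simp) ?_
    (fun r _ hr => hr)
  intro j hj r hf hI
  have h3 : r.real 3 = s.real 3 := by rw [hf.real 3 rfl]; simp [setReal_real]
  have h8 : r.real 8 0 = temp (s.real 0 0) (s.real 0 1) (s.nat 43 0) (s.nat 35 0) := by
    rw [hf.real 8 rfl]
    simp [setReal_real, RExp.eval, NExp.eval, temp]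
  rw [Prog.ens_setReal]
  intro u hu
  simp only [reg_eval, RExp.eval, NExp.eval, setReal_real, setNat_nat, if_true,
    Function.update_self, setNat_real, h3, h8]
  rcases Nat.lt_succ_iff_lt_or_eq.1 hu with hu | rfl
  · rw [Function.update_of_ne hu.ne, hI u hu]
  · rw [Function.update_self, hw u hj]; simp

theorem addr_lt {N a a' v v' : ℕ} (hv' : v' < N) (h : a' < a ∨ (a' = a ∧ v' < v)) :
    a' * N + v' < a * N + v := by
  rcases h with h | ⟨rfl, h⟩
  · have := Nat.mul_le_mul_right N (Nat.succ_le_of_lt h)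
    rw [Nat.succ_mul] at this
    omega
  · omega

/-- A running maximum evaluates the recursion `LGraph.isGreatest_K`. Edges lead to larger node
numbers, so in row-major order the entries that the recursion refers to are already final. The array
κ must not be the one that holds the factors. -/
theorem table_ens {s : Mem} {I : Inst} (hs : Static I s) {β : ℝ} (hβ : 0 ≤ β) {w : ℕ → ℝ}
    (hg : ∀ u < I.N, s.real 4 u = Real.exp (-(β * w u))) {κ : ℕ} (hκ : κ ≠ 4) {j p : ℕ}
    (hj : s.nat 26 0 = j) (hp : s.nat 27 0 = p) :
    (tableProg I.v κ).ens ℓ s (fun s' => ∀ a < I.N, ∀ v < I.N,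
      s'.real κ (a * I.N + v) = I.graph.K β w j p a v) := by
  set P : ℕ → ℕ → Mem → Prop := fun a v s' => ∀ a' v', v' < I.N → (a' < a ∨ (a' = a ∧ v' < v)) →
    s'.real κ (a' * I.N + v') = I.graph.K β w j p a' v' with hP
  refine Prog.ens_forTo (J := I.N) (upto_eval hs.N hs.N le_rfl) (fun a s' => P a 0 s')
    (fun a' v' _ h => by omega) ?_ (fun r _ hr a ha v hv => hr a v hv (Or.inl ha))
  intro a ha r hf hI
  have hr : Static I (r.setNat 32 0 a) := (hs.frame' hf rfl).setNat' rfl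
  refine Prog.ens_forTo (J := I.N) (upto_eval hr.N hr.N le_rfl) (fun v s' => P a v s') hI ?_
    (fun r _ hr a' v' hv' h => hr a' v' hv' (by omega))
  intro v hv r1 hf1 hI1
  have hr1 : Static I r1 := hr.frame' hf1 rfl
  have h32 : r1.nat 32 0 = a := by rw [hf1.nat 32 rfl]; simp [setNat_nat]
  rw [Prog.ens_seq, Prog.ens_setReal]
  set r2 := (r1.setNat 33 0 v).setReal κ ((addr (reg 32) (reg 33)).eval (r1.setNat 33 0 v))
    ((RExp.cast (eqE (reg 32) (reg 33))).eval ℓ (r1.setNat 33 0 v)) with hr2d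
  have hr2 : Static I r2 := (hr1.setNat' rfl).setReal
  have h33 : r2.nat 33 0 = v := by simp [hr2d, setNat_nat]
  have h32' : r2.nat 32 0 = a := by simp [hr2d, setNat_nat, h32]
  have hκ2 : r2.real κ = Function.update (r1.real κ) (a * I.N + v) (if a = v then 1 else 0) := by
    have h13 := hr1.N
    simp only [hr2d, setReal_real, if_true, addr, NExp.eval, reg_eval, setNat_nat,
      setNat_real, RExp.eval, eqE_eval]
    simp [h32, h13]
  have hP2 : P a v r2 := by
    intro a' v' hv' h
    rw [hκ2, Function.update_of_ne (addr_lt hv' h).ne, hI1 a' v' hv' h]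
  -- The current entry is the greatest candidate among the predecessors below u; at u = v this is
  -- the full recursion, and uniqueness of greatest elements identifies the entry.
  refine Prog.ens_forTo (J := v) (upto_eval hr2.N h33 hv.le) (fun u s' => P a v s' ∧
    IsGreatest {x | x = (if a = v then 1 else 0) ∨ ∃ u' < u, (I.graph.E u' v ∧
      I.graph.V u' * p < j * I.graph.M) ∧
      x = I.graph.K β w j p a u' * Real.exp (-(β * w u'))} (s'.real κ (a * I.N + v))) ?_ ?_ ?_
  · refine ⟨hP2, ?_⟩
    rw [hκ2, Function.update_self]
    exact ⟨Or.inl rfl, by rintro x (rfl | ⟨u', hu', -⟩) <;> [exact le_rfl; omega]⟩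
  · intro u hu r3 hf3 ⟨hP3, hG3⟩
    have hr3 : Static I (r3.setNat 34 0 u) := (hr2.frame' hf3 rfl).setNat' rfl
    have e32 : r3.nat 32 0 = a := by rw [hf3.nat 32 rfl, h32']
    have e33 : r3.nat 33 0 = v := by rw [hf3.nat 33 rfl, h33]
    have e34 : (r3.setNat 34 0 u).nat 34 0 = u := by simp [setNat_nat]
    have e26 : r3.nat 26 0 = j := by
      rw [hf3.nat 26 rfl, hr2d, setReal_nat, setNat_nat, if_neg (by decide), hf1.nat 26 rfl,
        setNat_nat, if_neg (by decide), hf.nat 26 rfl, hj]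
    have e27 : r3.nat 27 0 = p := by
      rw [hf3.nat 27 rfl, hr2d, setReal_nat, setNat_nat, if_neg (by decide), hf1.nat 27 rfl,
        setNat_nat, if_neg (by decide), hf.nat 27 rfl, hp]
    have e4 : r3.real 4 u = Real.exp (-(β * w u)) := by
      have hk : (κ == 4) = false := by simpa using hκ
      rw [hf3.real 4 (by simp [Prog.wR, hk]), hr2d, setReal_real, if_neg (Ne.symm hκ), setNat_real,
        hf1.real 4 (by simp [Prog.wR, hk]), setNat_real, hf.real 4 (by simp [Prog.wR, hk]),
        hg u (by omega)]
    have e13 : r3.nat 13 0 = I.N := by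
      have := hr3.N
      simpa [setNat_nat] using this
    have hau : r3.real κ (a * I.N + u) = I.graph.K β w j p a u :=
      hP3 a u (by omega) (Or.inr ⟨rfl, hu⟩)
    have hd := hr3.digits (a := reg 34) (by rw [reg_eval, e34]; omega)
    rw [reg_eval, e34] at hd
    have hcond : 1 ≤ (NExp.mul (edgeE I.v (reg 34) (reg 33))
          (leE (.add (.mul (valE (reg 34)) (reg 27)) (.const 1))
            (.mul (reg 26) (reg 11)))).eval (r3.setNat 34 0 u) ↔
        I.graph.E u v ∧ I.graph.V u * p < j * I.graph.M := by
      rw [mul_iff, hr3.edge_iff (by rw [reg_eval, e34]; omega)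
        (by simp [setNat_nat, e33]; exact hv), leE_iff]
      have hM := hr3.M
      simp only [NExp.eval, hd.2.1, reg_eval, hM]
      simp only [setNat_nat, Nat.reduceEqDiff, if_false, if_true, Function.update_self, e33, e26,
        e27]
      rfl
    have hold : ∀ y, P a v ((r3.setNat 34 0 u).setReal κ (a * I.N + v) y) := by
      intro y a' v' hv' h
      rw [setReal_real, if_pos rfl, Function.update_of_ne (addr_lt hv' h).ne]
      exact hP3 a' v' hv' h
    simp only [Prog.ens_ite, Prog.ens_setReal, Prog.ens_skip, isTrue_holds, hcond]
    simp only [Test.Holds, RExp.eval, NExp.eval, addr, reg_eval, setNat_real, setNat_nat]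
    simp only [Nat.reduceEqDiff, if_false, if_true, Function.update_self, e32, e33, e13, e4, hau]
    refine ⟨fun hc => ⟨fun hle => ⟨hold _, ?_⟩, fun hle => ⟨hP3, ?_⟩⟩, fun hc => ⟨hP3, ?_⟩⟩
    · rw [setReal_real, if_pos rfl, Function.update_self]
      refine ⟨Or.inr ⟨u, by omega, hc, rfl⟩, ?_⟩
      rintro x (hx | ⟨u', hu', hc', rfl⟩)
      · exact (hG3.2 (Or.inl hx)).trans hle
      · rcases Nat.lt_succ_iff_lt_or_eq.1 hu' with hu' | rfl
        · exact (hG3.2 (Or.inr ⟨u', hu', hc', rfl⟩)).trans hle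
        · exact le_rfl
    · refine ⟨?_, ?_⟩
      · rcases hG3.1 with h | ⟨u', hu', h⟩
        · exact Or.inl h
        · exact Or.inr ⟨u', by omega, h⟩
      · rintro x (hx | ⟨u', hu', hc', rfl⟩)
        · exact hG3.2 (Or.inl hx)
        · rcases Nat.lt_succ_iff_lt_or_eq.1 hu' with hu' | rfl
          · exact hG3.2 (Or.inr ⟨u', hu', hc', rfl⟩)
          · exact (not_le.1 hle).le
    · refine ⟨?_, ?_⟩
      · rcases hG3.1 with h | ⟨u', hu', h⟩
        · exact Or.inl h
        · exact Or.inr ⟨u', by omega, h⟩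
      · rintro x (hx | ⟨u', hu', hc', rfl⟩)
        · exact hG3.2 (Or.inl hx)
        · rcases Nat.lt_succ_iff_lt_or_eq.1 hu' with hu' | rfl
          · exact hG3.2 (Or.inr ⟨u', hu', hc', rfl⟩)
          · exact absurd hc' hc
  · intro r3 _ ⟨hP3, hG3⟩ a' v' hv' h
    by_cases heq : a' = a ∧ v' = v
    · obtain ⟨rfl, rfl⟩ := heq
      exact hG3.unique (LGraph.isGreatest_K hβ w j p a' v')
    · exact hP3 a' v' hv' (by omega)

/-! ### Correctness of the sampling -/

theorem coin_map_pure {α : Type*} (p : ℝ) (f : Bool → α) :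
    (coin p).bind (fun b => PMF.pure (f b)) = (coin p).map f := rfl

/-- The partial sum is updated before the coin is flipped, so the bias is exactly that of
`reservoir`; only the selected node is part of the abstract state. -/
theorem candidate_sim {s : Mem} {I : Inst} (hs : Static I s) {W : ℕ → ℝ} {β : ℝ} {w : ℕ → ℝ}
    {p j : ℕ} {A : ℕ → ℕ} (hW : W = I.graph.cellWt β w p A j)
    (hp : s.nat 43 0 = p) (hj : s.nat 36 0 = j) (hA : s.nat 40 = A) (hA1 : A j < I.N)
    (hA2 : A (j + 1) < I.N)
    (h5 : ∀ a < I.N, ∀ v < I.N,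
      s.real 5 (a * I.N + v) = I.graph.K β w (2 * j + 1) (2 * p) a v)
    (h6 : ∀ a < I.N, ∀ v < I.N,
      s.real 6 (a * I.N + v) = I.graph.K β w (2 * j + 2) (2 * p) a v)
    {u : ℕ} (hu : s.nat 37 0 = u) (huN : u < I.N) (hsel : s.nat 47 0 < I.N)
    (h9 : s.real 9 0 = ∑ i ∈ Finset.range u, W i) :
    candidateProg.sim ℓ s (fun s' => s'.nat 47 0 < I.N ∧
        s'.real 9 0 = ∑ i ∈ Finset.range (u + 1), W i) (fun s' => s'.nat 47 0)
      ((coin (W u / ∑ i ∈ Finset.range (u + 1), W i)).map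
        fun b => if b then u else s.nat 47 0) := by
  have hd := hs.digits (a := reg 37) (by rw [reg_eval, hu]; exact huN)
  rw [reg_eval, hu] at hd
  have hfirst : (Prog.ite (.natLe (.mul (.add (.mul (.const 2) (reg 36)) (.const 1)) (reg 11))
        (.mul (valE (reg 37)) (.mul (.const 2) (reg 43))))
      (.setReal 10 (.const 0) (.mul (.get 5 (addr (.get 40 (reg 36)) (reg 37)))
        (.get 6 (addr (reg 37) (.get 40 (.add (reg 36) (.const 1)))))))
      (.setReal 10 (.const 0) (.cast (.const 0)))).dist ℓ s =
      PMF.pure (s.setReal 10 0 (W u)) := by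
    rw [Prog.dist_ite]
    simp only [Prog.dist_setReal, Test.Holds, NExp.eval, RExp.eval, addr, reg_eval, hp, hj, hA,
      hd.2.1, hs.M, hs.N, hu]
    rw [h5 _ hA1 _ huN, h6 _ huN _ hA2, hW, LGraph.cellWt, LGraph.wt]
    have e : I.graph.M = I.M := rfl
    have e' : I.graph.V u = I.V u := rfl
    rw [e, e']
    split_ifs <;> simp
  set s1 := (s.setReal 10 0 (W u)).setReal 9 0 (∑ i ∈ Finset.range (u + 1), W i) with hs1
  have hdist : candidateProg.dist ℓ s = (coin (W u / ∑ i ∈ Finset.range (u + 1), W i)).map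
      fun b => if b then (s1.setNat 48 0 1).setNat 47 0 u else s1.setNat 48 0 0 := by
    rw [candidateProg, Prog.dist_seq, hfirst, PMF.pure_bind, Prog.dist_seq, Prog.dist_setReal,
      PMF.pure_bind]
    have e : (s.setReal 10 0 (W u)).setReal 9 (NExp.eval (s.setReal 10 0 (W u)) (.const 0))
        (RExp.eval ℓ (s.setReal 10 0 (W u))
          (.add (.get 9 (.const 0)) (.get 10 (.const 0)))) = s1 := by
      rw [hs1]
      simp [RExp.eval, NExp.eval, setReal_real, h9, Finset.sum_range_succ]
    rw [e, Prog.dist_seq, Prog.dist_flip, PMF.bind_map, ← coin_map_pure]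
    have ep : RExp.eval ℓ s1 (.div (.get 10 (.const 0)) (.get 9 (.const 0))) =
        W u / ∑ i ∈ Finset.range (u + 1), W i := by
      simp [hs1, RExp.eval, NExp.eval, setReal_real]
    rw [ep]
    congr 1
    funext b
    have e37 : s1.nat 37 0 = u := by simp [hs1, hu]
    simp only [Function.comp, Prog.dist_ite, Prog.dist_setNat, Prog.dist_skip, Test.Holds,
      NExp.eval, reg_eval, setNat_nat]
    cases b <;> simp [e37]
  constructor
  · intro s' hs'
    rw [hdist, PMF.support_map] at hs'
    obtain ⟨b, -, rfl⟩ := hs'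
    cases b <;> simp [setNat_nat, hs1, setReal_real, huN, hsel]
  · rw [hdist, PMF.map_comp]
    congr 1
    funext b
    cases b <;> simp [setNat_nat, hs1]

theorem cellTables_ens {s : Mem} {I : Inst} (hs : Static I s) {β : ℝ} (hβ : 0 ≤ β) {w : ℕ → ℝ}
    (hg : ∀ u < I.N, s.real 4 u = Real.exp (-(β * w u))) {p j : ℕ}
    (hp : s.nat 43 0 = p) (hj : s.nat 36 0 = j) :
    (cellTablesProg I.v).ens ℓ s (fun s' =>
      (∀ a < I.N, ∀ v < I.N,
        s'.real 5 (a * I.N + v) = I.graph.K β w (2 * j + 1) (2 * p) a v) ∧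
      (∀ a < I.N, ∀ v < I.N,
        s'.real 6 (a * I.N + v) = I.graph.K β w (2 * j + 2) (2 * p) a v) ∧
      s'.nat 47 0 = 0 ∧ s'.real 9 0 = 0) := by
  rw [cellTablesProg, Prog.ens_seq, Prog.ens_setNat, Prog.ens_seq, Prog.ens_setNat]
  set s1 := (s.setNat 27 (NExp.eval s (.const 0)) (NExp.eval s (.mul (.const 2) (reg 43)))).setNat
    26 (NExp.eval _ (.const 0))
    (NExp.eval (s.setNat 27 (NExp.eval s (.const 0)) (NExp.eval s (.mul (.const 2) (reg 43))))
      (.add (.mul (.const 2) (reg 36)) (.const 1))) with hs1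
  have hs1s : Static I s1 := (hs.setNat' rfl).setNat' rfl
  have h26 : s1.nat 26 0 = 2 * j + 1 := by simp [hs1, setNat_nat, NExp.eval, hj]
  have h27 : s1.nat 27 0 = 2 * p := by simp [hs1, setNat_nat, NExp.eval, hp]
  have h36 : s1.nat 36 0 = j := by simp [hs1, setNat_nat, hj]
  refine Prog.ens_seq_of (table_ens hs1s hβ (w := w) hg (by decide) h26 h27) ?_
  intro s2 hf2 h5
  rw [Prog.ens_seq, Prog.ens_setNat]
  set s3 := s2.setNat 26 (NExp.eval s2 (.const 0))
    (NExp.eval s2 (.add (.mul (.const 2) (reg 36)) (.const 2))) with hs3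
  have hs3s : Static I s3 := (hs1s.frame' hf2 rfl).setNat' rfl
  have h26' : s3.nat 26 0 = 2 * j + 2 := by
    simp [hs3, setNat_nat, NExp.eval, hf2.nat 36 rfl, h36]
  have h27' : s3.nat 27 0 = 2 * p := by simp [hs3, setNat_nat, hf2.nat 27 rfl, h27]
  have hg3 : ∀ u < I.N, s3.real 4 u = Real.exp (-(β * w u)) := by
    intro u hu
    rw [hs3, setNat_real, hf2.real 4 rfl]
    exact hg u hu
  refine Prog.ens_seq_of (table_ens hs3s hβ hg3 (by decide) h26' h27') ?_
  intro s4 hf4 h6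
  have h5' : s4.real 5 = s2.real 5 := by rw [hf4.real 5 rfl, hs3, setNat_real]
  simp only [Prog.ens_seq, Prog.ens_setNat, Prog.ens_setReal]
  simp only [setReal_real, setNat_real, setReal_nat, setNat_nat, NExp.eval, RExp.eval]
  simp only [Nat.reduceEqDiff, if_false, if_true, Function.update_self, h5']
  exact ⟨h5, h6, trivial, by simp⟩

theorem cell_sim {s : Mem} {I : Inst} (hs : Static I s) {β : ℝ} (hβ : 0 ≤ β) {w : ℕ → ℝ}
    (hg : ∀ u < I.N, s.real 4 u = Real.exp (-(β * w u))) {p j : ℕ} {A : ℕ → ℕ}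
    (hp : s.nat 43 0 = p) (hj : s.nat 36 0 = j) (hA : s.nat 40 = A) (hA1 : A j < I.N)
    (hA2 : A (j + 1) < I.N) :
    (cellProg I.v).sim ℓ s (fun s' => (cellProg I.v).Frame s s' ∧ s'.nat 41 j < I.N ∧
        ∀ i, i ≠ j → s'.nat 41 i = s.nat 41 i) (fun s' => s'.nat 41)
      (I.graph.cellStep β w p A j (s.nat 41)) := by
  have h1 : (cellTablesProg I.v).sim ℓ s (fun s1 => (cellTablesProg I.v).Frame s s1 ∧
      (∀ a < I.N, ∀ v < I.N,
        s1.real 5 (a * I.N + v) = I.graph.K β w (2 * j + 1) (2 * p) a v) ∧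
      (∀ a < I.N, ∀ v < I.N,
        s1.real 6 (a * I.N + v) = I.graph.K β w (2 * j + 2) (2 * p) a v) ∧
      s1.nat 47 0 = 0 ∧ s1.real 9 0 = 0) (fun _ => ()) (PMF.pure ()) :=
    Prog.sim_of_ens (Prog.ens_mono (Prog.ens_and (Prog.ens_frame _ _)
      (cellTables_ens hs hβ hg hp hj)) fun s' h => ⟨h, rfl⟩)
  have h2 : ∀ s1, (cellTablesProg I.v).Frame s s1 ∧
      (∀ a < I.N, ∀ v < I.N,
        s1.real 5 (a * I.N + v) = I.graph.K β w (2 * j + 1) (2 * p) a v) ∧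
      (∀ a < I.N, ∀ v < I.N,
        s1.real 6 (a * I.N + v) = I.graph.K β w (2 * j + 2) (2 * p) a v) ∧
      s1.nat 47 0 = 0 ∧ s1.real 9 0 = 0 →
      (Prog.seq (.forTo 37 (upto (reg 13)) candidateProg) (.setNat 41 (reg 36) (reg 47))).sim ℓ s1
        (fun s' => s'.nat 41 j < I.N ∧ ∀ i, i ≠ j → s'.nat 41 i = s.nat 41 i) (fun s' => s'.nat 41)
        (I.graph.cellStep β w p A j (s.nat 41)) := by
    rintro s1 ⟨hf1, h5, h6, h47, h9⟩
    have hs1 : Static I s1 := hs.frame' hf1 rfl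
    have h43 : s1.nat 43 0 = p := by rw [hf1.nat 43 rfl, hp]
    have h36 : s1.nat 36 0 = j := by rw [hf1.nat 36 rfl, hj]
    have h40 : s1.nat 40 = A := by rw [hf1.nat 40 rfl, hA]
    have h41 : s1.nat 41 = s.nat 41 := hf1.nat 41 rfl
    have hloop : (Prog.forTo 37 (upto (reg 13)) candidateProg).sim ℓ s1
        (fun s2 => (Prog.forTo 37 (upto (reg 13)) candidateProg).Frame s1 s2 ∧ s2.nat 47 0 < I.N)
        (fun s2 => s2.nat 47 0) (reservoir (I.graph.cellWt β w p A j) I.N) := by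
      have := Prog.sim_forTo (ℓ := ℓ) (a := 37) (e := upto (reg 13)) (p := candidateProg) (s := s1) (J := I.N)
        (Q := fun s2 => (Prog.forTo 37 (upto (reg 13)) candidateProg).Frame s1 s2 ∧
          s2.nat 47 0 < I.N)
        (upto_eval hs1.N hs1.N le_rfl) (fun s2 => s2.nat 47 0)
        (fun u sel => (coin (I.graph.cellWt β w p A j u /
          ∑ i ∈ Finset.range (u + 1), I.graph.cellWt β w p A j i)).map
            fun b => if b then u else sel)
        (fun u s2 => s2.nat 47 0 < I.N ∧
          s2.real 9 0 = ∑ i ∈ Finset.range u, I.graph.cellWt β w p A j i)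
        ⟨by rw [h47]; exact (Nat.zero_le _).trans_lt hA1, by simpa using h9⟩ ?_ ?_
      · rw [h47] at this
        exact this
      · intro u hu r hf ⟨hr1, hr2⟩
        have hrs : Static I (r.setNat 37 0 u) := (hs1.frame' hf rfl).setNat' rfl
        have := candidate_sim (ℓ := ℓ) (u := u) hrs (β := β) (w := w) (p := p) (j := j) (A := A)
          rfl (by rw [setNat_nat, if_neg (by decide), hf.nat 43 rfl, h43])
          (by rw [setNat_nat, if_neg (by decide), hf.nat 36 rfl, h36])
          (by rw [setNat_nat, if_neg (by decide), hf.nat 40 rfl, h40]) hA1 hA2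
          (by rw [setNat_real, hf.real 5 rfl]; exact h5)
          (by rw [setNat_real, hf.real 6 rfl]; exact h6) (by simp [setNat_nat]) hu
          (by rw [setNat_nat, if_neg (by decide)]; exact hr1)
          (by rw [setNat_real]; exact hr2)
        rwa [setNat_nat, if_neg (by decide)] at this
      · exact fun r hf hr => ⟨hf, hr.1⟩
    refine Prog.sim_seq hloop (g := fun u => PMF.pure (Function.update (s.nat 41) j u)) ?_
    intro s2 ⟨hf2, hlt⟩
    have e36 : s2.nat 36 0 = j := by rw [hf2.nat 36 rfl, h36]
    have e41 : s2.nat 41 = s.nat 41 := by rw [hf2.nat 41 rfl, h41]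
    refine Prog.sim_of_ens ?_
    rw [Prog.ens_setNat]
    simp only [setNat_nat, if_true, reg_eval, e36, e41, Function.update_self, and_true]
    exact ⟨hlt, fun i hi => Function.update_of_ne hi _ _⟩
  have := Prog.sim_seq (g := fun _ => I.graph.cellStep β w p A j (s.nat 41)) h1 h2
  rw [PMF.pure_bind] at this
  exact ⟨Prog.ens_and (Prog.ens_frame _ _) this.1, this.2⟩

/-- The interleaving goes through a scratch array, since writing in place would destroy entries
still to be read. Entries beyond 2p keep their old contents, as in `LGraph.merge`, so that whole
arrays can be equated. -/
theorem merge_ens {s : Mem} {N p : ℕ} (hN : s.nat 13 0 = N) (hp : s.nat 43 0 = p)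
    (hpN : 2 * p + 1 ≤ N) :
    mergeProg.ens ℓ s (fun s' => s'.nat 40 = LGraph.merge p (s.nat 40) (s.nat 41) ∧
      s'.nat 41 = s.nat 41 ∧ s'.nat 43 0 = 2 * p) := by
  have h1 : (Prog.forTo 38 (upto (.add (reg 43) (.const 1))) <|
    .seq (.setNat 42 (.mul (.const 2) (reg 38)) (.get 40 (reg 38)))
      (.setNat 42 (.add (.mul (.const 2) (reg 38)) (.const 1)) (.get 41 (reg 38)))).ens ℓ s
      (fun s1 => ∀ i ≤ p, s1.nat 42 (2 * i) = s.nat 40 i ∧ s1.nat 42 (2 * i + 1) = s.nat 41 i) := by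
    refine Prog.ens_forTo (J := p + 1) (upto_eval hN (by simp [NExp.eval, hp]) (by omega))
      (fun j s1 => ∀ i < j, s1.nat 42 (2 * i) = s.nat 40 i ∧ s1.nat 42 (2 * i + 1) = s.nat 41 i)
      (by simp) ?_ (fun r _ hr i hi => hr i (by omega))
    intro j hj r hf hI
    have e40 : r.nat 40 = s.nat 40 := hf.nat 40 rfl
    have e41 : r.nat 41 = s.nat 41 := hf.nat 41 rfl
    simp only [Prog.ens_seq, Prog.ens_setNat, NExp.eval, reg_eval, setNat_nat]
    simp only [Nat.reduceEqDiff, if_false, if_true, Function.update_self, e40, e41]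
    intro i hi
    rcases Nat.lt_succ_iff_lt_or_eq.1 hi with hi | rfl
    · rw [Function.update_of_ne (by omega), Function.update_of_ne (by omega),
        Function.update_of_ne (by omega), Function.update_of_ne (by omega)]
      exact hI i hi
    · rw [Function.update_of_ne (by omega), Function.update_self, Function.update_self]
      exact ⟨rfl, rfl⟩
  rw [mergeProg]
  refine Prog.ens_seq_of h1 fun s1 hf1 h42 => ?_
  have e40 : s1.nat 40 = s.nat 40 := hf1.nat 40 rfl
  have e41 : s1.nat 41 = s.nat 41 := hf1.nat 41 rfl
  have e43 : s1.nat 43 0 = p := by rw [hf1.nat 43 rfl, hp]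
  have e13 : s1.nat 13 0 = N := by rw [hf1.nat 13 rfl, hN]
  have h2 : (Prog.forTo 38 (upto (.add (.mul (.const 2) (reg 43)) (.const 1))) <|
    .setNat 40 (reg 38) (.get 42 (reg 38))).ens ℓ s1
      (fun s2 => s2.nat 40 = LGraph.merge p (s.nat 40) (s.nat 41)) := by
    refine Prog.ens_forTo (J := 2 * p + 1) (upto_eval e13 (by simp [NExp.eval, e43]) hpN)
      (fun j s2 => s2.nat 40 = fun i => if i < j then
        LGraph.merge p (s.nat 40) (s.nat 41) i else s.nat 40 i) (by simp [e40]) ?_ ?_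
    · intro j hj r hf hI
      have e42 : r.nat 42 = s1.nat 42 := hf.nat 42 rfl
      rw [Prog.ens_setNat]
      simp only [NExp.eval, reg_eval, setNat_nat]
      simp only [Nat.reduceEqDiff, if_false, if_true, Function.update_self, e42, hI]
      funext i
      rw [Function.update_apply]
      by_cases hij : i = j
      · subst hij
        rw [if_pos rfl, if_pos (by omega)]
        rcases Nat.even_or_odd' i with ⟨c, rfl | rfl⟩
        · rw [(h42 c (by omega)).1, LGraph.merge_even (by omega)]
        · rw [(h42 c (by omega)).2, LGraph.merge_odd (by omega)]
      · rw [if_neg hij]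
        by_cases hlt : i < j
        · rw [if_pos hlt, if_pos (by omega)]
        · rw [if_neg hlt, if_neg (by omega)]
    · intro r _ hr
      rw [hr]
      funext i
      split_ifs with h
      · rfl
      · rw [LGraph.merge, if_neg (by omega)]
  refine Prog.ens_seq_of h2 fun s2 hf2 h40 => ?_
  rw [Prog.ens_setNat]
  simp only [NExp.eval, reg_eval, setNat_nat]
  simp only [Nat.reduceEqDiff, if_false, if_true, Function.update_self]
  exact ⟨h40, by rw [hf2.nat 41 rfl, e41], by rw [hf2.nat 43 rfl, e43]⟩

end PrivIso
end

/-! ### Levels, walk and output: the program against the abstract mechanism -/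

noncomputable section
namespace PrivIso

variable {ℓ : ℝ → ℝ → ℝ}

/-- Memory contents that stay fixed after the preparations. -/
structure Prepared (I : Inst) (w : ℕ → ℝ) (ε L : ℝ) (s : Mem) : Prop where
  static : Static I s
  loss : ∀ u < I.N, s.real 3 u = w u
  eps : s.real 0 0 = ε
  lip : s.real 0 1 = L

theorem Prepared.frame {I : Inst} {w : ℕ → ℝ} {ε L : ℝ} {s s' : Mem} {P : Prog}
    (h : Prepared I w ε L s) (hf : P.Frame s s')
    (hP : (staticArrays.all fun a => !P.wN a) = true) (h0 : P.wR 0 = false)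
    (h3 : P.wR 3 = false) : Prepared I w ε L s' where
  static := h.static.frame' hf hP
  loss := by rw [hf.real 3 h3]; exact h.loss
  eps := by rw [hf.real 0 h0]; exact h.eps
  lip := by rw [hf.real 0 h0]; exact h.lip

theorem Prepared.setNat {I : Inst} {w : ℕ → ℝ} {ε L : ℝ} {s : Mem} (h : Prepared I w ε L s)
    {a i x : ℕ} (ha : (staticArrays.contains a) = false) : Prepared I w ε L (s.setNat a i x) where
  static := h.static.setNat' ha
  loss := h.loss
  eps := h.eps
  lip := h.lip

theorem temp_nonneg {ε L : ℝ} (hε : 0 ≤ ε) (hL : 0 ≤ L) (p t : ℕ) : 0 ≤ temp ε L p t := by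
  unfold temp
  positivity

theorem level_sim {s : Mem} {I : Inst} {w : ℕ → ℝ} {ε L : ℝ} (hs : Prepared I w ε L s)
    (hε : 0 ≤ ε) (hL : 0 ≤ L) {t p : ℕ} (ht : s.nat 35 0 = t) (hp : s.nat 43 0 = p)
    (hA : ∀ i ≤ p, s.nat 40 i < I.N) (hpN : 2 * p + 1 ≤ I.N) :
    (levelProg I.v).sim ℓ s (fun s' => s'.nat 43 0 = 2 * p ∧ ∀ i ≤ 2 * p, s'.nat 40 i < I.N)
      (fun s' => (s'.nat 40, s'.nat 41))
      (I.graph.levelStep (temp ε L p t) w p (s.nat 40, s.nat 41)) := by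
  set β := temp ε L p t with hβd
  have hβ : 0 ≤ β := temp_nonneg hε hL p t
  have h1 : gainProg.sim ℓ s (fun s1 => gainProg.Frame s s1 ∧
      ∀ u < I.N, s1.real 4 u = Real.exp (-(β * w u))) (fun _ => ()) (PMF.pure ()) := by
    refine Prog.sim_of_ens (Prog.ens_mono (Prog.ens_and (Prog.ens_frame _ _)
      (gain_ens hs.static.N hs.loss)) fun s' h => ⟨?_, rfl⟩)
    rw [hs.eps, hs.lip, hp, ht] at h
    exact h
  have h2 := Prog.sim_seq (g := fun _ => I.graph.levelStep β w p (s.nat 40, s.nat 41)) h1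
    (q := .seq (.forTo 36 (upto (reg 43)) (cellProg I.v)) mergeProg)
    (Q' := fun s' => s'.nat 43 0 = 2 * p ∧ ∀ i ≤ 2 * p, s'.nat 40 i < I.N)
    (abs' := fun s' => (s'.nat 40, s'.nat 41)) ?_
  · rw [PMF.pure_bind] at h2
    exact h2
  · rintro s1 ⟨hf1, hg⟩
    have hs1 : Static I s1 := hs.static.frame' hf1 rfl
    have e43 : s1.nat 43 0 = p := by rw [hf1.nat 43 rfl, hp]
    have e40 : s1.nat 40 = s.nat 40 := hf1.nat 40 rfl
    have e41 : s1.nat 41 = s.nat 41 := hf1.nat 41 rfl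
    have hloop := Prog.sim_forTo (ℓ := ℓ) (a := 36) (e := upto (reg 43)) (p := cellProg I.v)
      (s := s1) (J := p)
      (Q := fun s2 => (Prog.forTo 36 (upto (reg 43)) (cellProg I.v)).Frame s1 s2 ∧
        ∀ i < p, s2.nat 41 i < I.N)
      (upto_eval hs1.N e43 (by omega)) (fun s2 => s2.nat 41)
      (I.graph.cellStep β w p (s.nat 40)) (fun j s2 => ∀ i < j, s2.nat 41 i < I.N)
      (by simp) ?_ (fun r hf hr => ⟨hf, hr⟩)
    · rw [e41] at hloop
      refine Prog.sim_seq hloop (g := fun B => PMF.pure (LGraph.merge p (s.nat 40) B, B)) ?_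
      rintro s2 ⟨hf2, hB⟩
      have e13 : s2.nat 13 0 = I.N := (hs1.frame' hf2 rfl).N
      have e40' : s2.nat 40 = s.nat 40 := by rw [hf2.nat 40 rfl, e40]
      refine Prog.sim_of_ens (Prog.ens_mono (merge_ens e13 (by rw [hf2.nat 43 rfl, e43]) hpN)
        fun s3 ⟨h40, h41, h43⟩ => ⟨⟨h43, fun i hi => ?_⟩, ?_⟩)
      · rw [h40, e40']
        rcases Nat.even_or_odd' i with ⟨c, rfl | rfl⟩
        · rw [LGraph.merge_even (by omega)]; exact hA c (by omega)
        · rw [LGraph.merge_odd (by omega)]; exact hB c (by omega)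
      · rw [h40, h41, e40']
    · intro j hj r hf hB
      have hr : Static I (r.setNat 36 0 j) := (hs1.frame' hf rfl).setNat' rfl
      have := cell_sim (ℓ := ℓ) (p := p) (j := j) (A := s.nat 40) hr hβ (w := w)
        (by rw [setNat_real, hf.real 4 rfl]; exact hg)
        (by rw [setNat_nat, if_neg (by decide), hf.nat 43 rfl, e43]) (by simp [setNat_nat])
        (by rw [setNat_nat, if_neg (by decide), hf.nat 40 rfl, e40]) (hA j hj.le) (hA _ hj)
      rw [setNat_nat, if_neg (by decide)] at this
      refine ⟨Prog.ens_mono this.1 fun s' ⟨_, h1, h2⟩ i hi => ?_, this.2⟩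
      rcases Nat.lt_succ_iff_lt_or_eq.1 hi with hi | rfl
      · rw [h2 i hi.ne]
        exact hB i hi
      · exact h1

theorem levels_sim {s : Mem} {I : Inst} {w : ℕ → ℝ} {ε L : ℝ} (hs : Prepared I w ε L s)
    (hε : 0 ≤ ε) (hL : 0 ≤ L) {T : ℕ} (hT : s.nat 44 0 = T) (hTN : ∀ t < T, 2 * 2 ^ t + 1 ≤ I.N)
    (hTN' : T ≤ I.N) (h43 : s.nat 43 0 = 1) (hA : (s.nat 40, s.nat 41) = I.graph.start) :
    (levelsProg I.v).sim ℓ s (fun s' => (levelsProg I.v).Frame s s' ∧ s'.nat 43 0 = 2 ^ T ∧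
        ∀ i ≤ 2 ^ T, s'.nat 40 i < I.N)
      (fun s' => (s'.nat 40, s'.nat 41))
      (I.graph.levels (fun t => temp ε L (2 ^ t) t) w T) := by
  have := Prog.sim_forTo (ℓ := ℓ) (a := 35) (e := upto (reg 44)) (p := levelProg I.v)
      (s := s) (J := T)
      (Q := fun s' => (levelsProg I.v).Frame s s' ∧ s'.nat 43 0 = 2 ^ T ∧
        ∀ i ≤ 2 ^ T, s'.nat 40 i < I.N)
      (upto_eval hs.static.N hT hTN') (fun s' => (s'.nat 40, s'.nat 41))
      (fun t => I.graph.levelStep (temp ε L (2 ^ t) t) w (2 ^ t))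
      (fun t s' => s'.nat 43 0 = 2 ^ t ∧ ∀ i ≤ 2 ^ t, s'.nat 40 i < I.N) ?_ ?_
      (fun r hf hr => ⟨hf, hr⟩)
  · rw [hA] at this
    exact this
  · refine ⟨by simpa using h43, fun i hi => ?_⟩
    have e : s.nat 40 = I.graph.start.1 := congrArg Prod.fst hA
    have h1 : I.sink < I.N := I.graph.sink_lt
    rw [e, LGraph.start]
    change (if i = 1 then I.sink else 0) < I.N
    split_ifs <;> omega
  · rintro t ht r hf ⟨h1, h2⟩
    have hr : Prepared I w ε L (r.setNat 35 0 t) := (hs.frame hf rfl rfl rfl).setNat rfl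
    have := level_sim (ℓ := ℓ) hr hε hL (t := t) (p := 2 ^ t) (by simp [setNat_nat])
      (by rw [setNat_nat, if_neg (by decide)]; exact h1)
      (by rw [setNat_nat, if_neg (by decide)]; exact h2) (hTN t ht)
    rw [← pow_succ'] at this
    exact this

theorem findGreatest_lt {P : ℕ → Prop} [DecidablePred P] {N : ℕ} (hN : 0 < N) :
    Nat.findGreatest P (N - 1) < N := by
  have := Nat.findGreatest_le (P := P) (N - 1)
  omega

/-- The table entries depend on the data, but only their positivity is used, and that is
reachability in the graph. Hence the walk reveals nothing beyond the chosen nodes. -/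
theorem walkStep_ens {s : Mem} {I : Inst} (hs : Static I s) {β : ℝ} {w : ℕ → ℝ} {j p hi : ℕ}
    (hK : ∀ a < I.N, ∀ v < I.N, s.real 5 (a * I.N + v) = I.graph.K β w j p a v)
    (hhi : s.nat 40 (s.nat 36 0 + 1) = hi) (hhi' : hi < I.N) (hcur : s.nat 51 0 < I.N)
    (hPI : ∀ i, s.nat 50 i < I.N) :
    (walkStepProg I.v).ens ℓ s (fun s' =>
      (s'.nat 51 0, s'.nat 50) = I.graph.walkStep j p hi (s.nat 51 0, s.nat 50) ∧
        s'.nat 51 0 < I.N ∧ ∀ i, s'.nat 50 i < I.N) := by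
  classical
  rw [walkStepProg, Prog.ens_ite]
  simp only [Test.Holds, NExp.eval, reg_eval, hhi, Nat.add_one_le_iff]
  constructor
  · intro hlt
    rw [Prog.ens_seq, Prog.ens_setNat]
    set s1 := s.setNat 52 (NExp.eval s (.const 0)) (NExp.eval s (.const 0)) with hs1d
    have hs1 : Static I s1 := hs.setNat' rfl
    have hloop : (Prog.forTo 38 (upto (reg 13)) <|
        .ite (isTrue (edgeE I.v (reg 51) (reg 38)))
          (.ite (.realLe (.get 5 (addr (reg 38) (.get 40 (.add (reg 36) (.const 1)))))
            (.cast (.const 0))) .skip (.setNat 52 (.const 0) (reg 38))) .skip).ens ℓ s1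
        (fun s' => s'.nat 52 0 = Nat.findGreatest
          (fun u => I.graph.E (s.nat 51 0) u ∧ I.graph.Reach j p u hi) (I.N - 1)) := by
      refine Prog.ens_forTo (J := I.N) (upto_eval hs1.N hs1.N le_rfl)
        (fun u s' => s'.nat 52 0 = Nat.findGreatest
          (fun u => I.graph.E (s.nat 51 0) u ∧ I.graph.Reach j p u hi) (u - 1)) ?_ ?_
        (fun r _ hr => hr)
      · simp [hs1d, setNat_nat, NExp.eval]
      · intro u hu r hf h52
        have hr : Static I (r.setNat 38 0 u) := (hs1.frame' hf rfl).setNat' rfl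
        have e51 : r.nat 51 0 = s.nat 51 0 := by
          rw [hf.nat 51 rfl, hs1d, setNat_nat, if_neg (by decide)]
        have e36 : r.nat 36 0 = s.nat 36 0 := by
          rw [hf.nat 36 rfl, hs1d, setNat_nat, if_neg (by decide)]
        have e40 : r.nat 40 = s.nat 40 := by
          rw [hf.nat 40 rfl, hs1d, setNat_nat, if_neg (by decide)]
        have e5 : r.real 5 = s.real 5 := by rw [hf.real 5 rfl, hs1d, setNat_real]
        have h13 : r.nat 13 0 = I.N := by
          have := hr.N
          simpa [setNat_nat] using this
        have hedge : 1 ≤ (edgeE I.v (reg 51) (reg 38)).eval (r.setNat 38 0 u) ↔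
            I.graph.E (s.nat 51 0) u := by
          rw [hr.edge_iff (by simpa [setNat_nat, e51] using hcur)
            (by simpa [setNat_nat] using hu)]
          simp [setNat_nat, e51]
        simp only [Prog.ens_ite, Prog.ens_setNat, Prog.ens_skip, isTrue_holds, hedge]
        simp only [Test.Holds, RExp.eval, NExp.eval, addr, reg_eval, setNat_real, setNat_nat]
        simp only [Nat.reduceEqDiff, if_false, if_true, Function.update_self, e36, e40, e5, hhi,
          h13, hK u hu hi hhi', h52, Nat.add_sub_cancel, Nat.cast_zero]
        -- Node 0 has no incoming edge, in agreement with the default value 0 of the search.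
        rcases u with _ | u
        · have hno : ¬ I.graph.E (s.nat 51 0) 0 := fun h => absurd (I.graph.E_lt' h) (by omega)
          simp [hno]
        · simp only [Nat.add_sub_cancel]
          rw [Nat.findGreatest_succ]
          refine ⟨fun he => ⟨fun h0 => ?_, fun h0 => ?_⟩, fun he => ?_⟩
          · rw [if_neg]
            exact fun h => absurd (LGraph.K_pos.2 h.2) (not_lt.2 h0)
          · rw [if_pos]
            exact ⟨he, LGraph.K_pos.1 (not_le.1 h0)⟩
          · rw [if_neg]
            exact fun h => he h.1
    refine Prog.ens_seq_of hloop fun s2 hf2 h52 => ?_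
    have hs2 : Static I s2 := hs1.frame' hf2 rfl
    have e50 : s2.nat 50 = s.nat 50 := by
      rw [hf2.nat 50 rfl, hs1d, setNat_nat, if_neg (by decide)]
    rw [Prog.ens_seq, Prog.ens_setNat, Prog.ens_setNat]
    set x := Nat.findGreatest
      (fun u => I.graph.E (s.nat 51 0) u ∧ I.graph.Reach j p u hi) (I.N - 1) with hx
    have hxN : x < I.N := findGreatest_lt (by omega)
    have hs3 : Static I (s2.setNat 51 0 x) := hs2.setNat' rfl
    have hd := hs3.digits (a := reg 51) (by simpa [setNat_nat] using hxN)
    simp only [reg_eval, h52, NExp.eval] at hd ⊢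
    rw [hd.1]
    have e : I.graph.walkStep j p hi (s.nat 51 0, s.nat 50) =
        (x, Function.update (s.nat 50) (I.graph.pos x) x) := by
      rw [LGraph.walkStep, if_pos hlt]
      rfl
    rw [e]
    simp only [setNat_nat]
    simp only [Nat.reduceEqDiff, if_false, if_true, Function.update_self, e50]
    refine ⟨rfl, hxN, fun i => ?_⟩
    rw [Function.update_apply]
    split_ifs
    · exact hxN
    · exact hPI i
  · intro hlt
    rw [Prog.ens_skip, LGraph.walkStep, if_neg hlt]
    exact ⟨rfl, hcur, hPI⟩

theorem walk_ens {s : Mem} {I : Inst} {w : ℕ → ℝ} {ε L : ℝ} (hs : Prepared I w ε L s)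
    (hε : 0 ≤ ε) (hL : 0 ≤ L) {p : ℕ} (hp : s.nat 43 0 = p) (hpN : p ≤ I.N)
    (hA : ∀ i ≤ p, s.nat 40 i < I.N) (h51 : s.nat 51 0 = 0) (h50 : s.nat 50 = fun _ => 0) :
    (walkProg I.v).ens ℓ s (fun s' => s'.nat 50 = (I.graph.walk p (s.nat 40) p).2 ∧
      ∀ i, s'.nat 50 i < I.N) := by
  have hQN := I.Q_lt_N
  rw [walkProg]
  refine Prog.ens_seq_of (gain_ens hs.static.N hs.loss) fun s1 hf1 hg => ?_
  have hβ : 0 ≤ temp (s.real 0 0) (s.real 0 1) (s.nat 43 0) (s.nat 35 0) :=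
    temp_nonneg (by rw [hs.eps]; exact hε) (by rw [hs.lip]; exact hL) _ _
  set β := temp (s.real 0 0) (s.real 0 1) (s.nat 43 0) (s.nat 35 0)
  have hs1 : Static I s1 := hs.static.frame' hf1 rfl
  have e43 : s1.nat 43 0 = p := by rw [hf1.nat 43 rfl, hp]
  have e40 : s1.nat 40 = s.nat 40 := hf1.nat 40 rfl
  refine Prog.ens_forTo (J := p) (upto_eval hs1.N e43 hpN)
    (fun j s' => (s'.nat 51 0, s'.nat 50) = I.graph.walk p (s.nat 40) j ∧ s'.nat 51 0 < I.N ∧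
      ∀ i, s'.nat 50 i < I.N) ?_ ?_ (fun r _ hr => ⟨congrArg Prod.snd hr.1, hr.2.2⟩)
  · rw [hf1.nat 51 rfl, hf1.nat 50 rfl, h51, h50]
    have h0 : 0 < I.N := by omega
    exact ⟨rfl, h0, fun _ => h0⟩
  · rintro j hj r hf ⟨hw, hcur, hPI⟩
    have hr : Static I r := hs1.frame' hf rfl
    rw [Prog.ens_seq, Prog.ens_setNat, Prog.ens_seq, Prog.ens_setNat]
    set r1 := ((r.setNat 36 0 j).setNat 26 (NExp.eval (r.setNat 36 0 j) (.const 0))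
      (NExp.eval (r.setNat 36 0 j) (.add (reg 36) (.const 1)))) with hr1
    set r2 := r1.setNat 27 (NExp.eval r1 (.const 0)) (NExp.eval r1 (reg 43)) with hr2
    have hr2s : Static I r2 := ((hr.setNat' rfl).setNat' rfl).setNat' rfl
    have e26 : r2.nat 26 0 = j + 1 := by simp [hr2, hr1, setNat_nat, NExp.eval]
    have e27 : r2.nat 27 0 = p := by
      simp [hr2, hr1, setNat_nat, NExp.eval, hf.nat 43 rfl, e43]
    have e36 : r2.nat 36 0 = j := by simp [hr2, hr1, setNat_nat]
    have e40' : r2.nat 40 = s.nat 40 := by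
      simp [hr2, hr1, setNat_nat, hf.nat 40 rfl, e40]
    have e51 : r2.nat 51 = r.nat 51 := by simp [hr2, hr1, setNat_nat]
    have e50 : r2.nat 50 = r.nat 50 := by simp [hr2, hr1, setNat_nat]
    have hg2 : ∀ u < I.N, r2.real 4 u = Real.exp (-(β * w u)) := by
      have : r2.real 4 = s1.real 4 := by simp [hr2, hr1, hf.real 4 rfl]
      rw [this]
      exact hg
    refine Prog.ens_seq_of (table_ens hr2s hβ hg2 (by decide) e26 e27) fun r3 hf3 hK => ?_
    have hr3 : Static I r3 := hr2s.frame' hf3 rfl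
    have f36 : r3.nat 36 0 = j := by rw [hf3.nat 36 rfl, e36]
    have f40 : r3.nat 40 = s.nat 40 := by rw [hf3.nat 40 rfl, e40']
    refine Prog.ens_forTo (J := I.m + 2) (upto_eval hr3.N (by
      simp only [NExp.eval, mE, hr3.m]) (by omega))
      (fun i s' => (s'.nat 51 0, s'.nat 50) =
        (I.graph.walkStep (j + 1) p (s.nat 40 (j + 1)))^[i] (I.graph.walk p (s.nat 40) j) ∧
        s'.nat 51 0 < I.N ∧ ∀ i, s'.nat 50 i < I.N) ?_ ?_ (fun r _ hr => hr)
    · rw [hf3.nat 51 rfl, hf3.nat 50 rfl, e50, e51]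
      exact ⟨hw, hcur, hPI⟩
    · rintro i hi r4 hf4 ⟨h1, h2, h3⟩
      have hr4 : Static I (r4.setNat 37 0 i) := (hr3.frame' hf4 rfl).setNat' rfl
      have := walkStep_ens (ℓ := ℓ) (β := β) (w := w) (j := j + 1) (p := p)
        (hi := s.nat 40 (j + 1)) hr4
        (by rw [setNat_real, hf4.real 5 rfl]; exact hK)
        (by simp [setNat_nat, hf4.nat 40 rfl, hf4.nat 36 rfl, f36, f40])
        (hA _ hj) (by simpa [setNat_nat] using h2) (by simpa [setNat_nat] using h3)
      rw [Function.iterate_succ_apply', ← h1]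
      simpa [setNat_nat] using this

theorem out_ens {s : Mem} {I : Inst} (hs : Static I s) (hPI : ∀ i, s.nat 50 i < I.N) :
    outProg.ens ℓ s (fun s' => ∀ i < I.m, s'.real 2 i = (I.V (s.nat 50 (i + 1)) : ℝ) / I.Q) := by
  have hQN := I.Q_lt_N
  refine Prog.ens_forTo (J := I.m) (upto_eval hs.N hs.m (by omega))
    (fun j s' => ∀ i < j, s'.real 2 i = (I.V (s.nat 50 (i + 1)) : ℝ) / I.Q) (by simp) ?_
    (fun r _ hr => hr)
  intro j hj r hf hI
  have hr : Static I (r.setNat 36 0 j) := (hs.frame' hf rfl).setNat' rfl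
  have e50 : r.nat 50 = s.nat 50 := hf.nat 50 rfl
  have hval : (NExp.get 50 (.add (reg 36) (.const 1))).eval (r.setNat 36 0 j) =
      s.nat 50 (j + 1) := by
    simp [NExp.eval, setNat_nat, e50]
  have hd := hr.digits (a := .get 50 (.add (reg 36) (.const 1))) (by rw [hval]; exact hPI _)
  rw [hval] at hd
  rw [Prog.ens_setReal]
  intro i hi
  simp only [RExp.eval, hd.2.1, reg_eval, hr.Q, setReal_real, if_true, setNat_real]
  simp only [setNat_nat, if_true, Function.update_self]
  rcases Nat.lt_succ_iff_lt_or_eq.1 hi with hi | rfl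
  · rw [Function.update_of_ne hi.ne, hI i hi]
  · rw [Function.update_self]

/-! ### The mechanism -/

/-- The rounded-up power of two stays below 2n, so every array and loop of the levels has length at
most N. -/
theorem pow_clog_bounds {I : Inst} (hn : 1 ≤ I.n) (hm : 1 ≤ I.m) :
    2 ^ Nat.clog 2 I.n ≤ 2 * I.n ∧ (∀ t < Nat.clog 2 I.n, 2 * 2 ^ t + 1 ≤ I.N) ∧
      2 ^ Nat.clog 2 I.n ≤ I.N ∧ I.n ≤ I.N ∧ Nat.clog 2 I.n ≤ I.N := by
  have hQN := I.Q_lt_N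
  have hQ : I.n ≤ I.Q := Nat.le_mul_of_pos_right _ hm
  have h1 : 2 ^ Nat.clog 2 I.n ≤ 2 * I.n := by
    rcases Nat.eq_zero_or_pos (Nat.clog 2 I.n) with h | h
    · rw [h]; omega
    · obtain ⟨t, ht⟩ : ∃ t, Nat.clog 2 I.n = t + 1 := ⟨Nat.clog 2 I.n - 1, by omega⟩
      have := Nat.pow_lt_of_lt_clog (b := 2) (x := I.n) (y := t) (by omega)
      rw [ht, pow_succ']
      omega
  have h2 : Nat.clog 2 I.n < 2 ^ Nat.clog 2 I.n := Nat.lt_two_pow_self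
  refine ⟨h1, fun t ht => ?_, by omega, by omega, by omega⟩
  have := Nat.pow_lt_of_lt_clog ht
  omega

theorem setup_ens {s : Mem} {I : Inst} {ε L Lf : ℝ} (hm : s.nat 0 0 = I.m) (hn : s.nat 0 1 = I.n)
    (hk : s.nat 0 2 = I.k) (h10 : s.nat 10 0 = I.Q) (h11 : s.nat 11 0 = I.M)
    (h12 : s.nat 12 0 = I.B) (h13 : s.nat 13 0 = I.N) (h14 : s.nat 14 0 = I.sink)
    (hε : s.real 0 0 = ε) (hL : s.real 0 1 = L) (hLf : s.real 0 2 = Lf)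
    (hJ : I.J = maxIncr I.Q Lf) (hnN : I.n ≤ I.N) (h40 : s.nat 40 = fun _ => 0) :
    setupProg.ens ℓ s (fun s' => Prepared I (I.loss ℓ (s.nat 1) (s.real 1)) ε L s' ∧
      s'.nat 44 0 = Nat.clog 2 I.n ∧ s'.nat 43 0 = 1 ∧ s'.nat 40 = I.graph.start.1) := by
  rw [setupProg]
  refine Prog.ens_seq_of (divMod_ens I h12 h13) fun s1 hf1 ⟨hdiv, hmod⟩ => ?_
  refine Prog.ens_seq_of (incr_ens I (by rw [hf1.nat 13 rfl, h13]) (by rw [hf1.nat 10 rfl, h10]))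
    fun s2 hf2 h15 => ?_
  have hs2 : Static I s2 := by
    constructor
    · rw [hf2.nat 0 rfl, hf1.nat 0 rfl, hm]
    · rw [hf2.nat 0 rfl, hf1.nat 0 rfl, hn]
    · rw [hf2.nat 0 rfl, hf1.nat 0 rfl, hk]
    · rw [hf2.nat 10 rfl, hf1.nat 10 rfl, h10]
    · rw [hf2.nat 11 rfl, hf1.nat 11 rfl, h11]
    · rw [hf2.nat 13 rfl, hf1.nat 13 rfl, h13]
    · rw [hf2.nat 14 rfl, hf1.nat 14 rfl, h14]
    · rw [h15, hf1.real 0 rfl, hLf, hJ]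
    · rw [hf2.nat 20 rfl]; exact hdiv
    · rw [hf2.nat 21 rfl]; exact hmod
  refine Prog.ens_seq_of (loss_ens hs2 hnN) fun s3 hf3 h3 => ?_
  have hs3 : Static I s3 := hs2.frame' hf3 rfl
  refine Prog.ens_seq_of (numLevels_ens hs3 hnN) fun s4 hf4 ⟨h44, h43⟩ => ?_
  have hs4 : Static I s4 := hs3.frame' hf4 rfl
  have e0 : s4.real 0 = s.real 0 := by
    rw [hf4.real 0 rfl, hf3.real 0 rfl, hf2.real 0 rfl, hf1.real 0 rfl]
  have e40 : s4.nat 40 = fun _ => 0 := by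
    rw [hf4.nat 40 rfl, hf3.nat 40 rfl, hf2.nat 40 rfl, hf1.nat 40 rfl, h40]
  have e1 : s2.nat 1 = s.nat 1 := by rw [hf2.nat 1 rfl, hf1.nat 1 rfl]
  have e1' : s2.real 1 = s.real 1 := by rw [hf2.real 1 rfl, hf1.real 1 rfl]
  rw [Prog.ens_setNat]
  refine ⟨⟨hs4.setNat' rfl, ?_, ?_, ?_⟩, ?_, ?_, ?_⟩
  · rw [setNat_real, hf4.real 3 rfl, ← e1, ← e1']
    exact h3
  · rw [setNat_real, e0, hε]
  · rw [setNat_real, e0, hL]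
  · rw [setNat_nat, if_neg (by decide), h44]
  · rw [setNat_nat, if_neg (by decide), h43]
  · rw [setNat_nat, if_pos rfl, reg_eval, hs4.sink, e40]
    funext i
    simp [NExp.eval, Function.update_apply, LGraph.start, Inst.graph]

/-- The function described by the nodes that the levels have produced. -/
def decode (I : Inst) (X : Type*) [LinearOrder X] [Fintype X] (s : (ℕ → ℕ) × (ℕ → ℕ)) (x : X) : ℝ :=
  (I.V ((I.graph.walk (2 ^ Nat.clog 2 I.n) s.1 (2 ^ Nat.clog 2 I.n)).2
    (((rankIso X).symm x : ℕ) + 1)) : ℝ) / I.Q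

/-- The instance that belongs to a regression problem. -/
def theInst (v : Variant) (X : Type*) [Fintype X] (n : ℕ) (θ : Params) : Inst where
  v := v
  m := Fintype.card X
  n := n
  k := θ.k
  J := maxIncr (n * Fintype.card X) θ.Lf

/-- The losses of the nodes of a regression problem. -/
def theLoss (v : Variant) {X : Type*} [LinearOrder X] [Fintype X] {n : ℕ} (ℓ : ℝ → ℝ → ℝ)
    (θ : Params) (D : Dataset X n) : ℕ → ℝ :=
  (theInst v X n θ).loss ℓ ((initMem θ D).nat 1) ((initMem θ D).real 1)

/-- The data enter only through the node weights in `levels`. The instance and `decode` do not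
depend on them, so everything after the levels is post-processing. -/
theorem mechanism_eq (v : Variant) {X : Type*} [LinearOrder X] [Fintype X] {n : ℕ}
    (ℓ : ℝ → ℝ → ℝ) (θ : Params) (D : Dataset X n) (hX : 2 ≤ Fintype.card X) (hn : 1 ≤ n)
    (hε : 0 ≤ θ.ε) (hL : 0 ≤ θ.L) :
    (mainProg v).mechanism ℓ θ D =
      ((theInst v X n θ).graph.levels (fun t => temp θ.ε θ.L (2 ^ t) t) (theLoss v ℓ θ D)
        (Nat.clog 2 n)).map (decode (theInst v X n θ) X) := by
  set I := theInst v X n θ with hI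
  set s := initMem θ D with hs
  set w := theLoss v ℓ θ D with hw
  obtain ⟨hb1, hb2, hb3, hb4, hb5⟩ := pow_clog_bounds (I := I) hn (by
    change 1 ≤ Fintype.card X; omega)
  have hm : s.nat 0 0 = I.m := by simp [hs, initMem, hI, theInst]
  have hn' : s.nat 0 1 = I.n := by simp [hs, initMem, hI, theInst]
  have hk : s.nat 0 2 = I.k := by simp [hs, initMem, hI, theInst]
  have hz : ∀ a, a ≠ 0 → a ≠ 1 → s.nat a = fun _ => 0 := by
    intro a h0 h1
    funext i
    simp [hs, initMem, h0, h1]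
  have hfirst : (Prog.seq sizesProg setupProg).ens ℓ s (fun s' => Prepared I w θ.ε θ.L s' ∧
      s'.nat 44 0 = Nat.clog 2 I.n ∧ s'.nat 43 0 = 1 ∧ s'.nat 40 = I.graph.start.1) := by
    refine Prog.ens_seq_of (sizes_ens I hm hn') fun s1 hf1 ⟨h10, h11, h12, h13, h14⟩ => ?_
    have e1 : s1.nat 1 = s.nat 1 := hf1.nat 1 rfl
    have e1' : s1.real 1 = s.real 1 := hf1.real 1 rfl
    have e0 : s1.nat 0 = s.nat 0 := hf1.nat 0 rfl
    have e0' : s1.real 0 = s.real 0 := hf1.real 0 rfl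
    have := setup_ens (ℓ := ℓ) (s := s1) (I := I) (ε := θ.ε) (L := θ.L) (Lf := θ.Lf)
      (by rw [e0, hm]) (by rw [e0, hn']) (by rw [e0, hk]) h10 h11 h12 h13 h14
      (by rw [e0']; simp [hs, initMem]) (by rw [e0']; simp [hs, initMem])
      (by rw [e0']; simp [hs, initMem]) rfl hb4
      (by rw [hf1.nat 40 rfl, hz 40 (by decide) (by decide)])
    rw [e1, e1'] at this
    exact this
  have hlev : (Prog.seq (.seq sizesProg setupProg) (levelsProg v)).sim ℓ s
      (fun s' => Prepared I w θ.ε θ.L s' ∧ s'.nat 43 0 = 2 ^ Nat.clog 2 n ∧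
        (∀ i ≤ 2 ^ Nat.clog 2 n, s'.nat 40 i < I.N) ∧ s'.nat 51 = (fun _ => 0) ∧
        s'.nat 50 = fun _ => 0)
      (fun s' => (s'.nat 40, s'.nat 41))
      (I.graph.levels (fun t => temp θ.ε θ.L (2 ^ t) t) w (Nat.clog 2 n)) := by
    have h1 := Prog.sim_of_ens (abs := fun _ => ()) (c := ()) (Prog.ens_mono (Prog.ens_and
      (Prog.ens_frame _ _) hfirst) fun s' h => ⟨h, rfl⟩)
    have h2 := Prog.sim_seq (q := levelsProg v) (g := fun _ =>
      I.graph.levels (fun t => temp θ.ε θ.L (2 ^ t) t) w (Nat.clog 2 n))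
      (Q' := fun s' => Prepared I w θ.ε θ.L s' ∧ s'.nat 43 0 = 2 ^ Nat.clog 2 n ∧
        (∀ i ≤ 2 ^ Nat.clog 2 n, s'.nat 40 i < I.N) ∧ s'.nat 51 = (fun _ => 0) ∧
        s'.nat 50 = fun _ => 0) (abs' := fun s' => (s'.nat 40, s'.nat 41)) h1 ?_
    · rw [PMF.pure_bind] at h2
      exact h2
    · rintro s1 ⟨hf1, hp, h44, h43, h40⟩
      have h41 : s1.nat 41 = fun _ => 0 := by
        rw [hf1.nat 41 rfl, hz 41 (by decide) (by decide)]
      have := levels_sim (ℓ := ℓ) hp hε hL h44 hb2 hb5 h43 (by rw [h40, h41]; rfl)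
      refine ⟨Prog.ens_mono this.1 fun s' ⟨hf, h1, h2⟩ => ⟨hp.frame hf rfl rfl rfl, h1, h2, ?_, ?_⟩,
        this.2⟩
      · rw [hf.nat 51 rfl, hf1.nat 51 rfl, hz 51 (by decide) (by decide)]
      · rw [hf.nat 50 rfl, hf1.nat 50 rfl, hz 50 (by decide) (by decide)]
  have hall := Prog.sim_seq (q := .seq (walkProg v) outProg) (Q' := fun _ => True)
    (abs' := output X) (g := fun c => PMF.pure (decode I X c)) hlev ?_
  · have e : (mainProg v).dist ℓ s =
        (Prog.seq (.seq (.seq sizesProg setupProg) (levelsProg v))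
          (.seq (walkProg v) outProg)).dist ℓ s := by
      simp only [mainProg, bodyProg, Prog.dist_seq, PMF.bind_bind]
      refine congrArg _ (funext fun a => ?_)
      rw [Prog.dist_seq]
      refine congrArg _ (funext fun b => ?_)
      rw [Prog.dist_seq]
    have h2 := hall.2
    rw [← e, Prog.dist, PMF.map_comp] at h2
    exact h2
  · rintro s1 ⟨hp, h43, h40, h51, h50⟩
    refine Prog.sim_of_ens ?_
    refine Prog.ens_seq_of (walk_ens hp hε hL h43 hb3 h40 (by rw [h51]) h50)
      fun s2 hf2 ⟨hPI, hPIN⟩ => ?_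
    refine Prog.ens_mono (out_ens (hp.static.frame' hf2 rfl) hPIN) fun s3 h => ⟨trivial, ?_⟩
    funext x
    have hx : ((rankIso X).symm x : ℕ) < I.m := ((rankIso X).symm x).2
    change s3.real 2 ((rankIso X).symm x : ℕ) = _
    rw [h _ hx, hPI]
    rfl

end PrivIso
end

noncomputable section
namespace PrivIso

/-! ### Paths describe feasible functions -/

theorem const_on_runs {α : Type*} {m : ℕ} {c : ℕ → ℕ} {F : ℕ → α}
    (hc : ∀ i, i + 1 < m → c i ≤ c (i + 1))
    (hF : ∀ i, i + 1 < m → c (i + 1) = c i → F (i + 1) = F i) :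
    ∀ i j, i < m → j < m → c i = c j → F i = F j := by
  have mono : ∀ i j, i ≤ j → j < m → c i ≤ c j := by
    intro i j hij
    induction j, hij using Nat.le_induction with
    | base => exact fun _ => le_rfl
    | succ j hij ih => exact fun hj => (ih (by omega)).trans (hc j hj)
  have key : ∀ i j, i ≤ j → j < m → c i = c j → F i = F j := by
    intro i j hij
    induction j, hij using Nat.le_induction with
    | base => exact fun _ _ => rfl
    | succ j hij ih =>
      intro hj h
      have h1 := mono i j hij (by omega)
      have h2 := hc j hj
      rw [hF j hj (by omega), ih (by omega) (by omega)]
  intro i j hi hj h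
  rcases le_total i j with hij | hij
  · exact key i j hij hj h
  · exact (key j i hij hi h.symm).symm

/-- A quantity that changes only when the monotone counter changes is a function of the counter.
Counters run from 1 to k, labels from 0. -/
theorem exists_factor {α : Type*} [Nonempty α] {m k : ℕ} {c : ℕ → ℕ} {F : ℕ → α} (hk : 1 ≤ k)
    (hc : ∀ i, i + 1 < m → c i ≤ c (i + 1)) (hck : ∀ i < m, c i ≤ k) (hc1 : ∀ i < m, 1 ≤ c i)
    (hF : ∀ i, i + 1 < m → c (i + 1) = c i → F (i + 1) = F i) :
    ∃ c' : Fin m → Fin k, Monotone c' ∧ ∃ a : Fin k → α, ∀ i : Fin m, F i = a (c' i) := by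
  have mono : ∀ i j, i ≤ j → j < m → c i ≤ c j := by
    intro i j hij
    induction j, hij using Nat.le_induction with
    | base => exact fun _ => le_rfl
    | succ j hij ih => exact fun hj => (ih (by omega)).trans (hc j hj)
  refine ⟨fun i => ⟨c i - 1, by have := hck i i.2; omega⟩, fun i j hij => ?_, ?_⟩
  · have := mono i j hij j.2
    simp only [Fin.mk_le_mk]
    omega
  · have hfac : Function.FactorsThrough (fun i : Fin m => F i)
        (fun i : Fin m => (⟨c i - 1, by have := hck i i.2; omega⟩ : Fin k)) := by
      intro i j hij
      simp only [Fin.mk.injEq] at hij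
      refine const_on_runs hc hF i j i.2 j.2 ?_
      have := hc1 i i.2
      have := hc1 j j.2
      omega
    obtain ⟨e, he⟩ := (Function.factorsThrough_iff _).1 hfac
    exact ⟨e, fun i => congrFun he i⟩

theorem maxIncr_le {Q : ℕ} {Lf : ℝ} (h : 0 ≤ Lf) : (maxIncr Q Lf : ℝ) ≤ Lf * Q := by
  classical
  exact Nat.findGreatest_spec (P := fun i : ℕ => (i : ℝ) ≤ Lf * Q) (m := 0) (Nat.zero_le _)
    (by simpa using mul_nonneg h (Nat.cast_nonneg _))

theorem le_maxIncr {Q i : ℕ} {Lf : ℝ} (hi : i ≤ Q) (h : (i : ℝ) ≤ Lf * Q) : i ≤ maxIncr Q Lf := by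
  classical
  exact Nat.le_findGreatest hi h

namespace Inst

variable {I : Inst}

/-- The digits serve as memory of the path: the counter limits the number of pieces, and the slope
digit lets a relation between two nodes constrain two successive increments. -/
theorem shape_of_rel {Lf : ℝ} (hLf : 0 ≤ Lf) (hJ : I.J = maxIncr I.Q Lf) (hk : 1 ≤ I.k)
    (hQ : 0 < I.Q) {x : ℕ → ℕ} (hV : ∀ i, i + 1 < I.m → I.V (x i) ≤ I.V (x (i + 1)))
    (h0 : I.cnt (x 0) = 1) (hrel : ∀ i, i + 1 < I.m → I.Rel (x i) (x (i + 1))) :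
    Shape I.v I.k Lf (fun i : Fin I.m => (I.V (x i) : ℝ) / I.Q) := by
  have hQ' : (0 : ℝ) < I.Q := by exact_mod_cast hQ
  have hcnt : (∀ i, i + 1 < I.m → I.cnt (x (i + 1)) ≤ I.k ∧ (I.cnt (x (i + 1)) = I.cnt (x i) ∨
      I.cnt (x (i + 1)) = I.cnt (x i) + 1)) →
      (∀ i, i + 1 < I.m → I.cnt (x i) ≤ I.cnt (x (i + 1))) ∧ (∀ i < I.m, I.cnt (x i) ≤ I.k) ∧
      ∀ i < I.m, 1 ≤ I.cnt (x i) := by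
    intro h
    refine ⟨fun i hi => ?_, fun i hi => ?_, fun i => ?_⟩
    · rcases (h i hi).2 with h | h <;> omega
    · rcases i with _ | i
      · rw [h0]; exact hk
      · exact (h i hi).1
    · induction i with
      | zero => intro _; rw [h0]
      | succ i ih =>
        intro hi
        have := ih (by omega)
        rcases (h i hi).2 with h | h <;> omega
  unfold Rel at hrel
  unfold Shape
  cases hv : I.v <;> simp only [hv] at hrel ⊢
  · obtain ⟨h1, h2, h3⟩ := hcnt fun i hi => ⟨(hrel i hi).1, (hrel i hi).2.imp And.left id⟩
    refine exists_factor (F := fun i => (I.V (x i) : ℝ) / I.Q) hk h1 h2 h3 ?_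
    intro i hi heq
    rcases (hrel i hi).2 with ⟨-, h⟩ | h
    · simp only [h]
    · omega
  · obtain ⟨h1, h2, h3⟩ := hcnt fun i hi => ⟨(hrel i hi).1, (hrel i hi).2.imp And.left id⟩
    -- The pair of intercept and slope is constant as long as the counter does not change.
    obtain ⟨c, hc, a, ha⟩ := exists_factor
      (F := fun i => (((I.V (x i) : ℝ) - I.slope (x i) * i) / I.Q, (I.slope (x i) : ℝ) / I.Q))
      hk h1 h2 h3 (by
        intro i hi heq
        rcases (hrel i hi).2 with ⟨-, h, h'⟩ | h
        · simp only [h, h', Prod.mk.injEq, and_true]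
          push_cast
          ring
        · omega)
    refine ⟨c, hc, fun s => (a s).1, fun s => (a s).2, fun i => ?_⟩
    simp only [← ha i]
    field_simp
    ring
  · obtain ⟨h1, h2, h3⟩ := hcnt fun i hi => ⟨(hrel i hi).1, (hrel i hi).2.2.imp And.left id⟩
    have mono : ∀ i j, i ≤ j → j < I.m → I.cnt (x i) ≤ I.cnt (x j) := by
      intro i j hij
      induction j, hij using Nat.le_induction with
      | base => exact fun _ => le_rfl
      | succ j hij ih => exact fun hj => (ih (by omega)).trans (h1 j hj)
    rcases Nat.eq_zero_or_pos I.m with hm | hm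
    · exfalso
      unfold Q at hQ
      rw [hm] at hQ
      simp at hQ
    have hslope := const_on_runs (m := I.m) (c := fun i => I.cnt (x i))
      (F := fun i => I.slope (x i)) h1 (by
        intro i hi heq
        rcases (hrel i hi).2.2 with ⟨-, h⟩ | h
        · exact h
        · omega)
    -- The breakpoint t s is the last argument with count at most s. On (t s, t (s + 1)] the count
    -- is s + 1, so the increments that end there are equal and the function is affine from t s on,
    -- left end included. Counts start at 1, so t 0 is the default value 0.
    set t : ℕ → ℕ := fun s => Nat.findGreatest (fun i => I.cnt (x i) ≤ s) (I.m - 1) with ht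
    have htm : ∀ s, t s < I.m := fun s => by
      have : t s ≤ I.m - 1 := Nat.findGreatest_le _
      omega
    have hbet : ∀ s i, t s < i → i ≤ t (s + 1) → I.cnt (x i) = s + 1 := by
      intro s i h h'
      have hlt : s < I.cnt (x i) := by
        have := Nat.findGreatest_is_greatest (P := fun i => I.cnt (x i) ≤ s) h
          (by have := htm (s + 1); omega)
        omega
      have hne : t (s + 1) ≠ 0 := by omega
      have hspec := Nat.findGreatest_of_ne_zero (P := fun i => I.cnt (x i) ≤ s + 1) (n := I.m - 1)
        rfl hne
      have := mono i (t (s + 1)) h' (htm _)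
      have hspec' : I.cnt (x (t (s + 1))) ≤ s + 1 := hspec
      omega
    refine ⟨fun s => ⟨t s, htm s⟩, fun s s' hs => ?_, ?_, ?_,
      fun s => ((I.V (x (t s)) : ℝ) - I.slope (x (t s + 1)) * (t s)) / I.Q,
      fun s => (I.slope (x (t s + 1)) : ℝ) / I.Q, fun s i h h' => ?_⟩
    · refine Nat.findGreatest_mono_left (fun i hi => ?_) _
      exact hi.trans hs
    · simp only [ht, Fin.val_zero, Nat.findGreatest_eq_zero_iff]
      intro i _ hi
      have := h3 i (by omega)
      omega
    · simp only [Fin.val_last]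
      have : t I.k = I.m - 1 := by
        refine le_antisymm (Nat.findGreatest_le _) (Nat.le_findGreatest le_rfl ?_)
        exact h2 _ (by omega)
      omega
    · have key : ∀ i', t s ≤ i' → i' ≤ t (s + 1) →
          (I.V (x i') : ℝ) = I.V (x (t s)) + I.slope (x (t s + 1)) * ((i' : ℝ) - t s) := by
        intro i' hi'
        induction i', hi' using Nat.le_induction with
        | base => intro _; simp
        | succ i' hi' ih =>
          intro hle
          have hm' := htm (s + 1)
          have e1 := (hrel i' (by omega)).2.1
          have e2 := hslope (i' + 1) (t s + 1) (by omega) (by omega)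
            (by rw [hbet s (i' + 1) (by omega) hle,
              hbet s (t s + 1) (by omega) (by omega)])
          rw [e1, e2]
          push_cast
          rw [ih (by omega)]
          ring
      simp only [Fin.le_def, Fin.val_castSucc, Fin.val_succ] at h h'
      have := key i h h'
      simp only
      rw [this]
      ring
  · have hstep : ∀ i j, i ≤ j → j < I.m →
        (I.V (x j) : ℝ) ≤ I.V (x i) + maxIncr I.Q Lf * ((j : ℝ) - i) ∧
        I.V (x i) ≤ I.V (x j) := by
      intro i j hij
      induction j, hij using Nat.le_induction with
      | base => intro _; simp
      | succ j hij ih =>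
        intro hj
        obtain ⟨e1, e2⟩ := ih (by omega)
        refine ⟨?_, e2.trans (hV j hj)⟩
        have e3 := hrel j hj
        rw [hJ] at e3
        have e4 : (I.V (x (j + 1)) : ℝ) ≤ I.V (x j) + maxIncr I.Q Lf := by exact_mod_cast e3
        push_cast
        linarith
    have hmain : ∀ i j : Fin I.m, i ≤ j → |(I.V (x i) : ℝ) / I.Q - (I.V (x j) : ℝ) / I.Q| ≤
        Lf * |(i : ℝ) - (j : ℝ)| := by
      intro i j hij
      obtain ⟨e1, e2⟩ := hstep i j hij j.2
      have e3 : (I.V (x i) : ℝ) ≤ I.V (x j) := by exact_mod_cast e2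
      have e4 : ((i : ℕ) : ℝ) ≤ ((j : ℕ) : ℝ) := by exact_mod_cast hij
      rw [abs_sub_comm, abs_sub_comm (i : ℝ), abs_of_nonneg (by linarith : (0 : ℝ) ≤ (j : ℝ) - i),
        ← sub_div, abs_of_nonneg (div_nonneg (by linarith) hQ'.le), div_le_iff₀ hQ']
      have := mul_le_mul_of_nonneg_right (maxIncr_le (Q := I.Q) hLf)
        (by linarith : (0 : ℝ) ≤ (j : ℝ) - i)
      nlinarith
    intro i j
    rcases le_total i j with hij | hij
    · exact hmain i j hij
    · rw [abs_sub_comm, abs_sub_comm (i : ℝ)]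
      exact hmain j i hij
  · intro i hi
    obtain ⟨e1, -⟩ := hrel i (by omega)
    obtain ⟨e2, e3⟩ := hrel (i + 1) (by omega)
    have e4 : 2 * I.V (x (i + 1)) ≤ I.V (x i) + I.V (x (i + 2)) := by
      rw [show i + 2 = i + 1 + 1 by ring]; omega
    have e5 : 2 * (I.V (x (i + 1)) : ℝ) ≤ I.V (x i) + I.V (x (i + 2)) := by exact_mod_cast e4
    simp only
    rw [← add_div, ← mul_div_assoc]
    exact div_le_div_of_nonneg_right e5 hQ'.le
  · intro i hi
    obtain ⟨e1, -⟩ := hrel i (by omega)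
    obtain ⟨e2, e3⟩ := hrel (i + 1) (by omega)
    have e4 : I.V (x i) + I.V (x (i + 2)) ≤ 2 * I.V (x (i + 1)) := by
      rw [show i + 2 = i + 1 + 1 by ring]; omega
    have e5 : (I.V (x i) : ℝ) + I.V (x (i + 2)) ≤ 2 * (I.V (x (i + 1)) : ℝ) := by exact_mod_cast e4
    simp only
    rw [← add_div, ← mul_div_assoc]
    exact div_le_div_of_nonneg_right e5 hQ'.le

/-- A path from the source to the sink describes a feasible function. -/
theorem feasible_of_path {Lf : ℝ} (hLf : 0 ≤ Lf) (hJ : I.J = maxIncr I.Q Lf) (hk : 1 ≤ I.k)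
    (hQ : 0 < I.Q) {π : ℕ → ℕ} (hE : ∀ i < I.m + 1, I.graph.E (π i) (π (i + 1))) (h0 : π 0 = 0) :
    (∀ i j, i ≤ j → j < I.m → I.V (π (i + 1)) ≤ I.V (π (j + 1))) ∧
      (∀ i < I.m, I.V (π (i + 1)) ≤ I.Q) ∧
      Shape I.v I.k Lf (fun i : Fin I.m => (I.V (π (i + 1)) : ℝ) / I.Q) := by
  have hpos : ∀ i ≤ I.m + 1, I.pos (π i) = i := by
    intro i
    induction i with
    | zero => intro _; rw [h0]; simp [pos]
    | succ i ih => intro hi; rw [(hE i (by omega)).1.1, ih (by omega)]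
  have hV : ∀ i, i + 1 < I.m → I.V (π (i + 1)) ≤ I.V (π (i + 1 + 1)) :=
    fun i hi => (hE (i + 1) (by omega)).1.2.2.1
  refine ⟨?_, fun i hi => (hE (i + 1) (by omega)).1.2.1,
    shape_of_rel hLf hJ hk hQ (x := fun i => π (i + 1)) hV ?_ ?_⟩
  · intro i j hij
    induction j, hij using Nat.le_induction with
    | base => exact fun _ => le_rfl
    | succ j hij ih => exact fun hj => (ih (by omega)).trans (hV j hj)
  · have hm : 0 < I.m := Nat.pos_of_mul_pos_left hQ
    obtain ⟨-, -, -, h | ⟨-, h | h⟩⟩ := (hE 0 (by omega)).1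
    · rw [hpos 1 (by omega)] at h; omega
    · exact h.2
    · rw [h0] at h; simp [pos] at h
  · intro i hi
    obtain ⟨-, -, -, h | ⟨-, h | h⟩⟩ := (hE (i + 1) (by omega)).1
    · rw [hpos _ (by omega)] at h; omega
    · rw [hpos _ (by omega)] at h; omega
    · exact h.2

/-! ### Feasible functions are close to paths -/

/-- The path with given digits. -/
def mkPath (I : Inst) (V d q : ℕ → ℕ) (i : ℕ) : ℕ :=
  if i = 0 then 0 else if i ≤ I.m then I.node i (V (i - 1)) (d (i - 1)) (q (i - 1)) else I.sink

theorem isPath_mkPath (hm : 1 ≤ I.m) {V d q : ℕ → ℕ} (hV : ∀ i < I.m, V i ≤ I.Q)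
    (hd : ∀ i < I.m, d i ≤ I.Q) (hq : ∀ i < I.m, q i ≤ I.m) (hmono : Monotone V) (hq0 : q 0 = 1)
    (hrel : ∀ i, i + 1 < I.m → I.Rel (I.node (i + 1) (V i) (d i) (q i))
      (I.node (i + 1 + 1) (V (i + 1)) (d (i + 1)) (q (i + 1)))) :
    I.graph.IsPath 1 1 0 I.sink (I.mkPath V d q) ∧
      ∀ i < I.m, I.V (I.mkPath V d q (i + 1)) = V i := by
  have hB : I.B = I.Q + I.m + 3 := rfl
  have e0 : I.mkPath V d q 0 = 0 := by simp [mkPath]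
  have e1 : ∀ i < I.m, I.mkPath V d q (i + 1) = I.node (i + 1) (V i) (d i) (q i) := by
    intro i hi
    rw [mkPath, if_neg (by omega), if_pos (by omega), Nat.add_sub_cancel]
  have e2 : I.mkPath V d q (I.m + 1) = I.sink := by
    rw [mkPath, if_neg (by omega), if_neg (by omega)]
  have dig : ∀ i < I.m, I.pos (I.node (i + 1) (V i) (d i) (q i)) = i + 1 ∧
      I.V (I.node (i + 1) (V i) (d i) (q i)) = V i ∧
      I.slope (I.node (i + 1) (V i) (d i) (q i)) = d i ∧
      I.cnt (I.node (i + 1) (V i) (d i) (q i)) = q i := by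
    intro i hi
    have := hV i hi
    have := hd i hi
    have := hq i hi
    exact node_digits (by omega) (by omega) (by omega)
  have hlt : ∀ i < I.m, I.node (i + 1) (V i) (d i) (q i) < I.N := by
    intro i hi
    have := hV i hi
    have := hd i hi
    have := hq i hi
    exact node_lt (by omega) (by omega) (by omega) (by omega)
  have hV0 : I.V 0 = 0 := by simp [Inst.V]
  have hp0 : I.pos 0 = 0 := by simp [pos]
  have hps : I.graph.pos I.sink = I.m + 1 := sink_digits.1
  have hp0' : I.graph.pos 0 = 0 := hp0
  have hsN : I.sink < I.N := I.graph.sink_lt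
  refine ⟨⟨by omega, by rw [hp0', e0], by rw [hps, e2], ?_, ?_⟩,
    fun i hi => by rw [e1 i hi, (dig i hi).2.1]⟩
  · intro i _ hi
    rw [hps] at hi
    rcases i with _ | i
    · rw [e0, e1 0 hm]
      obtain ⟨d1, d2, d3, d4⟩ := dig 0 hm
      exact ⟨⟨by rw [d1, hp0], by omega, by omega, Or.inr ⟨by rw [d2]; exact hV 0 hm,
        Or.inl ⟨hp0, by rw [d4, hq0]⟩⟩⟩, hlt 0 hm⟩
    · have hi' : i < I.m := by omega
      obtain ⟨d1, d2, d3, d4⟩ := dig i hi'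
      rw [e1 i hi']
      rcases Nat.lt_or_ge (i + 1) I.m with h | h
      · obtain ⟨c1, c2, c3, c4⟩ := dig (i + 1) h
        rw [e1 (i + 1) h]
        exact ⟨⟨by rw [c1, d1], by rw [d2]; exact hV i hi', by rw [d2, c2]; exact hmono (by omega),
          Or.inr ⟨by rw [c2]; exact hV _ h, Or.inr ⟨by omega, hrel i h⟩⟩⟩, hlt _ h⟩
      · have hmi : i + 1 = I.m := by omega
        rw [show i + 1 + 1 = I.m + 1 by omega, e2]
        obtain ⟨s1, s2⟩ := sink_digits (I := I)
        have := hV i hi'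
        exact ⟨⟨by rw [s1, d1, hmi], by omega, by rw [d2, s2]; unfold M; omega, Or.inl s1⟩, hsN⟩
  · intro i _ hi
    rw [hps] at hi
    have : I.V (I.mkPath V d q i) ≤ I.Q := by
      rcases i with _ | i
      · rw [e0, hV0]; omega
      · rw [e1 i (by omega), (dig i (by omega)).2.1]; exact hV i (by omega)
    -- The single cell of level 0 is no restriction, because the sink has a larger value than all
    -- grid values.
    change I.V (I.mkPath V d q i) * 1 < 1 * I.M
    unfold M
    omega

/-- The number of pieces up to an argument, if the pieces are labelled by `c`. -/
def pieces (c : ℕ → ℕ) : ℕ → ℕ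
  | 0 => 1
  | i + 1 => if c (i + 1) = c i then pieces c i else pieces c i + 1

/-- Counting the distinct labels instead of storing them keeps the count within one digit even if k
is huge, and makes it grow by at most one per step. -/
theorem pieces_le (c : ℕ → ℕ) (i : ℕ) : pieces c i ≤ i + 1 := by
  induction i with
  | zero => exact le_rfl
  | succ i ih => rw [pieces]; split_ifs <;> omega

theorem pieces_le_label {c : ℕ → ℕ} {m : ℕ} (hc : ∀ i, i + 1 < m → c i ≤ c (i + 1)) (i : ℕ)
    (hi : i < m) : pieces c i ≤ c i + 1 := by
  induction i with
  | zero => simp [pieces]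
  | succ i ih =>
    have := ih (by omega)
    have := hc i hi
    rw [pieces]
    split_ifs <;> omega

theorem pieces_succ (c : ℕ → ℕ) (i : ℕ) : (pieces c (i + 1) = pieces c i ∧ c (i + 1) = c i) ∨
    pieces c (i + 1) = pieces c i + 1 := by
  rw [pieces]
  split_ifs with h
  · exact Or.inl ⟨rfl, h⟩
  · exact Or.inr rfl

/-- Rounding of a sequence to the grid, by rounding its increments. -/
def round (Q : ℕ) (G : ℕ → ℝ) : ℕ → ℕ
  | 0 => ⌊G 0 * Q⌋₊
  | i + 1 => round Q G i + ⌊(G (i + 1) - G i) * Q⌋₊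

/-- Each of the i + 1 floors taken so far loses at most one unit of the grid. -/
theorem round_bounds {Q : ℕ} {G : ℕ → ℝ} (h0 : 0 ≤ G 0) (hG : Monotone G) (i : ℕ) :
    (round Q G i : ℝ) ≤ G i * Q ∧ G i * Q ≤ round Q G i + (i + 1) := by
  have hQ : (0 : ℝ) ≤ Q := Nat.cast_nonneg _
  induction i with
  | zero =>
    refine ⟨Nat.floor_le (mul_nonneg h0 hQ), ?_⟩
    have := (Nat.lt_floor_add_one (G 0 * Q)).le
    simpa [round] using this
  | succ i ih =>
    have h1 := Nat.floor_le (mul_nonneg (sub_nonneg.2 (hG (Nat.le_succ i))) hQ)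
    have h2 := (Nat.lt_floor_add_one ((G (i + 1) - G i) * Q)).le
    simp only [Nat.succ_eq_add_one] at h1
    rw [round]
    push_cast
    constructor <;> nlinarith [ih.1, ih.2]

theorem round_mono (Q : ℕ) (G : ℕ → ℝ) : Monotone (round Q G) :=
  monotone_nat_of_le_succ fun i => by rw [round]; omega

/-- Every feasible function is close to a path. -/
theorem exists_path {Lf : ℝ} (hJ : I.J = maxIncr I.Q Lf) (hk : 1 ≤ I.k) (hn : 1 ≤ I.n)
    (hm : 1 ≤ I.m) {g : Fin I.m → ℝ} (hg : Monotone g) (hg01 : ∀ i, g i ∈ Set.Icc (0 : ℝ) 1)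
    (hs : Shape I.v I.k Lf g) :
    ∃ ρ, I.graph.IsPath 1 1 0 I.sink ρ ∧
      ∀ i : Fin I.m, |(I.V (ρ (i + 1)) : ℝ) / I.Q - g i| ≤ 1 / I.n := by
  have hQ : 0 < I.Q := Nat.mul_pos hn hm
  have hQ' : (0 : ℝ) < I.Q := by exact_mod_cast hQ
  set G : ℕ → ℝ := fun i => g ⟨min i (I.m - 1), by omega⟩ with hG
  have hGg : ∀ i (h : i < I.m), G i = g ⟨i, h⟩ := by
    intro i h
    simp only [hG]
    congr 2
    omega
  have hGmono : Monotone G := fun i j hij => hg (by simp only [Fin.mk_le_mk]; omega)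
  have hG01 : ∀ i, G i ∈ Set.Icc (0 : ℝ) 1 := fun i => hg01 _
  have hGd : ∀ i, 0 ≤ G (i + 1) - G i := fun i => sub_nonneg.2 (hGmono (Nat.le_succ i))
  have hGd1 : ∀ i, (G (i + 1) - G i) * I.Q ≤ I.Q := fun i => by
    have := (hG01 (i + 1)).2
    have := (hG01 i).1
    nlinarith
  set e : ℕ → ℕ := fun i => ⌊(G (i + 1) - G i) * I.Q⌋₊ with he
  have heQ : ∀ i, e i ≤ I.Q := fun i => Nat.floor_le_of_le (hGd1 i)
  set V := round I.Q G with hVd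
  have hVs : ∀ i, V (i + 1) = V i + e i := fun i => rfl
  have hb := fun i => round_bounds (Q := I.Q) (hG01 0).1 hGmono i
  have hVQ : ∀ i < I.m, V i ≤ I.Q := by
    intro i _
    have h1 := (hb i).1
    have h2 := (hG01 i).2
    have h3 : (V i : ℝ) ≤ I.Q := by nlinarith
    exact_mod_cast h3
  have hclose : ∀ i : Fin I.m, |(V i : ℝ) / I.Q - g i| ≤ 1 / I.n := by
    intro i
    obtain ⟨h1, h2⟩ := hb i
    rw [hGg i i.2] at h1 h2
    have h3 : ((i : ℕ) : ℝ) + 1 ≤ I.m := by exact_mod_cast i.2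
    have hn' : (0 : ℝ) < I.n := by exact_mod_cast hn
    have hQe : (I.Q : ℝ) = I.n * I.m := by simp [Q]
    -- The reason for Q = n·m: an accumulated error of m grid units is 1/n in value.
    have h4 : (1 : ℝ) / I.n * I.Q = I.m := by rw [hQe]; field_simp
    have h5 : (V i : ℝ) / I.Q ≤ g i := (div_le_iff₀ hQ').2 h1
    have h6 : g i ≤ (V i : ℝ) / I.Q + 1 / I.n := by
      refine le_of_mul_le_mul_right ?_ hQ'
      rw [add_mul, div_mul_cancel₀ _ hQ'.ne', h4]
      linarith
    rw [abs_le]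
    constructor <;> linarith [show (0 : ℝ) ≤ 1 / I.n by positivity]
  have finish : ∀ d q : ℕ → ℕ, (∀ i < I.m, d i ≤ I.Q) → (∀ i < I.m, q i ≤ I.m) → q 0 = 1 →
      (∀ i, i + 1 < I.m → I.Rel (I.node (i + 1) (V i) (d i) (q i))
        (I.node (i + 1 + 1) (V (i + 1)) (d (i + 1)) (q (i + 1)))) →
      ∃ ρ, I.graph.IsPath 1 1 0 I.sink ρ ∧
        ∀ i : Fin I.m, |(I.V (ρ (i + 1)) : ℝ) / I.Q - g i| ≤ 1 / I.n := by
    intro d q h1 h2 h3 h4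
    obtain ⟨h5, h6⟩ := isPath_mkPath hm hVQ h1 h2 (round_mono _ _) h3 h4
    exact ⟨_, h5, fun i => by rw [h6 i i.2]; exact hclose i⟩
  have hB : I.B = I.Q + I.m + 3 := rfl
  have dig : ∀ d q : ℕ → ℕ, (∀ i < I.m, d i ≤ I.Q) → (∀ i < I.m, q i ≤ I.m) → ∀ i < I.m,
      I.V (I.node (i + 1) (V i) (d i) (q i)) = V i ∧
      I.slope (I.node (i + 1) (V i) (d i) (q i)) = d i ∧
      I.cnt (I.node (i + 1) (V i) (d i) (q i)) = q i := by
    intro d q h1 h2 i hi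
    have := hVQ i hi
    have := h1 i hi
    have := h2 i hi
    exact (node_digits (by omega) (by omega) (by omega)).2
  have hpm : ∀ c : ℕ → ℕ, ∀ i < I.m, pieces c i ≤ I.m := fun c i hi => by
    have := pieces_le c i
    omega
  unfold Shape at hs
  cases hv : I.v <;> simp only [hv] at hs
  · obtain ⟨c, hc, a, ha⟩ := hs
    set c' : ℕ → ℕ := fun i => c ⟨min i (I.m - 1), by omega⟩ with hc'
    have hcm : ∀ i, i + 1 < I.m → c' i ≤ c' (i + 1) := fun i _ =>
      hc (by simp only [Fin.mk_le_mk]; omega)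
    refine finish (fun _ => 0) (pieces c') (fun _ _ => Nat.zero_le _) (hpm c') rfl ?_
    intro i hi
    obtain ⟨d1, d2, d3⟩ := dig (fun _ => 0) (pieces c') (fun _ _ => Nat.zero_le _) (hpm c') i
      (by omega)
    obtain ⟨b1, b2, b3⟩ := dig (fun _ => 0) (pieces c') (fun _ _ => Nat.zero_le _) (hpm c') (i + 1)
      hi
    simp only [Rel, hv, d1, d3, b1, b3]
    refine ⟨(pieces_le_label hcm (i + 1) hi).trans (c _).2, ?_⟩
    rcases pieces_succ c' i with ⟨h1, h2⟩ | h
    · refine Or.inl ⟨h1, ?_⟩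
      rw [hVs]
      have : G (i + 1) = G i := by
        simp only [hG, ha]
        exact congrArg a (Fin.ext h2)
      simp [he, this]
    · exact Or.inr h
  · obtain ⟨c, hc, a, b, ha⟩ := hs
    set c' : ℕ → ℕ := fun i => c ⟨min i (I.m - 1), by omega⟩ with hc'
    have hcm : ∀ i, i + 1 < I.m → c' i ≤ c' (i + 1) := fun i _ =>
      hc (by simp only [Fin.mk_le_mk]; omega)
    -- The slope of a one-point piece is arbitrary and is capped to fit in a digit. Where a piece
    -- has two consecutive points, its slope is an increment of g, and the cap is inactive.
    set d : ℕ → ℕ := fun i => min ⌊b (c ⟨min i (I.m - 1), by omega⟩) * I.Q⌋₊ I.Q with hd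
    have hdQ : ∀ i < I.m, d i ≤ I.Q := fun i _ => min_le_right _ _
    refine finish d (pieces c') hdQ (hpm c') rfl ?_
    intro i hi
    obtain ⟨d1, d2, d3⟩ := dig d (pieces c') hdQ (hpm c') i (by omega)
    obtain ⟨b1, b2, b3⟩ := dig d (pieces c') hdQ (hpm c') (i + 1) hi
    simp only [Rel, hv, d1, d2, d3, b1, b2, b3]
    refine ⟨(pieces_le_label hcm (i + 1) hi).trans (c _).2, ?_⟩
    rcases pieces_succ c' i with ⟨h1, h2⟩ | h
    · have h2' : c ⟨min (i + 1) (I.m - 1), by omega⟩ = c ⟨min i (I.m - 1), by omega⟩ := Fin.ext h2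
      refine Or.inl ⟨h1, ?_, by simp only [hd, h2']⟩
      rw [hVs]
      have : G (i + 1) - G i = b (c ⟨min i (I.m - 1), by omega⟩) := by
        have e1 : ((min (i + 1) (I.m - 1) : ℕ) : ℝ) = i + 1 := by
          rw [Nat.min_eq_left (by omega)]
          push_cast
          rfl
        have e2 : ((min i (I.m - 1) : ℕ) : ℝ) = i := by rw [Nat.min_eq_left (by omega)]
        simp only [hG, ha, h2', e1, e2]
        ring
      have h3 := heQ i
      simp only [he, this] at h3
      simp only [he, this, hd]
      rw [min_eq_left h3]
    · exact Or.inr h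
  · obtain ⟨t, ht, ht0, htk, a, b, ha⟩ := hs
    set tN : ℕ → ℕ := fun s => t ⟨min s I.k, by omega⟩ with htN
    have htN0 : tN 0 = 0 := by
      refine Eq.trans ?_ ht0
      simp only [htN]
      congr 2
    have htNk : tN I.k = I.m - 1 := by
      have : tN I.k = t (Fin.last I.k) := by
        simp only [htN]
        congr 2
        exact Fin.ext (by simp)
      omega
    -- An argument is labelled by the piece s with t s < i ≤ t (s + 1), the one that governs the
    -- increment ending at i.
    set c : ℕ → ℕ := fun i => Nat.findGreatest (fun s => tN s < i) (I.k - 1) with hc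
    have hck : ∀ i, c i ≤ I.k - 1 := fun i => Nat.findGreatest_le _
    have hcmono : Monotone c := fun i j hij =>
      Nat.findGreatest_mono_left (fun s (hs : tN s < i) => hs.trans_le hij) _
    have hcl : ∀ i, 1 ≤ i → tN (c i) < i := fun i hi =>
      Nat.findGreatest_spec (P := fun s => tN s < i) (Nat.zero_le _) (by rw [htN0]; omega)
    have hcr : ∀ i < I.m, i ≤ tN (c i + 1) := by
      intro i hi
      rcases Nat.lt_or_ge (c i + 1) I.k with h | h
      · have := Nat.findGreatest_is_greatest (P := fun s => tN s < i) (Nat.lt_succ_self (c i))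
          (by omega)
        simp only [Nat.succ_eq_add_one] at this
        omega
      · have := hck i
        rw [show c i + 1 = I.k by omega, htNk]
        omega
    have hval : ∀ s < I.k, ∃ α β : ℝ, ∀ i < I.m, tN s ≤ i → i ≤ tN (s + 1) → G i = α + β * i := by
      intro s hs
      refine ⟨a ⟨s, hs⟩, b ⟨s, hs⟩, fun i hi h1 h2 => ?_⟩
      rw [hGg i hi]
      refine ha ⟨s, hs⟩ ⟨i, hi⟩ ?_ ?_
      · rw [Fin.le_def]
        refine le_trans (le_of_eq ?_) h1
        simp only [htN]
        congr 2
        exact Fin.ext (by simp; omega)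
      · rw [Fin.le_def]
        refine h2.trans (le_of_eq ?_)
        simp only [htN]
        congr 2
        exact Fin.ext (by simp; omega)
    -- The argument 0 lies in no half-open piece; it gets the label of 1, and below also the slope
    -- of the first increment.
    set c' : ℕ → ℕ := fun i => c (max i 1) with hc'
    have hcm : ∀ i, i + 1 < I.m → c' i ≤ c' (i + 1) := fun i _ => hcmono (by omega)
    set d : ℕ → ℕ := fun i => if i = 0 then e 0 else e (i - 1) with hd
    have hdQ : ∀ i < I.m, d i ≤ I.Q := fun i _ => by
      simp only [hd]
      split_ifs
      · exact heQ _
      · exact heQ _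
    refine finish d (pieces c') hdQ (hpm c') rfl ?_
    intro i hi
    obtain ⟨d1, d2, d3⟩ := dig d (pieces c') hdQ (hpm c') i (by omega)
    obtain ⟨b1, b2, b3⟩ := dig d (pieces c') hdQ (hpm c') (i + 1) hi
    simp only [Rel, hv, d1, d2, d3, b1, b2, b3]
    refine ⟨?_, by simp [hd, hVs], ?_⟩
    · have h1 := pieces_le_label hcm (i + 1) hi
      have h2 : c' (i + 1) ≤ I.k - 1 := hck _
      omega
    rcases pieces_succ c' i with ⟨h1, h2⟩ | h
    · refine Or.inl ⟨h1, ?_⟩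
      rcases i with _ | i
      · simp [hd]
      · simp only [hd, Nat.add_sub_cancel, he]
        rw [if_neg (by omega), if_neg (by omega)]
        have h3 : c (i + 1 + 1) = c (i + 1) := by simpa [hc'] using h2
        obtain ⟨α, β, hαβ⟩ := hval (c (i + 1)) (by have := hck (i + 1); omega)
        -- Strictness puts i itself into the closed piece, so i, i + 1 and i + 2 lie on one line and
        -- the two increments agree before and after rounding.
        have h4 := hcl (i + 1) (by omega)
        have h5 := hcr (i + 1 + 1) hi
        rw [h3] at h5
        rw [hαβ i (by omega) (by omega) (by omega), hαβ (i + 1) (by omega) (by omega) (by omega),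
          hαβ (i + 1 + 1) hi (by omega) h5]
        congr 2
        push_cast
        ring
    · exact Or.inr h
  · refine finish (fun _ => 0) (fun _ => 1) (fun _ _ => Nat.zero_le _) (fun _ _ => hm) rfl ?_
    intro i hi
    obtain ⟨d1, d2, d3⟩ := dig (fun _ => 0) (fun _ => 1) (fun _ _ => Nat.zero_le _)
      (fun _ _ => hm) i (by omega)
    obtain ⟨b1, b2, b3⟩ := dig (fun _ => 0) (fun _ => 1) (fun _ _ => Nat.zero_le _)
      (fun _ _ => hm) (i + 1) hi
    simp only [Rel, hv, d1, b1]
    rw [hVs, hJ]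
    refine Nat.add_le_add_left (le_maxIncr (heQ i) ?_) _
    refine (Nat.floor_le (mul_nonneg (hGd i) hQ'.le)).trans ?_
    refine mul_le_mul_of_nonneg_right ?_ hQ'.le
    rw [hGg i (by omega), hGg (i + 1) hi]
    refine (le_abs_self _).trans ((hs _ _).trans ?_)
    simp
  -- No increment ends at the argument 0; the least slope makes the first comparison void. The
  -- concave case uses the largest slope instead.
  · set d : ℕ → ℕ := fun i => if i = 0 then 0 else e (i - 1) with hd
    have hdQ : ∀ i < I.m, d i ≤ I.Q := fun i _ => by
      simp only [hd]
      split_ifs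
      · exact Nat.zero_le _
      · exact heQ _
    refine finish d (fun _ => 1) hdQ (fun _ _ => hm) rfl ?_
    intro i hi
    obtain ⟨d1, d2, d3⟩ := dig d (fun _ => 1) hdQ (fun _ _ => hm) i (by omega)
    obtain ⟨b1, b2, b3⟩ := dig d (fun _ => 1) hdQ (fun _ _ => hm) (i + 1) hi
    simp only [Rel, hv, d1, d2, b1, b2]
    refine ⟨by simp [hd, hVs], ?_⟩
    rcases i with _ | i
    · simp [hd]
    · simp only [hd, Nat.add_sub_cancel, he]
      rw [if_neg (by omega), if_neg (by omega)]
      refine Nat.floor_le_floor (mul_le_mul_of_nonneg_right ?_ hQ'.le)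
      have := hs i hi
      rw [hGg i (by omega), hGg (i + 1) (by omega), hGg (i + 1 + 1) hi]
      linarith
  · set d : ℕ → ℕ := fun i => if i = 0 then I.Q else e (i - 1) with hd
    have hdQ : ∀ i < I.m, d i ≤ I.Q := fun i _ => by
      simp only [hd]
      split_ifs
      · exact le_rfl
      · exact heQ _
    refine finish d (fun _ => 1) hdQ (fun _ _ => hm) rfl ?_
    intro i hi
    obtain ⟨d1, d2, d3⟩ := dig d (fun _ => 1) hdQ (fun _ _ => hm) i (by omega)
    obtain ⟨b1, b2, b3⟩ := dig d (fun _ => 1) hdQ (fun _ _ => hm) (i + 1) hi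
    simp only [Rel, hv, d1, d2, b1, b2]
    refine ⟨by simp [hd, hVs], ?_⟩
    rcases i with _ | i
    · simpa [hd] using heQ 0
    · simp only [hd, Nat.add_sub_cancel, he]
      rw [if_neg (by omega), if_neg (by omega)]
      refine Nat.floor_le_floor (mul_le_mul_of_nonneg_right ?_ hQ'.le)
      have := hs i hi
      rw [hGg i (by omega), hGg (i + 1) (by omega), hGg (i + 1 + 1) hi]
      linarith

end Inst
end PrivIso
end

noncomputable section
namespace PrivIso

/-! ### Privacy, utility and running time -/

namespace Inst

variable {I : Inst}

/-- The zero function satisfies all constraints, so the mechanism always has something to choose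
from. -/
theorem reach (hm : 1 ≤ I.m) (hk : 1 ≤ I.k) : I.graph.Reach 1 1 0 I.graph.sink := by
  have hB : I.B = I.Q + I.m + 3 := rfl
  refine ⟨_, (isPath_mkPath (V := fun _ => 0) (d := fun _ => 0) (q := fun _ => 1) hm
    (fun _ _ => Nat.zero_le _) (fun _ _ => Nat.zero_le _) (fun _ _ => hm) monotone_const rfl
    fun i hi => ?_).1⟩
  have dig : ∀ p, I.V (I.node p 0 0 1) = 0 ∧ I.slope (I.node p 0 0 1) = 0 ∧
      I.cnt (I.node p 0 0 1) = 1 := fun p =>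
    (node_digits (by omega) (by omega) (by omega)).2
  unfold Rel
  cases I.v <;> simp [dig, hk]

/-- Nodes of the same cell have similar losses. -/
theorem abs_loss_sub_le {ℓ : ℝ → ℝ → ℝ} {L y : ℝ} (hL : 0 ≤ L) (hℓ : LipschitzLoss L ℓ)
    (hy : y ∈ Set.Icc (0 : ℝ) 1) (hQ : 2 ≤ I.Q) {p j₀ j₂ a b : ℕ} (hp : 0 < p) (haQ : a ≤ I.Q)
    (hbQ : b ≤ I.Q) (ha₀ : j₀ * I.M ≤ a * p) (hb₀ : j₀ * I.M ≤ b * p) (ha₂ : a * p < j₂ * I.M)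
    (hb₂ : b * p < j₂ * I.M) :
    ℓ ((a : ℝ) / I.Q) y ≤ ℓ ((b : ℝ) / I.Q) y + L * (2 * ((j₂ : ℝ) - j₀) / p) := by
  have hQ' : (0 : ℝ) < I.Q := by exact_mod_cast (by omega : 0 < I.Q)
  have hp' : (0 : ℝ) < p := by exact_mod_cast hp
  have mem : ∀ x : ℕ, x ≤ I.Q → (x : ℝ) / I.Q ∈ Set.Icc (0 : ℝ) 1 := fun x hx =>
    ⟨by positivity, by rw [div_le_one hQ']; exact_mod_cast hx⟩
  have h1 := hℓ _ (mem a haQ) _ (mem b hbQ) y hy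
  -- The range of node values exceeds the grid by 2, which at most doubles the width of the cells;
  -- this is the factor 2 in the conclusion.
  have hM : (I.M : ℝ) ≤ 2 * I.Q := by
    have : I.M ≤ 2 * I.Q := by unfold M; omega
    exact_mod_cast this
  have h2 : |(a : ℝ) / I.Q - (b : ℝ) / I.Q| ≤ 2 * ((j₂ : ℝ) - j₀) / p := by
    have a0 : (j₀ : ℝ) * I.M ≤ a * p := by exact_mod_cast ha₀
    have b0 : (j₀ : ℝ) * I.M ≤ b * p := by exact_mod_cast hb₀
    have a2 : (a : ℝ) * p ≤ j₂ * I.M := by exact_mod_cast ha₂.le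
    have b2 : (b : ℝ) * p ≤ j₂ * I.M := by exact_mod_cast hb₂.le
    have hj : (0 : ℝ) ≤ j₂ - j₀ := by
      have : j₀ ≤ j₂ := by
        by_contra h
        have := Nat.mul_le_mul_right I.M (by omega : j₂ ≤ j₀)
        omega
      have : (j₀ : ℝ) ≤ j₂ := by exact_mod_cast this
      linarith
    have hjM := mul_le_mul_of_nonneg_left hM hj
    rw [← sub_div, abs_div, abs_of_pos hQ', div_le_div_iff₀ hQ' hp']
    have e : |(a : ℝ) - b| * p = |((a : ℝ) - b) * p| := by rw [abs_mul, abs_of_pos hp']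
    rw [e, abs_le]
    constructor <;> nlinarith
  have h3 := (le_abs_self _).trans (h1.trans (mul_le_mul_of_nonneg_left h2 hL))
  linarith

end Inst

theorem exists_lower_bound {α : Type*} {P : α → Prop} {f : α → ℝ} {Δ : ℝ}
    (h : ∀ u v, P u → P v → f u ≤ f v + Δ) : ∃ c, ∀ u, P u → c ≤ f u ∧ f u ≤ c + Δ := by
  by_cases hP : ∃ u, P u
  · obtain ⟨u₀, h₀⟩ := hP
    have hb : BddBelow (f '' {u | P u}) := ⟨f u₀ - Δ, by
      rintro _ ⟨u, hu, rfl⟩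
      linarith [h u₀ u h₀ hu]⟩
    refine ⟨sInf (f '' {u | P u}), fun u hu => ⟨csInf_le hb ⟨u, hu, rfl⟩, ?_⟩⟩
    have : f u - Δ ≤ sInf (f '' {u | P u}) := by
      refine le_csInf ⟨_, u₀, h₀, rfl⟩ ?_
      rintro _ ⟨v, hv, rfl⟩
      linarith [h u v hu hv]
    linarith
  · exact ⟨0, fun u hu => absurd ⟨u, hu⟩ hP⟩

/-- For nonzero L the summand is ε / (2(t+1)(t+2)), which telescopes. For L = 0 all terms vanish. -/
theorem sum_temp_le {ε L : ℝ} (hε : 0 ≤ ε) (T : ℕ) :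
    ∑ t ∈ Finset.range T, temp ε L (2 ^ t) t * (2 * L / 2 ^ t) ≤ ε / 2 := by
  rcases eq_or_ne L 0 with rfl | hL
  · simp only [mul_zero, zero_div, Finset.sum_const_zero]
    positivity
  · have : ∑ t ∈ Finset.range T, temp ε L (2 ^ t) t * (2 * L / 2 ^ t) =
        ε / 2 * (1 - 1 / (T + 1)) := by
      induction T with
      | zero => simp
      | succ T ih =>
        rw [Finset.sum_range_succ, ih, temp]
        have h1 : (T : ℝ) + 1 ≠ 0 := by positivity
        have h2 : (T : ℝ) + 2 ≠ 0 := by positivity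
        have h3 : (T : ℝ) + 1 + 1 ≠ 0 := by positivity
        push_cast
        field_simp
        ring
    rw [this]
    have : (0 : ℝ) ≤ 1 / ((T : ℝ) + 1) := by positivity
    nlinarith

theorem risk_eq_of_lipschitz_zero {X : Type*} {n : ℕ} {ℓ : ℝ → ℝ → ℝ} (hℓ : LipschitzLoss 0 ℓ)
    (D : Dataset X n) {f g : X → ℝ}
    (hf : ∀ x, f x ∈ Set.Icc (0 : ℝ) 1) (hg : ∀ x, g x ∈ Set.Icc (0 : ℝ) 1) :
    risk ℓ f D = risk ℓ g D := by
  unfold risk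
  congr 1
  refine Finset.sum_congr rfl fun i _ => ?_
  have := hℓ _ (hf (D i).1) _ (hg (D i).1) _ (D i).2.2
  rw [zero_mul] at this
  exact sub_eq_zero.1 (abs_nonpos_iff.1 this)

/-! ### Losses of the examples as node weights; privacy and excess risk -/

section Problem

variable {v : Variant} {X : Type*} [LinearOrder X] [Fintype X] {n : ℕ} {ℓ : ℝ → ℝ → ℝ} {θ : Params}

/-- The layer of an example. -/
def layer (D : Dataset X n) (i : Fin n) : ℕ := ((rankIso X).symm (D i).1 : ℕ) + 1

theorem layer_lt (D : Dataset X n) (i : Fin n) : layer D i < Fintype.card X + 1 :=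
  Nat.succ_lt_succ ((rankIso X).symm (D i).1).2

theorem theLoss_eq (D : Dataset X n) (u : ℕ) : theLoss v ℓ θ D u =
    ∑ i : Fin n, if layer D i = (theInst v X n θ).pos u then
      ℓ (((theInst v X n θ).V u : ℝ) / (theInst v X n θ).Q) (D i).2 else 0 := by
  rw [theLoss, Inst.loss, show (theInst v X n θ).n = n from rfl, Finset.sum_range]
  refine Finset.sum_congr rfl fun i _ => ?_
  simp only [initMem, layer, i.2, dif_pos, one_ne_zero, if_false, if_true]
  rfl

/-- Adding back the example i₀ changes only its own layer. In a cell its loss is its infimum over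
the cell, which becomes the offset C, plus at most L times the width bound 2/2^t. -/
theorem perturb_theLoss (hL : 0 ≤ θ.L) (hℓ : LipschitzLoss θ.L ℓ)
    (hQ : 2 ≤ (theInst v X n θ).Q) (D : Dataset X n) (i₀ : Fin n) (t j : ℕ) :
    ∃ C, (theInst v X n θ).graph.Perturb
      (fun u => ∑ i ∈ Finset.univ.erase i₀, if layer D i = (theInst v X n θ).pos u then
        ℓ (((theInst v X n θ).V u : ℝ) / (theInst v X n θ).Q) (D i).2 else 0)
      (theLoss v ℓ θ D) (layer D i₀) (2 * j) (2 * j + 2) (2 * 2 ^ t) C (2 * θ.L / 2 ^ t) := by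
  set I := theInst v X n θ
  have hsplit : ∀ u, theLoss v ℓ θ D u = (if layer D i₀ = I.pos u then
      ℓ ((I.V u : ℝ) / I.Q) (D i₀).2 else 0) + ∑ i ∈ Finset.univ.erase i₀,
        if layer D i = I.pos u then ℓ ((I.V u : ℝ) / I.Q) (D i).2 else 0 := fun u => by
    rw [theLoss_eq]
    exact (Finset.add_sum_erase _ _ (Finset.mem_univ i₀)).symm
  obtain ⟨C, hC⟩ := exists_lower_bound (Δ := 2 * θ.L / 2 ^ t)
    (P := fun u => I.V u ≤ I.Q ∧ 2 * j * I.M ≤ I.V u * (2 * 2 ^ t) ∧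
      I.V u * (2 * 2 ^ t) < (2 * j + 2) * I.M)
    (f := fun u => ℓ ((I.V u : ℝ) / I.Q) (D i₀).2) (by
      rintro a b ⟨a1, a2, a3⟩ ⟨b1, b2, b3⟩
      have := Inst.abs_loss_sub_le (I := I) hL hℓ (D i₀).2.2 hQ (by positivity) a1 b1 a2 b2 a3 b3
      refine this.trans (le_of_eq ?_)
      push_cast
      field_simp
      ring)
  refine ⟨C, fun u hu => ?_, fun u hu h1 h2 h3 => ?_, fun u hu h1 h2 h3 => ?_⟩
  · rw [hsplit, if_neg (fun h => hu h.symm), zero_add]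
  · rw [hsplit, if_pos (show layer D i₀ = I.pos u from hu.symm)]
    linarith [(hC u ⟨h1, h2, h3⟩).1]
  · rw [hsplit, if_pos (show layer D i₀ = I.pos u from hu.symm)]
    linarith [(hC u ⟨h1, h2, h3⟩).2]

theorem mechanism_private (hX : 2 ≤ Fintype.card X) (hn : 1 ≤ n) (hε : 0 ≤ θ.ε) (hL : 0 ≤ θ.L)
    (hℓ : LipschitzLoss θ.L ℓ) (hk : 1 ≤ θ.k) :
    PureDP θ.ε (fun D : Dataset X n => (mainProg v).mechanism ℓ θ D) := by
  rintro D D' ⟨i₀, hD⟩ S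
  simp only
  set I := theInst v X n θ with hI
  have hQ : 2 ≤ I.Q := hX.trans (Nat.le_mul_of_pos_left _ hn)
  have hR : I.graph.Reach 1 1 0 I.graph.sink := Inst.reach (by change 1 ≤ Fintype.card X; omega) hk
  set w₀ : Dataset X n → ℕ → ℝ := fun D u => ∑ i ∈ Finset.univ.erase i₀,
    if layer D i = I.pos u then ℓ ((I.V u : ℝ) / I.Q) (D i).2 else 0 with hw₀
  have hw : w₀ D = w₀ D' := by
    funext u
    refine Finset.sum_congr rfl fun i hi => ?_
    rw [layer, layer, hD i (Finset.ne_of_mem_erase hi)]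
  -- Both datasets are compared with their common part without i₀, at a price of ε/2 each.
  have key : ∀ D s, _ ∧ _ := fun D s => LGraph.levels_le hR (fun t => temp θ.ε θ.L (2 ^ t) t)
    (fun t => temp_nonneg hε hL _ _) (w := w₀ D) (w' := theLoss v ℓ θ D) (Nat.clog 2 n)
    (x := layer D i₀) (Δ := fun t => 2 * θ.L / 2 ^ t) (fun t => by positivity)
    (fun t j _ => perturb_theLoss hL hℓ hQ D i₀ t j) s
  rw [mechanism_eq v ℓ θ D hX hn hε hL, mechanism_eq v ℓ θ D' hX hn hε hL]
  refine toOuterMeasure_le (map_apply_le (fun s => ?_) _) S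
  have hc := ENNReal.ofReal_le_ofReal (Real.exp_le_exp.2 (sum_temp_le (L := θ.L) hε (Nat.clog 2 n)))
  have h1 := (key D s).2
  have h2 := (key D' s).1
  rw [← hw] at h2
  refine (h1.trans (mul_le_mul' hc (h2.trans (mul_le_mul' hc le_rfl)))).trans (le_of_eq ?_)
  rw [← mul_assoc, ← ENNReal.ofReal_mul (Real.exp_nonneg _), ← Real.exp_add, add_halves]

/-- A path meets the layer of each example exactly once, so its cost is the total loss. Layer 0
contains no example. -/
theorem sum_theLoss (D : Dataset X n) {ρ : ℕ → ℕ}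
    (hρ : ∀ j < Fintype.card X + 1, (theInst v X n θ).pos (ρ j) = j) :
    ∑ j ∈ Finset.range (Fintype.card X + 1), theLoss v ℓ θ D (ρ j) =
      ∑ i : Fin n, ℓ (((theInst v X n θ).V (ρ (layer D i)) : ℝ) / (theInst v X n θ).Q) (D i).2 := by
  simp only [theLoss_eq]
  rw [Finset.sum_comm]
  refine Finset.sum_congr rfl fun i _ => ?_
  rw [Finset.sum_eq_single (layer D i)]
  · rw [hρ _ (layer_lt D i), if_pos rfl]
  · intro j hj hne
    rw [hρ j (Finset.mem_range.1 hj), if_neg hne.symm]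
  · intro h
    exact absurd (Finset.mem_range.2 (layer_lt D i)) h

theorem pos_of_edges {I : Inst} {π : ℕ → ℕ} (hE : ∀ i < I.m + 1, I.graph.E (π i) (π (i + 1)))
    (h0 : π 0 = 0) : ∀ i ≤ I.m + 1, I.pos (π i) = i := by
  intro i
  induction i with
  | zero => intro _; rw [h0]; simp [Inst.pos]
  | succ i ih => intro hi; rw [(hE i (by omega)).1.1, ih (by omega)]

theorem decode_feasible (hX : 2 ≤ Fintype.card X) (hn : 1 ≤ n) (hk : 1 ≤ θ.k) (hLf : 0 ≤ θ.Lf)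
    {s : (ℕ → ℕ) × (ℕ → ℕ)}
    (hs : (theInst v X n θ).graph.Valid (2 ^ Nat.clog 2 n) s.1) :
    decode (theInst v X n θ) X s ∈ feasible v θ.k θ.Lf X := by
  set I := theInst v X n θ with hI
  have hQ : 2 ≤ I.Q := hX.trans (Nat.le_mul_of_pos_left _ hn)
  have hQ' : (0 : ℝ) < I.Q := by exact_mod_cast (by omega : 0 < I.Q)
  obtain ⟨hE, h0, -⟩ := hs.walk_edge
  obtain ⟨h1, h2, h3⟩ := Inst.feasible_of_path hLf rfl hk (by omega) hE h0
  refine ⟨fun x y hxy => ?_, fun x => ⟨by unfold decode; positivity, ?_⟩, ?_⟩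
  · refine div_le_div_of_nonneg_right ?_ hQ'.le
    exact_mod_cast h1 _ _ ((rankIso X).symm.monotone hxy) ((rankIso X).symm y).2
  · refine (div_le_one hQ').2 ?_
    exact_mod_cast h2 _ ((rankIso X).symm x).2
  · have : decode I X s ∘ rankIso X = fun i : Fin (Fintype.card X) =>
        (I.V ((I.graph.walk (2 ^ Nat.clog 2 n) s.1 (2 ^ Nat.clog 2 n)).2 (i + 1)) : ℝ) / I.Q := by
      funext i
      simp only [Function.comp, decode, OrderIso.symm_apply_apply]
      rfl
    rw [this]
    exact h3

/-- With p ≥ n cells an example's loss on the walk exceeds that on the optimal path through the same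
nodes by at most 2L/p; summed over n examples this is at most 2L. -/
theorem risk_decode_le (hX : 2 ≤ Fintype.card X) (hn : 1 ≤ n) (hL : 0 ≤ θ.L)
    (hℓ : LipschitzLoss θ.L ℓ) (D : Dataset X n) {s : (ℕ → ℕ) × (ℕ → ℕ)}
    (hs : (theInst v X n θ).graph.Valid (2 ^ Nat.clog 2 n) s.1) :
    risk ℓ (decode (theInst v X n θ) X s) D ≤ 1 / n *
      ((theInst v X n θ).graph.potential (theLoss v ℓ θ D) (2 ^ Nat.clog 2 n) s.1 + 2 * θ.L) := by
  set I := theInst v X n θ with hI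
  have hQ : 2 ≤ I.Q := hX.trans (Nat.le_mul_of_pos_left _ hn)
  obtain ⟨hE, h0, -⟩ := hs.walk_edge
  set p : ℕ := 2 ^ Nat.clog 2 n with hp
  have hp0 : 0 < p := by positivity
  have hp' : (0 : ℝ) < p := by exact_mod_cast hp0
  set δ : ℕ → ℝ := fun j => ∑ i : Fin n, if layer D i = j then θ.L * (2 / p) else 0 with hδ
  have hw := hs.cost_walk_le (w := theLoss v ℓ θ D) (δ := δ) (by
    intro j _ a b hab a1 b1 a2 b2 a3 b3
    rw [theLoss_eq, theLoss_eq, ← hI, hδ, ← Finset.sum_add_distrib]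
    refine Finset.sum_le_sum fun i _ => ?_
    change I.pos a = I.pos b at hab
    rw [← hab]
    by_cases h : layer D i = I.pos a
    · rw [if_pos h, if_pos h, if_pos (show layer D i = I.graph.pos a from h)]
      have := Inst.abs_loss_sub_le (I := I) hL hℓ (D i).2.2 hQ hp0 a1 b1 a2 b2 a3 b3
      refine this.trans (le_of_eq ?_)
      rw [show 2 * (((j + 1 : ℕ) : ℝ) - (j : ℕ)) = 2 by push_cast; ring]
      rfl
    · rw [if_neg h, if_neg h, if_neg (show ¬ layer D i = I.graph.pos a from h), zero_add])
  have hsum : ∑ j ∈ Finset.range I.graph.R, δ j ≤ 2 * θ.L := by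
    simp only [hδ]
    rw [Finset.sum_comm]
    have : ∀ i : Fin n, ∑ j ∈ Finset.range I.graph.R,
        (if layer D i = j then θ.L * (2 / p) else 0) = θ.L * (2 / p) := by
      intro i
      rw [Finset.sum_ite_eq, if_pos (show layer D i ∈ Finset.range I.graph.R from
        Finset.mem_range.2 (layer_lt D i))]
    simp only [this, Finset.sum_const, Finset.card_univ, Fintype.card_fin, nsmul_eq_mul]
    have hnp : (n : ℝ) ≤ p := by
      have : n ≤ p := Nat.le_pow_clog (by norm_num) n
      exact_mod_cast this
    have : (n : ℝ) * (2 / p) ≤ 2 := by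
      rw [← mul_div_assoc, div_le_iff₀ hp']
      linarith
    nlinarith
  have hpos := pos_of_edges hE h0
  rw [risk]
  refine mul_le_mul_of_nonneg_left ?_ (by positivity)
  refine le_trans (le_of_eq ?_) (hw.trans (add_le_add_right hsum _))
  have := sum_theLoss (v := v) (ℓ := ℓ) (θ := θ) D (ρ := (I.graph.walk p s.1 p).2)
    (fun j hj => hpos j (by change j ≤ Fintype.card X + 1; omega))
  exact this.symm

/-- The rounding of a competitor moves each prediction by at most 1/n, so the total loss rises by at
most L. -/
theorem D_le_risk (hX : 2 ≤ Fintype.card X) (hn : 1 ≤ n) (hL : 0 ≤ θ.L)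
    (hℓ : LipschitzLoss θ.L ℓ) (hk : 1 ≤ θ.k) (D : Dataset X n) {g : X → ℝ}
    (hg : g ∈ feasible v θ.k θ.Lf X) :
    (theInst v X n θ).graph.D (theLoss v ℓ θ D) 1 1 0 (theInst v X n θ).graph.sink ≤
      n * risk ℓ g D + θ.L := by
  set I := theInst v X n θ with hI
  have hn' : (0 : ℝ) < n := by exact_mod_cast hn
  have hQ : 2 ≤ I.Q := hX.trans (Nat.le_mul_of_pos_left _ hn)
  have hQ' : (0 : ℝ) < I.Q := by exact_mod_cast (by omega : 0 < I.Q)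
  obtain ⟨g1, g2, g3⟩ := hg
  obtain ⟨ρ, hρ, hclose⟩ := Inst.exists_path (I := I) (Lf := θ.Lf) rfl hk hn
    (by change 1 ≤ Fintype.card X; omega) (g := g ∘ rankIso X)
    (g1.comp (rankIso X).monotone) (fun i => g2 _) g3
  refine (hρ.D_le _).trans ?_
  have e0 : I.graph.pos 0 = 0 := I.graph.pos_zero
  have e1 : I.graph.pos I.sink = Fintype.card X + 1 := I.graph.pos_sink
  have hpos : ∀ j < Fintype.card X + 1, I.pos (ρ j) = j := fun j hj =>
    hρ.pos_eq (by rw [e0]; omega) (by rw [e1]; omega)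
  rw [LGraph.cost, e0, e1, ← Finset.range_eq_Ico,
    sum_theLoss D hpos, risk, ← mul_assoc, mul_one_div_cancel hn'.ne', one_mul]
  have hle : ∀ i : Fin n, ℓ ((I.V (ρ (layer D i)) : ℝ) / I.Q) (D i).2 ≤
      ℓ (g (D i).1) (D i).2 + θ.L * (1 / n) := by
    intro i
    have hV : I.V (ρ (layer D i)) ≤ I.Q :=
      I.graph.E_Q (hρ.edge _ (by rw [e0]; omega) (by rw [e1]; exact layer_lt D i))
    have h1 := hℓ ((I.V (ρ (layer D i)) : ℝ) / I.Q)
      ⟨by positivity, by rw [div_le_one hQ']; exact_mod_cast hV⟩ _ (g2 (D i).1) _ (D i).2.2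
    have h2 := hclose ((rankIso X).symm (D i).1)
    simp only [Function.comp, OrderIso.apply_symm_apply] at h2
    have h3 := (le_abs_self _).trans (h1.trans (mul_le_mul_of_nonneg_left h2 hL))
    have h4 : ((I.n : ℕ) : ℝ) = n := rfl
    rw [h4] at h3
    linarith
  refine (Finset.sum_le_sum fun i _ => hle i).trans ?_
  rw [Finset.sum_add_distrib, Finset.sum_const, Finset.card_univ, Fintype.card_fin, nsmul_eq_mul]
  refine le_of_eq ?_
  field_simp

theorem mechanism_support (hX : 2 ≤ Fintype.card X) (hn : 1 ≤ n) (hε : 0 ≤ θ.ε) (hL : 0 ≤ θ.L)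
    (hk : 1 ≤ θ.k) (hLf : 0 ≤ θ.Lf) (D : Dataset X n) :
    ((mainProg v).mechanism ℓ θ D).support ⊆ feasible v θ.k θ.Lf X := by
  rw [mechanism_eq v ℓ θ D hX hn hε hL, PMF.support_map]
  rintro _ ⟨s, hs, rfl⟩
  exact decode_feasible hX hn hk hLf (LGraph.levels_valid
    (Inst.reach (by change 1 ≤ Fintype.card X; omega) hk) _ _ _ s hs)

theorem size_le_pow (I : Inst) (hn : 1 ≤ I.n) (hm : 2 ≤ I.m) : I.N ≤ (I.n * I.m) ^ 12 := by
  have hp : 2 ≤ I.n * I.m := hm.trans (Nat.le_mul_of_pos_left _ hn)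
  have hmp : I.m ≤ I.n * I.m := Nat.le_mul_of_pos_left _ hn
  have hB : I.B ≤ (I.n * I.m) ^ 3 := by
    unfold Inst.B Inst.Q
    generalize I.n * I.m = p at hp hmp ⊢
    -- The base is p + m + 3 ≤ 4p, as m ≤ p and p ≥ 2.
    have : 4 * p ≤ p ^ 3 := by
      calc 4 * p ≤ (p * p) * p := Nat.mul_le_mul_right _ (Nat.mul_le_mul hp hp)
        _ = p ^ 3 := by ring
    omega
  calc I.N = I.B ^ 4 := by unfold Inst.N; ring
    _ ≤ ((I.n * I.m) ^ 3) ^ 4 := Nat.pow_le_pow_left hB 4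
    _ = _ := by ring

theorem clog_le {n : ℕ} (hn : 1 ≤ n) : (Nat.clog 2 n : ℝ) ≤ 2 * (1 + Real.log n) := by
  have h1 : 2 ^ Nat.clog 2 n ≤ 2 * n :=
    (pow_clog_bounds (I := ⟨.convex, 1, n, 1, 1⟩) hn le_rfl).1
  have h2 : (2 : ℝ) ^ Nat.clog 2 n ≤ 2 * n := by exact_mod_cast h1
  have hn' : (0 : ℝ) < n := by exact_mod_cast hn
  have h3 := Real.log_le_log (by positivity) h2
  rw [Real.log_pow, Real.log_mul (by norm_num) hn'.ne'] at h3
  have h4 := Real.log_two_gt_d9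
  have h5 : 0 ≤ Real.log n := Real.log_nonneg (by exact_mod_cast hn)
  nlinarith

/-- The 3L consists of L for rounding the competitor and 2L for the walk. With u = 1 + log n, T ≤ 2u
levels and T(T+1) ≤ 6u² give 12u³, and log N ≤ 24u log m gives the fourth power of u. The constants
are 4·12·24 = 1152 for the noise and 6 for 3L, which uses ε ≤ 1 and log m ≥ 1/2. -/
theorem sum_noise_le {ε L : ℝ} (hε : 0 < ε) (hε1 : ε ≤ 1) (hL : 0 < L) {n m N : ℕ} (hn : 1 ≤ n)
    (hm : 2 ≤ m) (hN0 : 1 ≤ N) (hN : N ≤ (n * m) ^ 12) :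
    3 * L + ∑ t ∈ Finset.range (Nat.clog 2 n), ((2 : ℝ) ^ t * (Real.log N / temp ε L (2 ^ t) t)) ≤
      1200 * (L * Real.log m / ε) * (1 + Real.log n) ^ 4 := by
  have hn' : (0 : ℝ) < n := by exact_mod_cast hn
  have hm' : (0 : ℝ) < m := by exact_mod_cast (by omega : 0 < m)
  set u := 1 + Real.log n with hu
  have hu1 : 1 ≤ u := by
    have : 0 ≤ Real.log n := Real.log_nonneg (by exact_mod_cast hn)
    linarith
  set T := Nat.clog 2 n with hT
  have hTu : (T : ℝ) ≤ 2 * u := clog_le hn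
  have hT0 : (0 : ℝ) ≤ T := Nat.cast_nonneg _
  have hlm : 1 / 2 ≤ Real.log m := by
    have h1 : Real.log 2 ≤ Real.log m := Real.log_le_log (by norm_num) (by exact_mod_cast hm)
    linarith [Real.log_two_gt_d9]
  have hlN0 : 0 ≤ Real.log N := Real.log_nonneg (by exact_mod_cast hN0)
  have hlN : Real.log N ≤ 24 * (u * Real.log m) := by
    have h1 : (N : ℝ) ≤ (n * m) ^ 12 := by exact_mod_cast hN
    have h2 := Real.log_le_log (by exact_mod_cast hN0) h1
    rw [Real.log_pow, Real.log_mul hn'.ne' hm'.ne'] at h2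
    push_cast at h2
    nlinarith
  have hterm : ∀ t ∈ Finset.range T, (2 : ℝ) ^ t * (Real.log N / temp ε L (2 ^ t) t) ≤
      4 * L * (T * (T + 1)) * Real.log N / ε := by
    intro t ht
    have ht' : (t : ℝ) + 1 ≤ T := by exact_mod_cast Finset.mem_range.1 ht
    have e : (2 : ℝ) ^ t * (Real.log N / temp ε L (2 ^ t) t) =
        4 * L * ((t + 1) * (t + 2)) * Real.log N / ε := by
      rw [temp]
      push_cast
      field_simp
    rw [e]
    refine div_le_div_of_nonneg_right (mul_le_mul_of_nonneg_right (mul_le_mul_of_nonneg_left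
      ?_ (by positivity)) hlN0) hε.le
    exact mul_le_mul ht' (by linarith) (by positivity) hT0
  have hsum := Finset.sum_le_sum hterm
  rw [Finset.sum_const, Finset.card_range, nsmul_eq_mul] at hsum
  have hu0 : 0 ≤ u := by linarith
  have hT3 : (T : ℝ) * (T * (T + 1)) ≤ 12 * u ^ 3 := by
    calc (T : ℝ) * (T * (T + 1)) ≤ (2 * u) * ((2 * u) * (3 * u)) := by
          gcongr
          linarith
      _ = _ := by ring
  have h1 : (T : ℝ) * (4 * L * (T * (T + 1)) * Real.log N / ε) ≤
      1152 * (L * Real.log m / ε) * u ^ 4 := by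
    calc (T : ℝ) * (4 * L * (T * (T + 1)) * Real.log N / ε)
        = 4 * L / ε * ((T * (T * (T + 1))) * Real.log N) := by ring
      _ ≤ 4 * L / ε * ((12 * u ^ 3) * (24 * (u * Real.log m))) := by gcongr
      _ = _ := by ring
  have h2 : 3 * L ≤ 6 * (L * Real.log m / ε) * u ^ 4 := by
    have h3 : L ≤ 2 * (L * Real.log m / ε) := by
      rw [← mul_div_assoc, le_div_iff₀ hε]
      nlinarith
    have h4 : (1 : ℝ) ≤ u ^ 4 := one_le_pow₀ hu1
    nlinarith
  have h5 : 0 ≤ (L * Real.log m / ε) * u ^ 4 := by positivity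
  linarith

theorem mechanism_utility (hX : 2 ≤ Fintype.card X) (hn : 1 ≤ n) (hε : 0 < θ.ε) (hε1 : θ.ε ≤ 1)
    (hL : 0 ≤ θ.L) (hℓ : LipschitzLoss θ.L ℓ) (hk : 1 ≤ θ.k) (hLf : 0 ≤ θ.Lf) (D : Dataset X n) :
    ExpectedExcessRiskLE ℓ ((mainProg v).mechanism ℓ θ D) D (feasible v θ.k θ.Lf X)
      (1200 * (θ.L * Real.log (Fintype.card X) / (θ.ε * n)) * (1 + Real.log n) ^ 4) := by
  set I := theInst v X n θ with hI
  set T := Nat.clog 2 n with hT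
  have hn' : (0 : ℝ) < n := by exact_mod_cast hn
  set μ := I.graph.levels (fun t => temp θ.ε θ.L (2 ^ t) t) (theLoss v ℓ θ D) T with hμ
  have hμf : μ.support.Finite := LGraph.levels_finite _ _ _
  have hsupp := mechanism_support (v := v) (ℓ := ℓ) hX hn hε.le hL hk hLf D
  have heq : (mainProg v).mechanism ℓ θ D = μ.map (decode I X) :=
    mechanism_eq v ℓ θ D hX hn hε.le hL
  have hfin : ((mainProg v).mechanism ℓ θ D).support.Finite := by
    rw [heq]
    exact finite_support_map _ hμf
  have hR : I.graph.Reach 1 1 0 I.graph.sink :=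
    Inst.reach (by change 1 ≤ Fintype.card X; omega) hk
  refine ⟨_, hasSum_ex hfin _, fun g hg => ?_⟩
  rcases hL.eq_or_lt with hL0 | hL0
  -- For L = 0 the inverse temperature is a division by zero, that is 0, and the utility bound for
  -- the levels is not available; but then all feasible functions have the same risk.
  · rw [← hL0] at hℓ
    have h1 := ex_mono hfin (g := fun f => risk ℓ f D) (g' := fun _ => risk ℓ g D)
      fun f hf => (risk_eq_of_lipschitz_zero hℓ D (hsupp hf).2.1 hg.2.1).le
    rw [ex_const hfin] at h1
    rw [← hL0]
    simp only [zero_mul, zero_div, mul_zero]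
    linarith
  · have h1 : ex ((mainProg v).mechanism ℓ θ D) (fun f => risk ℓ f D) ≤
        1 / n * (ex μ (fun s => I.graph.potential (theLoss v ℓ θ D) (2 ^ T) s.1) + 2 * θ.L) := by
      rw [heq, ex_map hμf, ← ex_add_const hμf, ← ex_const_mul]
      exact ex_mono hμf fun s hs => risk_decode_le hX hn hL hℓ D
        (LGraph.levels_valid hR _ _ _ s hs)
    have h2 := LGraph.ex_levels_le hR (fun t => temp θ.ε θ.L (2 ^ t) t)
      (fun t => by unfold temp; positivity) (theLoss v ℓ θ D) T
    have h3 := D_le_risk hX hn hL hℓ hk D hg (v := v)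
    have h4 := sum_noise_le hε hε1 hL0 hn hX
      (show 1 ≤ I.N by have := I.Q_lt_N; omega) (size_le_pow I hn hX)
    have h5 : 1 / n * (ex μ (fun s => I.graph.potential (theLoss v ℓ θ D) (2 ^ T) s.1) + 2 * θ.L) ≤
        1 / n * (n * risk ℓ g D +
          1200 * (θ.L * Real.log (Fintype.card X) / θ.ε) * (1 + Real.log n) ^ 4) := by
      refine mul_le_mul_of_nonneg_left ?_ (by positivity)
      have h6 : I.graph.N = I.N := rfl
      rw [h6] at h2
      linarith
    have h7 : 1 / n * (n * risk ℓ g D +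
        1200 * (θ.L * Real.log (Fintype.card X) / θ.ε) * (1 + Real.log n) ^ 4) = risk ℓ g D +
          1200 * (θ.L * Real.log (Fintype.card X) / (θ.ε * n)) * (1 + Real.log n) ^ 4 := by
      field_simp
    linarith

end Problem

/-! ### Running time of the whole program -/

theorem bodyProg_safe (v : Variant) : (bodyProg v).Safe := by
  simp [bodyProg, setupProg, levelsProg, walkProg, outProg, divModProg, incrProg, lossProg,
    numLevelsProg, levelProg, gainProg, cellProg, cellTablesProg, tableProg, candidateProg,
    mergeProg, walkStepProg, Prog.Safe, upto, reg]

/-- The sizes are timed separately: this part writes the very cell that bounds all later loops, so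
it is not safe, but it has no loops. -/
theorem sizesProg_time (ℓ : ℝ → ℝ → ℝ) (s : Mem) : ∀ r ∈ (sizesProg.run ℓ s).support, r.2 ≤ 100 := by
  simp [sizesProg, Prog.run, NExp.cost, reg, mE, nE, PMF.pure_map]

theorem mainProg_time (v : Variant) : ∃ d : ℕ, ∀ (X : Type*) [LinearOrder X] [Fintype X] (n : ℕ)
    (ℓ : ℝ → ℝ → ℝ) (θ : Params) (D : Dataset X n), 2 ≤ Fintype.card X → 1 ≤ n →
      (mainProg v).RunsWithin ℓ θ D ((n * Fintype.card X) ^ d) := by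
  obtain ⟨C, E, hCE⟩ := (bodyProg v).time_le
  -- With p = n·m ≥ 2, N + 1 ≤ p^13 accounts for 13E, and the constant factor 100 + C is absorbed as
  -- p^(100 + C).
  refine ⟨100 + C + 13 * E, fun X _ _ n ℓ θ D hX hn r hr => ?_⟩
  set I := theInst v X n θ with hI
  set p := n * Fintype.card X with hp
  have hp2 : 2 ≤ p := hX.trans (Nat.le_mul_of_pos_left _ hn)
  simp only [mainProg, Prog.run, PMF.mem_support_bind_iff, PMF.mem_support_map_iff] at hr
  obtain ⟨r1, hr1, r2, hr2, rfl⟩ := hr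
  have h1 := sizesProg_time _ _ r1 hr1
  have h2 := sizes_ens (ℓ := ℓ) (s := initMem θ D) I (by simp [initMem, hI, theInst])
    (by simp [initMem, hI, theInst]) r1.1 (by
      rw [Prog.dist, PMF.mem_support_map_iff]
      exact ⟨r1, hr1, rfl⟩)
  have h3 := ((bodyProg v).run_time (bodyProg_safe v) r1.1 h2.2.2.2.1 r2 hr2).1
  have h4 : I.N ≤ p ^ 12 := size_le_pow I hn hX
  have h5 : I.N + 1 ≤ p ^ 13 := by
    have : 2 * p ^ 12 ≤ p ^ 13 := by
      rw [pow_succ' p 12]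
      exact Nat.mul_le_mul_right _ hp2
    have : 1 ≤ p ^ 12 := Nat.one_le_pow _ _ (by omega)
    omega
  have h6 : (I.N + 1) ^ E ≤ p ^ (13 * E) := by
    rw [pow_mul]
    exact Nat.pow_le_pow_left h5 E
  have h7 : 1 ≤ p ^ (13 * E) := Nat.one_le_pow _ _ (by omega)
  have h8 : 100 + C ≤ p ^ (100 + C) :=
    (Nat.lt_two_pow_self (n := 100 + C)).le.trans (Nat.pow_le_pow_left hp2 _)
  calc r1.2 + r2.2 ≤ 100 + C * (I.N + 1) ^ E := Nat.add_le_add h1 (h3.trans (hCE _))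
    _ ≤ 100 * p ^ (13 * E) + C * p ^ (13 * E) :=
      Nat.add_le_add (Nat.le_mul_of_pos_right _ h7) (Nat.mul_le_mul_left _ h6)
    _ = (100 + C) * p ^ (13 * E) := by ring
    _ ≤ p ^ (100 + C) * p ^ (13 * E) := Nat.mul_le_mul_right _ h8
    _ = _ := (pow_add _ _ _).symm

end PrivIso
end

theorem theorem4 (v : PrivIso.Variant) :
    ∃ (P : PrivIso.Prog) (C : ℝ) (c d : ℕ),
      ∀ (X : Type*) [LinearOrder X] [Fintype X] (n : ℕ) (ℓ : ℝ → ℝ → ℝ) (θ : PrivIso.Params),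
        2 ≤ Fintype.card X → 1 ≤ n →
        0 < θ.ε → θ.ε ≤ 1 → 0 ≤ θ.L → PrivIso.LipschitzLoss θ.L ℓ → 1 ≤ θ.k → 0 < θ.Lf →
        PrivIso.PureDP θ.ε (fun D : PrivIso.Dataset X n => P.mechanism ℓ θ D) ∧
        ∀ D : PrivIso.Dataset X n,
          (P.mechanism ℓ θ D).support ⊆ PrivIso.feasible v θ.k θ.Lf X ∧
          PrivIso.ExpectedExcessRiskLE ℓ (P.mechanism ℓ θ D) D
            (PrivIso.feasible v θ.k θ.Lf X)
            (C * (θ.L * Real.log (Fintype.card X) / (θ.ε * n)) * (1 + Real.log n) ^ c) ∧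
          P.RunsWithin ℓ θ D ((n * Fintype.card X) ^ d) := by
  obtain ⟨d, hd⟩ := PrivIso.mainProg_time v
  refine ⟨PrivIso.mainProg v, 1200, 4, d, fun X _ _ n ℓ θ hX hn hε hε1 hL hℓ hk hLf =>
    ⟨PrivIso.mechanism_private hX hn hε.le hL hℓ hk, fun D =>
      ⟨PrivIso.mechanism_support hX hn hε.le hL hk hLf.le D,
        PrivIso.mechanism_utility hX hn hε hε1 hL hℓ hk hLf.le D, hd X n ℓ θ D hX hn⟩⟩⟩
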